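/- Let $n\ge 2$. Write $\mathbf R^n_+=\{x: x_1>0\}$, $B_r^+=\{x: x_1>0,\ |x|<r\}$, $\partial B_r^+=\{x: x_1>0,\ |x|=r\}$, $a^+=\max(a,0)$, $a^-=\min(a,0)$. For $U\subset\mathbf R^n_+$ open, $V^{1,2}(U)$ is the set of $v\in W^{1,2}(U)$ with $$\int_U\Big(x_1|\nabla v^+|^2+\tfrac1{x_1}|\nabla v^-|^2\Big)dx<\infty,\qquad \int_U\Big(x_1(v^+)^2+\tfrac1{x_1}(v^-)^2\Big)dx<\infty,$$ and $V^{1,2}_{\rm loc}(\mathbf R^n_+)$ is the set of $v\in W^{1,2}_{\rm loc}(\mathbf R^n_+)$ for which these integrals over $B_R^+$ are finite for every $R>0$. A sequence $v_m$ (each $v_m$ defined on a domain that contains $B_R^+$ once $m\ge m(R)$) converges weakly (strongly) to $v$ in $V^{1,2}_{\rm loc}(\mathbf R^n_+)$ if, for every $R>0$, $v_m^+\to v^+$ and $\nabla v_m^+\to\nabla v^+$ weakly (strongly) in $L^2(B_R^+;x_1\,dx)$, and $v_m^-\to v^-$ and $\nabla v_m^-\to\nabla v^-$ weakly (strongly)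 in $L^2(B_R^+;\frac1{x_1}dx)$. Let $\Omega\subset\{x_1\ge 0\}$ be connected and relatively open in $\{x_1\ge0\}$. A function $u\in V^{1,2}(\Omega\cap\{x_1>0\})$ is a *variational solution* if $u\in C^0(\Omega\cap\{x_1>0\})\cap C^2(\Omega\cap\{u\neq0\}\cap\{x_1>0\})$; for every $x^0\in\Omega\cap\{x_1=0\}$, $x_1u\,\partial_1u\to0$ as $x\to x^0$ in $\Omega\cap\{x_1>0\}\cap\{u>0\}$ and $u\,\partial_1u/x_1\to0$ as $x\to x^0$ in $\Omega\cap\{x_1>0\}\cap\{u<0\}$; and $$\int_\Omega\Big[\big(x_1|\nabla u^+|^2+\tfrac1{x_1}|\nabla u^-|^2\big)\operatorname{div}\phi-2x_1\nabla u^+D\phi\nabla u^+-\tfrac2{x_1}\nabla u^-D\phi\nabla u^-+\big(|\nabla u^+|^2-\tfrac1{x_1^2}|\nabla u^-|^2\big)\phi_1\Big]dx=0$$ for every $\phi\in C^1_0(\Omega;\mathbf R^n)$ with $\phi_1=0$ on $\{x_1=0\}$. **Proposition.** Let $u$ be a variational solution in $\Omega$, let $\beta\in(0,1/2)$, and assume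 $0\in\Omega$ and that for some $C$ and some $r_0>0$ with $B_{r_0}^+\subset\Omega$, $$|\nabla u^+|\le C|x|^{\beta-1}\quad\text{and}\quad |\nabla u^-|\le C\sqrt{x_1}\,|x|^{\beta-1/2}\quad\text{a.e. in }B_{r_0}^+.$$ Assume $0\in\partial\{u>0\}$; here $u$ is extended to $\{x_1=0\}$ near $0$ by continuity (the bounds allow this), and the boundary is taken relative to $\Omega$. For small $r>0$ put $$M(r)=r^{-2\beta-n+1}\!\int_{B_r^+}\!\Big(x_1|\nabla u^+|^2+\tfrac1{x_1}|\nabla u^-|^2\Big)dx-\beta r^{-2\beta-n}\!\int_{\partial B_r^+}\!x_1(u^+)^2dS-(\beta+1)r^{-2\beta-n}\!\int_{\partial B_r^+}\!\tfrac1{x_1}(u^-)^2dS .$$ Then: 1. For all small $r>0$ the integrals in $M(r)$ are finite, and $M(0+)=\lim_{r\to0+}M(r)$ exists and is finite. 2. Let $r_m>0$, $r_m\to0$, be such that $u_m(x)=u^+(r_mx)/r_m^{\beta}+u^-(r_mx)/r_m^{\beta+1}$ converges weakly in $V^{1,2}_{\rm loc}(\mathbf R^n_+)$ to some $u_0\in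 V^{1,2}_{\rm loc}(\mathbf R^n_+)$. Then, for a suitable representative of $u_0$, $u_0^+(\lambda x)=\lambda^\beta u_0^+(x)$ and $u_0^-(\lambda x)=\lambda^{\beta+1}u_0^-(x)$ for all $\lambda>0$ and $x\in\mathbf R^n_+$. 3. For every sequence as in 2, $u_m\to u_0$ strongly in $V^{1,2}_{\rm loc}(\mathbf R^n_+)$. 4. $M(0+)=0$. -/

import Mathlib

open MeasureTheory Filter Topology Metric
open scoped ContDiff

noncomputable section

namespace TwoPhase

/-- The Euclidean space `ℝⁿ`; the first coordinate `x₁` is `x 0`. -/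
abbrev Rn (n : ℕ) : Type := EuclideanSpace ℝ (Fin n)

variable {n : ℕ} [NeZero n]

/-- The open half-space `{x₁ > 0}`. -/
def halfSpace (n : ℕ) [NeZero n] : Set (Rn n) := {x | 0 < x 0}

/-- The half-ball `B_R⁺ = {x : x₁ > 0, |x| < R}`. -/
def halfBall (n : ℕ) [NeZero n] (R : ℝ) : Set (Rn n) := {x | 0 < x 0 ∧ ‖x‖ < R}

/-- `Ω ∩ {x₁ > 0}`. -/
def openPart (Ω : Set (Rn n)) : Set (Rn n) := Ω ∩ halfSpace n

/-- `v⁺ = max(v, 0)`. -/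
def pos (v : Rn n → ℝ) : Rn n → ℝ := fun x => max (v x) 0

/-- `v⁻ = min(v, 0)` (a nonpositive function). -/
def neg (v : Rn n → ℝ) : Rn n → ℝ := fun x => min (v x) 0

/-- The unit vector in the `x₁` direction. -/
def e₁ (n : ℕ) [NeZero n] : Rn n := EuclideanSpace.single 0 1

/-- The measure `x₁ dx` on `U` (for `U ⊆ {x₁ > 0}`). -/
def muPos (U : Set (Rn n)) : Measure (Rn n) :=
  (volume.restrict U).withDensity fun x => ENNReal.ofReal (x 0)

/-- The measure `(1 / x₁) dx` on `U` (for `U ⊆ {x₁ > 0}`). -/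
def muNeg (U : Set (Rn n)) : Measure (Rn n) :=
  (volume.restrict U).withDensity fun x => ENNReal.ofReal (1 / x 0)

/-- `G` is a distributional gradient of `v` in the open set `U`. -/
structure HasWeakGrad (U : Set (Rn n)) (v : Rn n → ℝ) (G : Rn n → Rn n) : Prop where
  locallyIntegrable : LocallyIntegrableOn v U
  locallyIntegrable_grad : LocallyIntegrableOn G U
  integral_eq : ∀ φ : Rn n → ℝ, ContDiff ℝ ∞ φ → HasCompactSupport φ → tsupport φ ⊆ U →
    ∀ e : Rn n, ∫ x in U, v x * fderiv ℝ φ x e = -∫ x in U, inner ℝ (G x) e * φ x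

open Classical in
/-- The distributional gradient of `v` in the open set `U` (unique a.e. in `U`, when it exists). -/
def weakGrad (U : Set (Rn n)) (v : Rn n → ℝ) : Rn n → Rn n :=
  if h : ∃ G, HasWeakGrad U v G then h.choose else 0

/-- `v ∈ V^{1,2}(U)`, `U ⊆ {x₁ > 0}` open: `v ∈ W^{1,2}(U)` and
`∫_U x₁ |∇v⁺|² + |∇v⁻|² / x₁ < ∞`, `∫_U x₁ (v⁺)² + (v⁻)² / x₁ < ∞`.
(`v ∈ W^{1,2}(U)` is the same as `v⁺ ∈ W^{1,2}(U)` and `v⁻ ∈ W^{1,2}(U)`.) -/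
structure MemV (U : Set (Rn n)) (v : Rn n → ℝ) : Prop where
  memLp : MemLp v 2 (volume.restrict U)
  exists_grad_pos : ∃ G, HasWeakGrad U (pos v) G
  exists_grad_neg : ∃ G, HasWeakGrad U (neg v) G
  memLp_grad_pos : MemLp (weakGrad U (pos v)) 2 (volume.restrict U)
  memLp_grad_neg : MemLp (weakGrad U (neg v)) 2 (volume.restrict U)
  weighted_pos : MemLp (pos v) 2 (muPos U)
  weighted_neg : MemLp (neg v) 2 (muNeg U)
  weighted_grad_pos : MemLp (weakGrad U (pos v)) 2 (muPos U)
  weighted_grad_neg : MemLp (weakGrad U (neg v)) 2 (muNeg U)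

/-- `v ∈ V^{1,2}_loc(ℝⁿ₊)`: `v ∈ W^{1,2}_loc({x₁ > 0})`, and the weighted integrals are finite on
`B_R⁺` for every `R > 0`. (The weights are bounded below by positive constants on compact subsets
of `{x₁ > 0}`, so the weighted integrability contains the unweighted local one.) -/
structure MemVLoc (v : Rn n → ℝ) : Prop where
  exists_grad_pos : ∃ G, HasWeakGrad (halfSpace n) (pos v) G
  exists_grad_neg : ∃ G, HasWeakGrad (halfSpace n) (neg v) G
  weighted_pos : ∀ R : ℝ, 0 < R → MemLp (pos v) 2 (muPos (halfBall n R))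
  weighted_neg : ∀ R : ℝ, 0 < R → MemLp (neg v) 2 (muNeg (halfBall n R))
  weighted_grad_pos : ∀ R : ℝ, 0 < R →
    MemLp (weakGrad (halfSpace n) (pos v)) 2 (muPos (halfBall n R))
  weighted_grad_neg : ∀ R : ℝ, 0 < R →
    MemLp (weakGrad (halfSpace n) (neg v)) 2 (muNeg (halfBall n R))

/-- Weak convergence in `L²(μ; F)`. -/
def WeakL2 {F : Type*} [NormedAddCommGroup F] [InnerProductSpace ℝ F] (μ : Measure (Rn n))
    (f : ℕ → Rn n → F) (f₀ : Rn n → F) : Prop :=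
  ∀ g : Rn n → F, MemLp g 2 μ →
    Tendsto (fun m => ∫ x, inner ℝ (f m x) (g x) ∂μ) atTop (𝓝 (∫ x, inner ℝ (f₀ x) (g x) ∂μ))

/-- Strong convergence in `L²(μ; F)`. -/
def StrongL2 {F : Type*} [NormedAddCommGroup F] [InnerProductSpace ℝ F] (μ : Measure (Rn n))
    (f : ℕ → Rn n → F) (f₀ : Rn n → F) : Prop :=
  Tendsto (fun m => eLpNorm (fun x => f m x - f₀ x) 2 μ) atTop (𝓝 0)

/-- `v_m → v₀` weakly in `V^{1,2}_loc(ℝⁿ₊)`: on every `B_R⁺`, the positive parts and their gradients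
converge weakly in `L²(x₁ dx)`, the negative parts and their gradients in `L²(dx / x₁)`.
Only large `m` (depending on `R`) matter, so `v_m` may be meaningful on a domain that
contains `B_R⁺` only for large `m`. -/
structure WeakConvV (v : ℕ → Rn n → ℝ) (v₀ : Rn n → ℝ) : Prop where
  weighted_pos : ∀ R : ℝ, 0 < R → WeakL2 (muPos (halfBall n R)) (fun m => pos (v m)) (pos v₀)
  weighted_neg : ∀ R : ℝ, 0 < R → WeakL2 (muNeg (halfBall n R)) (fun m => neg (v m)) (neg v₀)
  weighted_grad_pos : ∀ R : ℝ, 0 < R → WeakL2 (muPos (halfBall n R))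
    (fun m => weakGrad (halfBall n R) (pos (v m)))
    (weakGrad (halfBall n R) (pos v₀))
  weighted_grad_neg : ∀ R : ℝ, 0 < R → WeakL2 (muNeg (halfBall n R))
    (fun m => weakGrad (halfBall n R) (neg (v m)))
    (weakGrad (halfBall n R) (neg v₀))

/-- `v_m → v₀` strongly in `V^{1,2}_loc(ℝⁿ₊)`. -/
structure StrongConvV (v : ℕ → Rn n → ℝ) (v₀ : Rn n → ℝ) : Prop where
  weighted_pos : ∀ R : ℝ, 0 < R → StrongL2 (muPos (halfBall n R)) (fun m => pos (v m)) (pos v₀)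
  weighted_neg : ∀ R : ℝ, 0 < R → StrongL2 (muNeg (halfBall n R)) (fun m => neg (v m)) (neg v₀)
  weighted_grad_pos : ∀ R : ℝ, 0 < R → StrongL2 (muPos (halfBall n R))
    (fun m => weakGrad (halfBall n R) (pos (v m)))
    (weakGrad (halfBall n R) (pos v₀))
  weighted_grad_neg : ∀ R : ℝ, 0 < R → StrongL2 (muNeg (halfBall n R))
    (fun m => weakGrad (halfBall n R) (neg (v m)))
    (weakGrad (halfBall n R) (neg v₀))

/-- `Ω` is connected and relatively open in the closed half-space `{x₁ ≥ 0}`. -/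
structure IsHalfDomain (Ω : Set (Rn n)) : Prop where
  connected : IsConnected Ω
  relOpen : ∃ Ω' : Set (Rn n), IsOpen Ω' ∧ Ω = Ω' ∩ {x | 0 ≤ x 0}

/-- The divergence of a vector field. -/
def divergence (φ : Rn n → Rn n) (x : Rn n) : ℝ :=
  ∑ i : Fin n, (fderiv ℝ φ x (EuclideanSpace.single i 1)) i

/-- The integrand of the first variation of
`E(v) = ∫_Ω x₁ |∇v⁺|² + |∇v⁻|² / x₁` with respect to the domain variation `φ`, where `P`, `N` stand
for `∇v⁺`, `∇v⁻`. -/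
def firstVariationIntegrand (P N φ : Rn n → Rn n) (x : Rn n) : ℝ :=
  (x 0 * ‖P x‖ ^ 2 + 1 / x 0 * ‖N x‖ ^ 2) * divergence φ x
    - 2 * x 0 * inner ℝ (P x) (fderiv ℝ φ x (P x))
    - 2 / x 0 * inner ℝ (N x) (fderiv ℝ φ x (N x))
    + (‖P x‖ ^ 2 - 1 / (x 0) ^ 2 * ‖N x‖ ^ 2) * φ x 0

/-- Variational solutions of the two-phase problem in `Ω`. The test fields are `C¹` up to
`{x₁ = 0}` and have compact support in `Ω`, which may touch `{x₁ = 0}`. -/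
structure IsVariationalSolution (Ω : Set (Rn n)) (u : Rn n → ℝ) : Prop where
  memV : MemV (openPart Ω) u
  continuousOn : ContinuousOn u (openPart Ω)
  contDiffOn : ContDiffOn ℝ 2 u {x ∈ openPart Ω | u x ≠ 0}
  axis_pos : ∀ x₀ ∈ Ω, x₀ 0 = 0 →
    Tendsto (fun x => x 0 * u x * fderiv ℝ u x (e₁ n)) (𝓝[{x ∈ openPart Ω | 0 < u x}] x₀) (𝓝 0)
  axis_neg : ∀ x₀ ∈ Ω, x₀ 0 = 0 →
    Tendsto (fun x => u x * (fderiv ℝ u x (e₁ n) / x 0)) (𝓝[{x ∈ openPart Ω | u x < 0}] x₀) (𝓝 0)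
  firstVariation : ∀ φ : Rn n → Rn n, ContDiff ℝ 1 φ → HasCompactSupport φ →
    tsupport φ ∩ {x | 0 ≤ x 0} ⊆ Ω → (∀ x, x 0 = 0 → φ x 0 = 0) →
    ∫ x in openPart Ω, firstVariationIntegrand
      (weakGrad (openPart Ω) (pos u)) (weakGrad (openPart Ω) (neg u)) φ x = 0

/-- `u` on `Ω ∩ {x₁ > 0}`, extended by its limits to those points of `{x₁ = 0}` where it has one. -/
def axisExtend (Ω : Set (Rn n)) (u : Rn n → ℝ) : Rn n → ℝ := extendFrom (openPart Ω) u

/-- `x₀ ∈ Ω ∩ ∂{u > 0}`, with the boundary taken relative to `Ω` and `u` extended to `{x₁ = 0}` by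
its limits. -/
def OnFreeBoundary (Ω : Set (Rn n)) (u : Rn n → ℝ) (x₀ : Rn n) : Prop :=
  x₀ ∈ Ω ∧ x₀ ∈ closure {x ∈ Ω | 0 < axisExtend Ω u x} ∧
    x₀ ∈ closure {x ∈ Ω | ¬ 0 < axisExtend Ω u x}

/-- The growth bounds `|∇u⁺| ≤ C |x|^{β-1}` and `|∇u⁻| ≤ C √x₁ |x|^{β-1/2}` in some `B_{r₀}⁺`. -/
def GrowthBounds (Ω : Set (Rn n)) (u : Rn n → ℝ) (β : ℝ) : Prop :=
  ∃ C r₀ : ℝ, 0 < r₀ ∧ halfBall n r₀ ⊆ Ω ∧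
    (∀ᵐ x ∂(volume.restrict (halfBall n r₀)),
      ‖weakGrad (openPart Ω) (pos u) x‖ ≤ C * ‖x‖ ^ (β - 1)) ∧
    (∀ᵐ x ∂(volume.restrict (halfBall n r₀)),
      ‖weakGrad (openPart Ω) (neg u) x‖ ≤ C * √(x 0) * ‖x‖ ^ (β - 1 / 2))

/-- The unit half-sphere `∂B_1⁺ = {y : |y| = 1, y₁ > 0}`. -/
def halfSphere (n : ℕ) [NeZero n] : Set (sphere (0 : Rn n) 1) := {y | 0 < (y : Rn n) 0}

/-- The integrand of `I(r)`. -/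
def energyDensity (Ω : Set (Rn n)) (u : Rn n → ℝ) (x : Rn n) : ℝ :=
  x 0 * ‖weakGrad (openPart Ω) (pos u) x‖ ^ 2 + 1 / x 0 * ‖weakGrad (openPart Ω) (neg u) x‖ ^ 2

/-- `I(r) = ∫_{B_r⁺} x₁ |∇u⁺|² + |∇u⁻|² / x₁ dx`. -/
def energyI (Ω : Set (Rn n)) (u : Rn n → ℝ) (r : ℝ) : ℝ :=
  ∫ x in halfBall n r, energyDensity Ω u x

/-- The integrand `x₁ (u⁺)²` of `J₊(r)`, at the point `x = r y` of `∂B_r⁺`. -/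
def densityJPos (u : Rn n → ℝ) (r : ℝ) (y : sphere (0 : Rn n) 1) : ℝ :=
  (r • (y : Rn n)) 0 * pos u (r • (y : Rn n)) ^ 2

/-- The integrand `(u⁻)² / x₁` of `J₋(r)`, at the point `x = r y` of `∂B_r⁺`. -/
def densityJNeg (u : Rn n → ℝ) (r : ℝ) (y : sphere (0 : Rn n) 1) : ℝ :=
  1 / (r • (y : Rn n)) 0 * neg u (r • (y : Rn n)) ^ 2

/-- `J₊(r) = ∫_{∂B_r⁺} x₁ (u⁺)² dS`, in the coordinate `x = r y`, `dS(x) = r^{n-1} dS(y)`. -/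
def energyJPos (u : Rn n → ℝ) (r : ℝ) : ℝ :=
  r ^ (n - 1) * ∫ y in halfSphere n, densityJPos u r y ∂(volume : Measure (Rn n)).toSphere

/-- `J₋(r) = ∫_{∂B_r⁺} (u⁻)² / x₁ dS`, in the coordinate `x = r y`, `dS(x) = r^{n-1} dS(y)`. -/
def energyJNeg (u : Rn n → ℝ) (r : ℝ) : ℝ :=
  r ^ (n - 1) * ∫ y in halfSphere n, densityJNeg u r y ∂(volume : Measure (Rn n)).toSphere

/-- `M(r) = r^{-2β-n+1} I(r) - β r^{-2β-n} J₊(r) - (β+1) r^{-2β-n} J₋(r)`. -/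
def weissM (Ω : Set (Rn n)) (u : Rn n → ℝ) (β r : ℝ) : ℝ :=
  r ^ (-2 * β - n + 1) * energyI Ω u r - β * r ^ (-2 * β - n) * energyJPos u r
    - (β + 1) * r ^ (-2 * β - n) * energyJNeg u r

/-- The integrals in `M(r)` are finite. -/
def WeissFinite (Ω : Set (Rn n)) (u : Rn n → ℝ) (r : ℝ) : Prop :=
  IntegrableOn (energyDensity Ω u) (halfBall n r) ∧
    IntegrableOn (densityJPos u r) (halfSphere n) (volume : Measure (Rn n)).toSphere ∧
    IntegrableOn (densityJNeg u r) (halfSphere n) (volume : Measure (Rn n)).toSphere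

/-- The blow-up `x ↦ u⁺(ρx) / ρ^β + u⁻(ρx) / ρ^{β+1}`. -/
def blowUp (u : Rn n → ℝ) (β ρ : ℝ) : Rn n → ℝ :=
  fun x => pos u (ρ • x) / ρ ^ β + neg u (ρ • x) / ρ ^ (β + 1)

/-- `w` is, for a suitable representative of its a.e. class on `ℝⁿ₊`, such that `w⁺` is homogeneous
of degree `a` and `w⁻` is homogeneous of degree `b` in `ℝⁿ₊`. -/
def TwoPhaseHomogeneous (w : Rn n → ℝ) (a b : ℝ) : Prop :=
  ∃ v : Rn n → ℝ, v =ᵐ[volume.restrict (halfSpace n)] w ∧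
    ∀ l : ℝ, 0 < l → ∀ x ∈ halfSpace n,
      pos v (l • x) = l ^ a * pos v x ∧ neg v (l • x) = l ^ b * neg v x

end TwoPhase

end

open MeasureTheory Filter Topology Metric
open scoped ContDiff

set_option linter.unusedSectionVars false

noncomputable section

namespace TwoPhase

variable {n : ℕ} [NeZero n]

/-! Put f = u⁺ and g = -u⁻. Both are instances of one notion, `IsPhase`, with a parameter σ (0 for
f, 1 for g): the weight is w = x₁^(1-2σ), the degree is β+σ, and w P is weakly divergence free where
the function is positive. The parameter cancels in all integrals that matter; for instance w|P|² is
at most a constant times x₁^(2β-1), which is integrable up to the axis because β > 0.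

The hypotheses give two such phases (`GrowthBounds.exists_isTwoPhase`). Stationarity under
translations of the domain gives the equation where u ≠ 0. The gradient bound for f makes f Hölder
continuous of exponent β up to the axis, and since the origin is a free boundary point this yields f
≤ K|x|^β. The function g vanishes on the axis because ∫ g²/x₁ is finite, and its gradient bound can
then be integrated from there. Nothing is known about the regularity of the free boundary. It is
crossed only by the C¹ truncations `trunc ε ∘ f`, which vanish near {f = 0}, and by the square f²,
which is C¹ everywhere.

Monotonicity. Variation along Ψ(|x|) x gives a Pohozaev identity on almost every sphere, testing the
equation with Ψ(|x|) f gives Green's formula, and the spherical means are differentiated along rays.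
Together (`IsTwoPhase.weissFun_sub`) M is the integral of 2 s^(-2β-n-1) [∫ x₁ (x·∇f - βf)² + ∫ (x·∇g
- (β+1)g)²/x₁] ≥ 0, the inner integrals being over ∂B_s⁺. As M is bounded below, M(0+) exists.

M(0+) = 0. Green's formula also writes M(s) as s^(-2β-n) times the integrals of w f (x·∇f - af) over
∂B_s⁺, summed over the phases (a is the degree). Young's inequality and the growth bounds then give
|M| ≤ t⁻¹ s M' + tK for every t > 0. If M tended to L ≠ 0, then s M' would stay above a positive
constant for small s, so M(2r) - M(r) could not tend to 0 (`IsTwoPhase.tendsto_weissFun`). No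
blow-up limit is needed for this.

Homogeneity. Since M converges, the integral of M' over (r_m a, r_m b) tends to 0. It controls the
L¹ distance on the half-sphere of the squares of the blow-ups on the spheres of radii a and b,
suitably normalised. The blow-ups are equi-Hölder, so weak convergence makes them converge at every
point to a continuous function, and this limit is homogeneous on each ray
(`IsPhase.ray_eq_of_tendsto`).

Strong convergence. It suffices that the cut-off energies of the blow-ups have a limit that does not
exceed the energy of the weak limit. The energies are determined by ∫ w η |∇f_m|² = -∫ w f_m
∇f_m·∇η, whose right-hand side converges. The same identity for the limit comes from testing the
equation of f_m with a truncation of f_k, letting first m, then k tend to infinity, and finally the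
truncation level to 0 (`IsPhaseSeq.eventually_inner_eq`, `IsPhaseSeq.limit_inner_eq`,
`IsPhaseSeq.strongL2_grad`). -/

/-! ### Half-balls and coordinates. -/

lemma continuous_coord (i : Fin n) : Continuous fun x : Rn n => x i := by fun_prop

lemma isOpen_halfSpace : IsOpen (halfSpace n) :=
  isOpen_lt continuous_const (continuous_coord 0)

lemma isOpen_halfBall (R : ℝ) : IsOpen (halfBall n R) :=
  (isOpen_lt continuous_const (continuous_coord 0)).inter (isOpen_lt continuous_norm continuous_const)

lemma halfBall_subset_halfSpace (R : ℝ) : halfBall n R ⊆ halfSpace n := fun _ hx => hx.1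

lemma halfBall_mono {r R : ℝ} (h : r ≤ R) : halfBall n r ⊆ halfBall n R :=
  fun _ hx => ⟨hx.1, hx.2.trans_le h⟩

lemma abs_coord_le_norm (x : Rn n) (i : Fin n) : |x i| ≤ ‖x‖ := by
  simpa using EuclideanSpace.norm_eq x ▸ Real.abs_le_sqrt
    (Finset.single_le_sum (f := fun i => ‖x i‖ ^ 2) (fun _ _ => by positivity) (Finset.mem_univ i) |>.trans' (by simp))

lemma coord_le_norm (x : Rn n) (i : Fin n) : x i ≤ ‖x‖ := (le_abs_self _).trans (abs_coord_le_norm x i)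

/-! ### Boxes and integrals of powers of x₁ near the axis. -/

/-- An open box with sides parallel to the axes. -/
def box (a b : Fin n → ℝ) : Set (Rn n) := {x | ∀ i, x i ∈ Set.Ioo (a i) (b i)}

lemma measurableSet_box (a b : Fin n → ℝ) : MeasurableSet (box a b) := by
  have : box a b = ⋂ i, (fun x : Rn n => x i) ⁻¹' Set.Ioo (a i) (b i) := by
    ext x; simp [box]
  rw [this]
  exact MeasurableSet.iInter fun i => (continuous_coord i).measurable measurableSet_Ioo

lemma lintegral_box_coord (a b : Fin n → ℝ) (g : ℝ → ENNReal) (hg : Measurable g) :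
    ∫⁻ x in box a b, g (x 0) = (∏ j ∈ Finset.univ.erase 0, ENNReal.ofReal (b j - a j)) *
      ∫⁻ t in Set.Ioo (a 0) (b 0), g t := by
  have h := EuclideanSpace.volume_preserving_symm_measurableEquiv_toLp (Fin n)
  have h1 : ∫⁻ x in box a b, g (x 0) =
      ∫⁻ x in Set.univ.pi fun i => Set.Ioo (a i) (b i), g (x 0) := by
    rw [← h.setLIntegral_comp_preimage_emb (MeasurableEquiv.measurableEmbedding _)]
    congr 2
    ext x; simp [box]
  rw [h1, MeasureTheory.volume_pi, Measure.restrict_pi_pi]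
  have h2 := Measure.pi_map_eval (μ := fun i => (volume : Measure ℝ).restrict (Set.Ioo (a i) (b i))) (0 : Fin n)
  have h3 : ∫⁻ x, g (x 0) ∂(Measure.pi fun i => (volume : Measure ℝ).restrict (Set.Ioo (a i) (b i))) =
    ∫⁻ t, g t ∂((Measure.pi fun i => (volume : Measure ℝ).restrict (Set.Ioo (a i) (b i))).map (Function.eval 0)) := by
    rw [lintegral_map hg (measurable_pi_apply _)]
  rw [h3, h2, lintegral_smul_measure, smul_eq_mul]
  simp [Real.volume_Ioo]

lemma halfBall_subset_box (R : ℝ) :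
    halfBall n R ⊆ box (fun i => if i = 0 then 0 else -R) (fun _ => R) := by
  intro x hx i
  have h1 := (abs_le.1 (abs_coord_le_norm x i))
  have h2 := hx.2
  by_cases hi : i = 0
  · subst hi; simp only [if_pos, Set.mem_Ioo]; exact ⟨hx.1, by linarith⟩
  · simp only [if_neg hi, Set.mem_Ioo]; constructor <;> linarith

/-- Almost every integrability claim below ends here: weights, gradients and functions are all
dominated by powers of x₁. Enclosing the half-ball in a box reduces the claim to ∫₀ᴿ tᵃ dt. -/
lemma integrableOn_rpow_coord {a : ℝ} (ha : -1 < a) (R : ℝ) :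
    IntegrableOn (fun x : Rn n => (x 0) ^ a) (halfBall n R) := by
  rcases le_or_gt R 0 with hR | hR
  · have : halfBall n R = ∅ := by
      ext x; simp only [halfBall, Set.mem_ofPred_eq, Set.mem_empty_iff_false, iff_false, not_and, not_lt]
      intro _; exact hR.trans (norm_nonneg x)
    simp [this]
  have hm : Measurable fun t : ℝ => ENNReal.ofReal (t ^ a) := by fun_prop
  have hx : Measurable fun x : Rn n => (x 0) ^ a := by
    exact (by fun_prop : Measurable fun t : ℝ => t ^ a).comp (continuous_coord 0).measurable
  refine IntegrableOn.mono_set ?_ (halfBall_subset_box R)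
  refine ⟨hx.aestronglyMeasurable, ?_⟩
  rw [hasFiniteIntegral_iff_ofReal]
  · rw [lintegral_box_coord _ _ _ hm]
    refine ENNReal.mul_lt_top (ENNReal.prod_lt_top fun _ _ => ENNReal.ofReal_lt_top) ?_
    simp only [if_pos]
    have h := (intervalIntegral.intervalIntegrable_rpow' (a := 0) (b := R) ha)
    rw [intervalIntegrable_iff_integrableOn_Ioo_of_le hR.le] at h
    have h' := h.2
    rwa [hasFiniteIntegral_iff_ofReal] at h'
    filter_upwards [ae_restrict_mem measurableSet_Ioo] with t ht
    exact Real.rpow_nonneg ht.1.le _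
  · filter_upwards [ae_restrict_mem (measurableSet_box _ _)] with t ht
    have := (ht 0).1
    simp only [if_pos] at this
    exact Real.rpow_nonneg this.le _

/-- The divergence of ∫₀ dt/t. It is what forces the negative phase to vanish on the axis. -/
lemma lintegral_box_inv_eq_top {a b : Fin n → ℝ} (h0 : a 0 = 0) (hab : ∀ i, a i < b i) :
    ∫⁻ x in box a b, ENNReal.ofReal (1 / x 0) = ⊤ := by
  have hm : Measurable fun t : ℝ => ENNReal.ofReal (1 / t) := by fun_prop
  rw [lintegral_box_coord a b _ hm]
  have hb : 0 < b 0 := h0 ▸ hab 0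
  refine ENNReal.mul_eq_top.2 (Or.inl ⟨?_, ?_⟩)
  · exact Finset.prod_ne_zero_iff.2 fun i _ => by simpa using hab i
  · by_contra h
    have h2 : IntegrableOn (fun t : ℝ => t ^ (-1 : ℝ)) (Set.Ioo 0 (b 0)) := by
      refine ⟨(by fun_prop : Measurable fun t : ℝ => t ^ (-1 : ℝ)).aestronglyMeasurable, ?_⟩
      rw [hasFiniteIntegral_iff_ofReal]
      · rw [h0] at h
        refine lt_of_le_of_lt (le_of_eq ?_) (lt_top_iff_ne_top.2 h)
        refine setLIntegral_congr_fun measurableSet_Ioo fun t ht => ?_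
        simp [Real.rpow_neg_one]
      · filter_upwards [ae_restrict_mem measurableSet_Ioo] with t ht
        exact Real.rpow_nonneg ht.1.le _
    rw [intervalIntegral.integrableOn_Ioo_rpow_iff hb] at h2
    exact lt_irrefl _ h2

/-! ### Polar coordinates in half-balls. -/

/-- The surface measure on the unit half-sphere. -/
def sphereMeasure (n : ℕ) [NeZero n] : Measure (sphere (0 : Rn n) 1) :=
  (volume : Measure (Rn n)).toSphere.restrict (halfSphere n)

instance : IsFiniteMeasure (sphereMeasure n) := by unfold sphereMeasure; infer_instance

lemma isOpen_halfSphere : IsOpen (halfSphere n) :=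
  isOpen_lt continuous_const ((continuous_coord 0).comp continuous_subtype_val)

lemma smul_mem_halfBall_iff {y : sphere (0 : Rn n) 1} {s R : ℝ} (hs : 0 < s) :
    s • (y : Rn n) ∈ halfBall n R ↔ y ∈ halfSphere n ∧ s < R := by
  have hy : ‖(y : Rn n)‖ = 1 := by simp
  simp only [halfBall, halfSphere, Set.mem_ofPred_eq, norm_smul, hy, mul_one, Real.norm_eq_abs,
    abs_of_pos hs, PiLp.smul_apply, smul_eq_mul, mul_pos_iff_of_pos_left hs]

lemma norm_smul_sphere (y : sphere (0 : Rn n) 1) {s : ℝ} (hs : 0 ≤ s) : ‖s • (y : Rn n)‖ = s := by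
  have hy : ‖(y : Rn n)‖ = 1 := by simp
  simp [norm_smul, hy, abs_of_nonneg hs]

/-- The measure `s ^ (n - 1) dS ds` on `∂B₁⁺ × (0, R)`. -/
def polarMeasure (n : ℕ) [NeZero n] (R : ℝ) : Measure (sphere (0 : Rn n) 1 × ℝ) :=
  ((sphereMeasure n).prod (volume.restrict (Set.Ioo 0 R))).withDensity
    fun p => ENNReal.ofReal (p.2 ^ (n - 1))

lemma continuous_polar : Continuous fun p : sphere (0 : Rn n) 1 × ℝ => p.2 • (p.1 : Rn n) := by
  fun_prop

/-- Polar coordinates with a real radius in (0, R), so that one-dimensional calculus on intervals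
applies. The measure on the subtype of positive radii is pushed forward to ℝ, and the half-ball
corresponds to the product of the half-sphere and (0, R). -/
lemma map_polar (R : ℝ) :
    (polarMeasure n R).map (fun p => p.2 • (p.1 : Rn n)) = volume.restrict (halfBall n R) := by
  set σ := (volume : Measure (Rn n)).toSphere
  have hmp := (volume : Measure (Rn n)).measurePreserving_homeomorphUnitSphereProd
  have hfin : Module.finrank ℝ (Rn n) = n := by simp
  rw [hfin] at hmp
  ext A hA
  rw [Measure.map_apply continuous_polar.measurable hA, Measure.restrict_apply hA]
  have hB : MeasurableSet (A ∩ halfBall n R) := hA.inter (isOpen_halfBall R).measurableSet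
  -- the volume in polar coordinates
  have h1 : volume (A ∩ halfBall n R) =
      (σ.prod (Measure.volumeIoiPow (n - 1)))
        {p | (p.2 : ℝ) • (p.1 : Rn n) ∈ A ∩ halfBall n R} := by
    have hm : MeasurableSet {p : sphere (0 : Rn n) 1 × Set.Ioi (0 : ℝ) |
        (p.2 : ℝ) • (p.1 : Rn n) ∈ A ∩ halfBall n R} :=
      (by fun_prop : Measurable fun p : sphere (0 : Rn n) 1 × Set.Ioi (0 : ℝ) =>
        (p.2 : ℝ) • (p.1 : Rn n)) hB
    rw [← hmp.measure_preimage hm.nullMeasurableSet,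
      Measure.comap_apply _ Subtype.val_injective
        (fun s hs => (MeasurableEmbedding.subtype_coe (measurableSet_singleton _).compl).measurableSet_image.2 hs)
        _ (hmp.measurable hm)]
    congr 1
    ext x
    simp only [Set.mem_image, Set.mem_preimage, Set.mem_ofPred_eq]
    constructor
    · intro hx
      -- Points of the half-ball have x₁ > 0, so the excluded origin plays no role.
      have hx0 : x ≠ 0 := by
        rintro rfl; have := hx.2.1; simp at this
      refine ⟨⟨x, hx0⟩, ?_, rfl⟩
      have : ‖x‖ ≠ 0 := norm_ne_zero_iff.2 hx0
      simpa [homeomorphUnitSphereProd, smul_smul, this] using hx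
    · rintro ⟨⟨z, hz⟩, h, rfl⟩
      have : ‖z‖ ≠ 0 := norm_ne_zero_iff.2 hz
      simpa [homeomorphUnitSphereProd, smul_smul, this] using h
  rw [h1]
  have hg : Measurable fun s : ℝ => ENNReal.ofReal (s ^ (n - 1)) := by fun_prop
  have h2 : (Measure.volumeIoiPow (n - 1)).map (Subtype.val : Set.Ioi (0 : ℝ) → ℝ) =
      (volume.restrict (Set.Ioi 0)).withDensity fun s => ENNReal.ofReal (s ^ (n - 1)) := by
    have he := MeasurableEmbedding.subtype_coe (measurableSet_Ioi (a := (0 : ℝ)))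
    ext B hB
    rw [he.map_apply, Measure.volumeIoiPow, withDensity_apply _ (he.measurable hB),
      withDensity_apply _ hB, ← map_comap_subtype_coe measurableSet_Ioi, he.restrict_map,
      he.lintegral_map]
  have hS : MeasurableSet {p : sphere (0 : Rn n) 1 × ℝ | p.2 • (p.1 : Rn n) ∈ A ∩ halfBall n R} :=
    continuous_polar.measurable hB
  have h3 : (σ.prod (Measure.volumeIoiPow (n - 1)))
        {p | (p.2 : ℝ) • (p.1 : Rn n) ∈ A ∩ halfBall n R} =
      (σ.prod ((volume.restrict (Set.Ioi 0)).withDensity fun s => ENNReal.ofReal (s ^ (n - 1))))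
        {p | p.2 • (p.1 : Rn n) ∈ A ∩ halfBall n R} := by
    rw [← h2]
    nth_rewrite 2 [← Measure.map_id (μ := σ)]
    rw [Measure.map_prod_map _ _ measurable_id measurable_subtype_coe, Measure.map_apply (by fun_prop) hS]
    rfl
  have hS' : MeasurableSet ((fun p : sphere (0 : Rn n) 1 × ℝ => p.2 • (p.1 : Rn n)) ⁻¹' A) :=
    continuous_polar.measurable hA
  rw [h3, prod_withDensity_right hg, withDensity_apply _ hS, polarMeasure, withDensity_apply _ hS',
    sphereMeasure, Measure.prod_restrict, Measure.restrict_restrict hS']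
  nth_rewrite 1 [← Measure.restrict_univ (μ := σ)]
  rw [Measure.prod_restrict, Measure.restrict_restrict hS]
  congr 2
  ext p
  simp only [Set.mem_inter_iff, Set.mem_preimage, Set.mem_prod, Set.mem_univ, true_and,
    Set.mem_Ioi, Set.mem_Ioo, Set.mem_ofPred_eq]
  constructor
  · rintro ⟨h, h1, h2, h3⟩
    exact ⟨⟨h, (smul_mem_halfBall_iff h2).2 ⟨h1, h3⟩⟩, h2⟩
  · rintro ⟨⟨h, h1⟩, h2⟩
    have := (smul_mem_halfBall_iff h2).1 h1
    exact ⟨h, this.1, h2, this.2⟩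

/-- The integral of `F` over `∂B_s⁺` with respect to the surface measure. -/
def sphInt (F : Rn n → ℝ) (s : ℝ) : ℝ :=
  s ^ (n - 1) * ∫ y, F (s • (y : Rn n)) ∂sphereMeasure n

lemma integrable_polar {F : Rn n → ℝ} {R : ℝ} (hF : IntegrableOn F (halfBall n R)) :
    Integrable (fun p : sphere (0 : Rn n) 1 × ℝ => p.2 ^ (n - 1) * F (p.2 • (p.1 : Rn n)))
      ((sphereMeasure n).prod (volume.restrict (Set.Ioo 0 R))) := by
  rw [IntegrableOn, ← map_polar] at hF
  have h := (integrable_map_measure hF.1 continuous_polar.measurable.aemeasurable).1 hF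
  rw [polarMeasure, integrable_withDensity_iff_integrable_smul' (by fun_prop) (by simp)] at h
  refine h.congr ?_
  rw [← Measure.restrict_univ (μ := sphereMeasure n), Measure.prod_restrict]
  filter_upwards [ae_restrict_mem (MeasurableSet.univ.prod measurableSet_Ioo)] with p hp
  simp [ENNReal.toReal_ofReal, pow_nonneg hp.2.1.le]

lemma integrableOn_sphInt {F : Rn n → ℝ} {R : ℝ} (hF : IntegrableOn F (halfBall n R)) :
    IntegrableOn (sphInt F) (Set.Ioo 0 R) := by
  have h := (integrable_polar hF).integral_prod_right
  simp only [integral_const_mul] at h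
  exact h

/-- Fubini gives integrability on almost every sphere only. This is why the identities on spheres
below hold for almost every radius. -/
lemma ae_integrable_sphere {F : Rn n → ℝ} {R : ℝ} (hF : IntegrableOn F (halfBall n R)) :
    ∀ᵐ s ∂(volume.restrict (Set.Ioo 0 R)),
      Integrable (fun y : sphere (0 : Rn n) 1 => F (s • (y : Rn n))) (sphereMeasure n) := by
  filter_upwards [(integrable_polar hF).prod_left_ae, ae_restrict_mem measurableSet_Ioo] with s hs hs'
  have h0 : s ^ (n - 1) ≠ 0 := pow_ne_zero _ hs'.1.ne'
  simpa [← mul_assoc, inv_mul_cancel₀ h0] using hs.const_mul (s ^ (n - 1))⁻¹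

lemma integral_halfBall_eq_sphInt {F : Rn n → ℝ} {R : ℝ} (hF : IntegrableOn F (halfBall n R)) :
    ∫ x in halfBall n R, F x = ∫ s in Set.Ioo 0 R, sphInt F s := by
  have h1 : ∫ x in halfBall n R, F x = ∫ p, F (p.2 • (p.1 : Rn n)) ∂polarMeasure n R := by
    rw [IntegrableOn, ← map_polar] at hF
    rw [← map_polar, integral_map continuous_polar.measurable.aemeasurable hF.1]
  rw [h1, polarMeasure, integral_withDensity_eq_integral_toReal_smul (by fun_prop) (by simp)]
  have h2 := integral_prod_symm _ (integrable_polar hF)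
  simp only [integral_const_mul] at h2
  refine Eq.trans (integral_congr_ae ?_) h2
  rw [← Measure.restrict_univ (μ := sphereMeasure n), Measure.prod_restrict]
  filter_upwards [ae_restrict_mem (MeasurableSet.univ.prod measurableSet_Ioo)] with p hp
  simp [ENNReal.toReal_ofReal, pow_nonneg hp.2.1.le]

lemma integral_halfBall_radial {F : Rn n → ℝ} {R : ℝ} (η : ℝ → ℝ)
    (hF : IntegrableOn (fun x => η ‖x‖ * F x) (halfBall n R)) :
    ∫ x in halfBall n R, η ‖x‖ * F x = ∫ s in Set.Ioo 0 R, η s * sphInt F s := by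
  rw [integral_halfBall_eq_sphInt hF]
  refine setIntegral_congr_fun measurableSet_Ioo fun s hs => ?_
  simp only [sphInt, norm_smul_sphere _ hs.1.le, integral_const_mul]
  ring

/-! ### Weak gradients: integration by parts and uniqueness. -/

lemma contDiffOn_one_of_hasGradientAt {U : Set (Rn n)} (hU : IsOpen U) {f : Rn n → ℝ}
    {P : Rn n → Rn n} (h : ∀ x ∈ U, HasGradientAt f (P x) x) (hP : ContinuousOn P U) :
    ContDiffOn ℝ 1 f U := by
  have := (contDiffOn_succ_iff_hasFDerivWithinAt_of_uniqueDiffOn (𝕜 := ℝ) (n := 0) (f := f)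
    hU.uniqueDiffOn).2 ⟨by simp, fun x => InnerProductSpace.toDual ℝ (Rn n) (P x), ?_,
      fun x hx => (h x hx).hasFDerivAt.hasFDerivWithinAt⟩
  · simpa using this
  · exact contDiffOn_zero.2 ((InnerProductSpace.toDual ℝ (Rn n)).continuous.comp_continuousOn hP)

lemma contDiff_mul_of_tsupport_subset {U : Set (Rn n)} (hU : IsOpen U) {k : ℕ∞ω} {v φ : Rn n → ℝ}
    (hv : ContDiffOn ℝ k v U) (hφ : ContDiff ℝ k φ) (hs : tsupport φ ⊆ U) :
    ContDiff ℝ k fun x => v x * φ x := by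
  refine contDiff_iff_contDiffAt.2 fun x => ?_
  by_cases hx : x ∈ tsupport fun x => v x * φ x
  swap
  · exact contDiffAt_const.congr_of_eventuallyEq (notMem_tsupport_iff_eventuallyEq.1 hx)
  have hx' : x ∈ tsupport φ := closure_mono (Function.support_mul_subset_right v φ) hx
  exact (hv.contDiffAt (hU.mem_nhds (hs hx'))).mul hφ.contDiffAt

lemma integral_fderiv_eq_zero {h : Rn n → ℝ} (hc : ContDiff ℝ 1 h) (hs : HasCompactSupport h)
    (e : Rn n) : ∫ x, fderiv ℝ h x e = 0 := by
  have hint : Integrable fun x => fderiv ℝ h x e :=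
    Continuous.integrable_of_hasCompactSupport
      ((hc.continuous_fderiv one_ne_zero).clm_apply continuous_const)
      (hs.fderiv_apply ℝ e)
  -- Integration by parts against the constant function 1.
  have := integral_mul_fderiv_eq_neg_fderiv_mul_of_integrable (μ := (volume : Measure (Rn n)))
    (f := fun _ => (1 : ℝ)) (g := h) (v := e) (by simp) (by simpa using hint)
    (by simpa using hc.continuous.integrable_of_hasCompactSupport hs)
    (fun x _ => by fun_prop) (fun x _ => hc.differentiable one_ne_zero x)
  simpa using this

lemma integrable_smul_of_tsupport_subset {E : Type*} [NormedAddCommGroup E] [NormedSpace ℝ E]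
    {U : Set (Rn n)} {φ : Rn n → ℝ} {G : Rn n → E}
    (hφ : Continuous φ) (hs : HasCompactSupport φ) (hU : tsupport φ ⊆ U)
    (hG : LocallyIntegrableOn G U) : Integrable fun x => φ x • G x := by
  have h1 : IntegrableOn (fun x => φ x • G x) (tsupport φ) :=
    (hG.integrableOn_compact_subset hU hs.isCompact).continuousOn_smul hφ.continuousOn hs.isCompact
  refine (integrableOn_iff_integrable_of_support_subset ?_).1 h1
  exact (Function.support_smul_subset_left φ G).trans (subset_tsupport φ)

/-- Integration by parts for a `C¹` function against a test function. -/
lemma integral_mul_fderiv_eq_neg {U : Set (Rn n)} (hU : IsOpen U) {f φ : Rn n → ℝ}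
    {P : Rn n → Rn n} (h : ∀ x ∈ U, HasGradientAt f (P x) x) (hP : ContinuousOn P U)
    (hφ : ContDiff ℝ 1 φ) (hc : HasCompactSupport φ) (hs : tsupport φ ⊆ U) (e : Rn n) :
    ∫ x in U, f x * fderiv ℝ φ x e = -∫ x in U, inner ℝ (P x) e * φ x := by
  have hf := contDiffOn_one_of_hasGradientAt hU h hP
  have hfc : ContinuousOn f U := hf.continuousOn
  have hm := contDiff_mul_of_tsupport_subset hU hf hφ hs
  have hz : ∀ x, x ∉ U → φ x = 0 := fun x hx => image_eq_zero_of_notMem_tsupport fun h => hx (hs h)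
  have hz' : ∀ x, x ∉ U → fderiv ℝ φ x = 0 := fun x hx =>
    fderiv_of_notMem_tsupport ℝ fun h => hx (hs h)
  have h0 := integral_fderiv_eq_zero hm hc.mul_left e
  have hd : ∀ x, fderiv ℝ (fun x => f x * φ x) x e =
      fderiv ℝ φ x e • f x + φ x • inner ℝ (P x) e := by
    intro x
    by_cases hx : x ∈ U
    · have h2 := (h x hx).hasFDerivAt.mul (hφ.differentiable one_ne_zero x).hasFDerivAt
      rw [show (fun x => f x * φ x) = f * φ from rfl, h2.fderiv]
      simp [InnerProductSpace.toDual_apply_apply]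
      ring
    · have : x ∉ tsupport fun x => f x * φ x := fun h =>
        hx (hs (closure_mono (Function.support_mul_subset_right f φ) h))
      rw [fderiv_of_notMem_tsupport ℝ this, hz' x hx, hz x hx]
      simp
  simp_rw [hd] at h0
  have hloc : LocallyIntegrableOn f U :=
    hfc.locallyIntegrableOn hU.measurableSet
  have hloc' : LocallyIntegrableOn (fun x => inner ℝ (P x) e) U :=
    (hP.inner continuousOn_const).locallyIntegrableOn hU.measurableSet
  rw [integral_add] at h0
  · rw [setIntegral_eq_integral_of_forall_compl_eq_zero (fun x hx => by simp [hz' x hx]),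
      setIntegral_eq_integral_of_forall_compl_eq_zero (fun x hx => by simp [hz x hx])]
    simp only [smul_eq_mul] at h0
    simp only [mul_comm (f _), mul_comm (inner ℝ _ _)]
    linarith
  · exact integrable_smul_of_tsupport_subset
      ((hφ.continuous_fderiv one_ne_zero).clm_apply continuous_const) (hc.fderiv_apply ℝ e)
      ((tsupport_fderiv_apply_subset ℝ e).trans hs) hloc
  · exact integrable_smul_of_tsupport_subset hφ.continuous hc hs hloc'

lemma hasWeakGrad_of_hasGradientAt {U : Set (Rn n)} (hU : IsOpen U) {f : Rn n → ℝ}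
    {P : Rn n → Rn n} (h : ∀ x ∈ U, HasGradientAt f (P x) x) (hP : ContinuousOn P U) :
    HasWeakGrad U f P where
  locallyIntegrable :=
    ((contDiffOn_one_of_hasGradientAt hU h hP).continuousOn).locallyIntegrableOn hU.measurableSet
  locallyIntegrable_grad := hP.locallyIntegrableOn hU.measurableSet
  integral_eq φ hφ hc hs e :=
    integral_mul_fderiv_eq_neg hU h hP (hφ.of_le (by exact_mod_cast le_top)) hc hs e

lemma HasWeakGrad.mono {U V : Set (Rn n)} {v : Rn n → ℝ} {G : Rn n → Rn n}
    (h : HasWeakGrad U v G) (hVU : V ⊆ U) : HasWeakGrad V v G where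
  locallyIntegrable := h.locallyIntegrable.mono_set hVU
  locallyIntegrable_grad := h.locallyIntegrable_grad.mono_set hVU
  integral_eq φ hφ hc hs e := by
    have hz : ∀ x, x ∉ V → φ x = 0 := fun x hx => image_eq_zero_of_notMem_tsupport fun h => hx (hs h)
    have hz' : ∀ x, x ∉ V → fderiv ℝ φ x = 0 := fun x hx =>
      fderiv_of_notMem_tsupport ℝ fun h => hx (hs h)
    have h1 := h.integral_eq φ hφ hc (hs.trans hVU) e
    rw [setIntegral_eq_integral_of_forall_compl_eq_zero
        (fun x hx => by simp [hz' x fun h => hx (hVU h)]),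
      setIntegral_eq_integral_of_forall_compl_eq_zero
        (fun x hx => by simp [hz x fun h => hx (hVU h)])] at h1
    rwa [setIntegral_eq_integral_of_forall_compl_eq_zero (fun x hx => by simp [hz' x hx]),
      setIntegral_eq_integral_of_forall_compl_eq_zero (fun x hx => by simp [hz x hx])]

/-- The fundamental lemma of the calculus of variations in each component. Since `weakGrad` is
obtained by choice, every computation of it goes through this uniqueness. -/
lemma HasWeakGrad.unique {U : Set (Rn n)} (hU : IsOpen U) {v : Rn n → ℝ} {G G' : Rn n → Rn n}
    (h : HasWeakGrad U v G) (h' : HasWeakGrad U v G') : G =ᵐ[volume.restrict U] G' := by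
  have key : ∀ i : Fin n, ∀ᵐ x, x ∈ U → (G x - G' x) i = 0 := by
    intro i
    have hl : LocallyIntegrableOn (fun x => (G x - G' x) i) U := by
      refine (locallyIntegrableOn_iff hU.isLocallyClosed).2 fun k hk hkc => ?_
      have h1 := (h.locallyIntegrable_grad.integrableOn_compact_subset hk hkc).sub
        (h'.locallyIntegrable_grad.integrableOn_compact_subset hk hkc)
      exact (EuclideanSpace.proj (𝕜 := ℝ) i).integrable_comp h1
    refine hU.ae_eq_zero_of_integral_contDiff_smul_eq_zero hl fun φ hφ hc hs => ?_
    have h1 := h.integral_eq φ hφ hc hs (EuclideanSpace.single i 1)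
    have h2 := h'.integral_eq φ hφ hc hs (EuclideanSpace.single i 1)
    have hz : ∀ x, x ∉ U → φ x = 0 := fun x hx => image_eq_zero_of_notMem_tsupport fun h => hx (hs h)
    rw [h1] at h2
    rw [setIntegral_eq_integral_of_forall_compl_eq_zero (fun x hx => by simp [hz x hx]),
      setIntegral_eq_integral_of_forall_compl_eq_zero (fun x hx => by simp [hz x hx])] at h2
    have hi : ∀ {K : Rn n → Rn n}, LocallyIntegrableOn K U →
        Integrable fun x => inner ℝ (K x) (EuclideanSpace.single i (1 : ℝ)) * φ x := by
      intro K hK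
      have h3 := integrable_smul_of_tsupport_subset hφ.continuous hc hs hK
      have h4 := (EuclideanSpace.proj (𝕜 := ℝ) i).integrable_comp h3
      refine h4.congr (ae_of_all _ fun x => ?_)
      simp [EuclideanSpace.inner_single_right, mul_comm]
    have h3 := integral_sub (hi h.locallyIntegrable_grad) (hi h'.locallyIntegrable_grad)
    have h4 : ∀ x, φ x • (G x - G' x) i = inner ℝ (G x) (EuclideanSpace.single i (1 : ℝ)) * φ x -
        inner ℝ (G' x) (EuclideanSpace.single i (1 : ℝ)) * φ x := by
      intro x; simp [EuclideanSpace.inner_single_right]; ring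
    simp_rw [h4]
    rw [h3]; linarith
  rw [Filter.EventuallyEq, ae_restrict_iff' hU.measurableSet]
  filter_upwards [ae_all_iff.2 key] with x hx hxU
  ext i
  have := hx i hxU
  simp only [PiLp.sub_apply] at this
  linarith

lemma hasWeakGrad_weakGrad {U : Set (Rn n)} {v : Rn n → ℝ} (h : ∃ G, HasWeakGrad U v G) :
    HasWeakGrad U v (weakGrad U v) := by
  rw [weakGrad, dif_pos h]; exact h.choose_spec

lemma HasWeakGrad.weakGrad_ae_eq {U : Set (Rn n)} (hU : IsOpen U) {v : Rn n → ℝ}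
    {G : Rn n → Rn n} (h : HasWeakGrad U v G) : weakGrad U v =ᵐ[volume.restrict U] G :=
  (hasWeakGrad_weakGrad ⟨G, h⟩).unique hU h

/-! ### A C¹ truncation at small heights. -/

/-- A `C¹` truncation of the identity that vanishes on `(-∞, ε]`. -/
def trunc (ε t : ℝ) : ℝ := max t ε - 2 * ε + ε ^ 2 / max t ε

/-- The derivative of `trunc ε`. -/
def truncDeriv (ε t : ℝ) : ℝ := 1 - ε ^ 2 / max t ε ^ 2

lemma trunc_of_le {ε t : ℝ} (hε : 0 < ε) (h : t ≤ ε) : trunc ε t = 0 := by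
  rw [trunc, max_eq_right h]; field_simp; ring

lemma truncDeriv_of_le {ε t : ℝ} (hε : 0 < ε) (h : t ≤ ε) : truncDeriv ε t = 0 := by
  rw [truncDeriv, max_eq_right h]; field_simp; ring

/-- For t ≥ ε the truncation equals (t-ε)²/t, which has a double zero at ε, so the derivatives from
both sides agree there. -/
lemma hasDerivAt_trunc {ε : ℝ} (hε : 0 < ε) (t : ℝ) :
    HasDerivAt (trunc ε) (truncDeriv ε t) t := by
  have h1 : t ≤ ε → HasDerivWithinAt (trunc ε) (truncDeriv ε t) (Set.Iic ε) t := by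
    intro h
    rw [truncDeriv_of_le hε h]
    exact (hasDerivWithinAt_const t _ (0 : ℝ)).congr (fun s hs => trunc_of_le hε hs)
      (trunc_of_le hε h)
  have h2 : ε ≤ t → HasDerivWithinAt (trunc ε) (truncDeriv ε t) (Set.Ici ε) t := by
    intro h
    have ht : 0 < t := hε.trans_le h
    have h3 : HasDerivAt (fun s : ℝ => s - 2 * ε + ε ^ 2 / s) (truncDeriv ε t) t := by
      have := ((hasDerivAt_id t).sub_const (2 * ε)).add
        ((hasDerivAt_const t (ε ^ 2)).div (hasDerivAt_id t) ht.ne')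
      refine this.congr_deriv ?_
      rw [truncDeriv, max_eq_left h]; simp; ring
    refine h3.hasDerivWithinAt.congr (fun s hs => ?_) ?_
    · rw [trunc, max_eq_left hs]
    · rw [trunc, max_eq_left h]
  rcases lt_trichotomy t ε with h | h | h
  · exact (h1 h.le).hasDerivAt (Iic_mem_nhds h)
  · have := (h1 h.le).union (h2 h.ge)
    rwa [Set.Iic_union_Ici, hasDerivWithinAt_univ] at this
  · exact (h2 h.le).hasDerivAt (Ici_mem_nhds h)

lemma continuous_truncDeriv {ε : ℝ} (hε : 0 < ε) : Continuous (truncDeriv ε) := by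
  unfold truncDeriv
  refine continuous_const.sub (continuous_const.div (by fun_prop) fun t => ?_)
  exact pow_ne_zero _ (hε.trans_le (le_max_right _ _)).ne'

lemma continuous_trunc {ε : ℝ} (hε : 0 < ε) : Continuous (trunc ε) :=
  continuous_iff_continuousAt.2 fun t => (hasDerivAt_trunc hε t).continuousAt

lemma truncDeriv_nonneg {ε : ℝ} (hε : 0 < ε) (t : ℝ) : 0 ≤ truncDeriv ε t := by
  have h := le_max_right t ε
  rw [truncDeriv, sub_nonneg, div_le_one (by positivity)]
  exact pow_le_pow_left₀ hε.le h 2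

lemma truncDeriv_le_one (ε t : ℝ) : truncDeriv ε t ≤ 1 := by
  have : 0 ≤ ε ^ 2 / max t ε ^ 2 := by positivity
  rw [truncDeriv]; linarith

lemma abs_truncDeriv_le {ε : ℝ} (hε : 0 < ε) (t : ℝ) : |truncDeriv ε t| ≤ 1 :=
  abs_le.2 ⟨by linarith [truncDeriv_nonneg hε t], truncDeriv_le_one ε t⟩

lemma trunc_nonneg {ε : ℝ} (hε : 0 < ε) (t : ℝ) : 0 ≤ trunc ε t := by
  have h := le_max_right t ε
  have hp : 0 < max t ε := hε.trans_le h
  have : trunc ε t = (max t ε - ε) ^ 2 / max t ε := by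
    rw [trunc]; field_simp; ring
  rw [this]; positivity

lemma trunc_le {ε t : ℝ} (hε : 0 < ε) (ht : 0 ≤ t) : trunc ε t ≤ t := by
  rcases le_total t ε with h | h
  · rw [trunc_of_le hε h]; exact ht
  · rw [trunc, max_eq_left h]
    have : ε ^ 2 / t ≤ ε := by
      rw [div_le_iff₀ (hε.trans_le h)]; nlinarith
    linarith

lemma sub_le_trunc {ε : ℝ} (hε : 0 < ε) (t : ℝ) : t - 2 * ε ≤ trunc ε t := by
  have h := le_max_left t ε
  have : 0 ≤ ε ^ 2 / max t ε := div_nonneg (sq_nonneg _) (hε.le.trans (le_max_right _ _))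
  rw [trunc]; linarith

lemma abs_trunc_sub_le {ε t : ℝ} (hε : 0 < ε) (ht : 0 ≤ t) : |trunc ε t - t| ≤ 2 * ε :=
  abs_le.2 ⟨by linarith [sub_le_trunc hε t], by linarith [trunc_le hε ht]⟩

lemma abs_trunc_le {ε t : ℝ} (hε : 0 < ε) (ht : 0 ≤ t) : |trunc ε t| ≤ t := by
  rw [abs_of_nonneg (trunc_nonneg hε t)]; exact trunc_le hε ht

lemma tendsto_trunc {t : ℝ} (ht : 0 ≤ t) :
    Tendsto (fun k : ℕ => trunc (1 / (k + 1)) t) atTop (𝓝 t) := by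
  have h0 : Tendsto (fun k : ℕ => 2 * (1 / ((k : ℝ) + 1))) atTop (𝓝 0) := by
    simpa using (tendsto_one_div_add_atTop_nhds_zero_nat (𝕜 := ℝ)).const_mul 2
  refine tendsto_iff_dist_tendsto_zero.2 (squeeze_zero (fun _ => dist_nonneg) (fun k => ?_) h0)
  exact abs_trunc_sub_le (by positivity) ht

lemma tendsto_truncDeriv {t : ℝ} (ht : 0 < t) :
    Tendsto (fun k : ℕ => truncDeriv (1 / (k + 1)) t) atTop (𝓝 1) := by
  have h0 : Tendsto (fun k : ℕ => 1 / ((k : ℝ) + 1)) atTop (𝓝 0) :=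
    tendsto_one_div_add_atTop_nhds_zero_nat
  have h1 : Tendsto (fun k : ℕ => 1 - (1 / ((k : ℝ) + 1)) ^ 2 / max t (1 / ((k : ℝ) + 1)) ^ 2) atTop
      (𝓝 (1 - 0 ^ 2 / max t 0 ^ 2)) := by
    refine tendsto_const_nhds.sub ((h0.pow 2).div ((tendsto_const_nhds.max h0).pow 2) ?_)
    rw [max_eq_left ht.le]; positivity
  simpa [truncDeriv] using h1

/-! ### Nonnegative functions that are C¹ where they are positive. -/

/-- `f ≥ 0` is continuous in `U` and `C¹` in `{f > 0}` with gradient `P`, and `P = 0` in `{f = 0}`. -/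
structure IsTruncC1 (U : Set (Rn n)) (f : Rn n → ℝ) (P : Rn n → Rn n) : Prop where
  nonneg : ∀ x ∈ U, 0 ≤ f x
  cont : ContinuousOn f U
  grad : ∀ x ∈ U, 0 < f x → HasGradientAt f (P x) x
  grad_zero : ∀ x ∈ U, f x = 0 → P x = 0
  cont_grad : ContinuousOn P {x ∈ U | 0 < f x}

namespace IsTruncC1

variable {U : Set (Rn n)} {f : Rn n → ℝ} {P : Rn n → Rn n}

lemma isOpen_pos (h : IsTruncC1 U f P) (hU : IsOpen U) : IsOpen {x ∈ U | 0 < f x} :=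
  h.cont.isOpen_inter_preimage hU isOpen_Ioi

lemma mono (h : IsTruncC1 U f P) {V : Set (Rn n)} (hV : V ⊆ U) : IsTruncC1 V f P where
  nonneg x hx := h.nonneg x (hV hx)
  cont := h.cont.mono hV
  grad x hx := h.grad x (hV hx)
  grad_zero x hx := h.grad_zero x (hV hx)
  cont_grad := h.cont_grad.mono fun _ hx => ⟨hV hx.1, hx.2⟩

/-- Near a zero of f the truncation is identically 0, by continuity of f. So it is C¹ in all of U
without any information on the set ∂{f > 0}. -/
lemma hasGradientAt_trunc (h : IsTruncC1 U f P) (hU : IsOpen U) {ε : ℝ} (hε : 0 < ε) {x : Rn n}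
    (hx : x ∈ U) : HasGradientAt (fun y => trunc ε (f y)) (truncDeriv ε (f x) • P x) x := by
  rcases (h.nonneg x hx).eq_or_lt with h0 | h0
  · rw [truncDeriv_of_le hε (h0 ▸ hε.le), zero_smul]
    have h1 : ∀ᶠ y in 𝓝 x, f y < ε :=
      (h.cont.continuousAt (hU.mem_nhds hx)).eventually_lt continuousAt_const (h0 ▸ hε)
    have h2 : (fun y => trunc ε (f y)) =ᶠ[𝓝 x] fun _ => 0 :=
      h1.mono fun y hy => trunc_of_le hε hy.le
    rw [hasGradientAt_iff_hasFDerivAt, map_zero]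
    exact (hasFDerivAt_const (0 : ℝ) x).congr_of_eventuallyEq h2
  · rw [hasGradientAt_iff_hasFDerivAt, map_smul]
    exact (hasDerivAt_trunc hε (f x)).comp_hasFDerivAt x (h.grad x hx h0).hasFDerivAt

lemma continuousOn_trunc_grad (h : IsTruncC1 U f P) (hU : IsOpen U) {ε : ℝ} (hε : 0 < ε) :
    ContinuousOn (fun x => truncDeriv ε (f x) • P x) U := by
  intro x hx
  refine ContinuousAt.continuousWithinAt ?_
  have hf := h.cont.continuousAt (hU.mem_nhds hx)
  rcases (h.nonneg x hx).eq_or_lt with h0 | h0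
  · have h1 : ∀ᶠ y in 𝓝 x, f y < ε := hf.eventually_lt continuousAt_const (h0 ▸ hε)
    have h2 : (fun y => truncDeriv ε (f y) • P y) =ᶠ[𝓝 x] fun _ => 0 :=
      h1.mono fun y hy => by simp [truncDeriv_of_le hε hy.le]
    exact continuousAt_const.congr h2.symm
  · exact ((continuous_truncDeriv hε).continuousAt.comp hf).smul
      (h.cont_grad.continuousAt ((h.isOpen_pos hU).mem_nhds ⟨hx, h0⟩))

lemma aestronglyMeasurable_grad (h : IsTruncC1 U f P) (hU : IsOpen U) :
    AEStronglyMeasurable P (volume.restrict U) := by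
  have h1 : AEStronglyMeasurable ({x ∈ U | 0 < f x}.indicator P) volume :=
    (aestronglyMeasurable_indicator_iff (h.isOpen_pos hU).measurableSet).2
      (h.cont_grad.aestronglyMeasurable (h.isOpen_pos hU).measurableSet)
  refine (h1.mono_measure Measure.restrict_le_self).congr ?_
  filter_upwards [ae_restrict_mem hU.measurableSet] with x hx
  by_cases hf : 0 < f x
  · exact Set.indicator_of_mem (show x ∈ {x ∈ U | 0 < f x} from ⟨hx, hf⟩) P
  · rw [Set.indicator_of_notMem (fun h => hf h.2),
      h.grad_zero x hx (le_antisymm (not_lt.1 hf) (h.nonneg x hx))]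

lemma aestronglyMeasurable (h : IsTruncC1 U f P) (hU : IsOpen U) :
    AEStronglyMeasurable f (volume.restrict U) :=
  h.cont.aestronglyMeasurable hU.measurableSet

/-- The pointwise gradient, extended by 0, is the weak gradient: integrate by parts for the
truncations at height 1/(k+1) and use dominated convergence. On {f = 0} the vanishing of P makes the
limit of the gradients correct. -/
lemma hasWeakGrad (h : IsTruncC1 U f P) (hU : IsOpen U) (hP : LocallyIntegrableOn P U) :
    HasWeakGrad U f P where
  locallyIntegrable := h.cont.locallyIntegrableOn hU.measurableSet
  locallyIntegrable_grad := hP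
  integral_eq φ hφ hc hs e := by
    have hφ1 : ContDiff ℝ 1 φ := hφ.of_le (by exact_mod_cast le_top)
    have hk : ∀ k : ℕ, (0 : ℝ) < 1 / (k + 1) := fun k => by positivity
    have h1 : ∀ k : ℕ, ∫ x in U, trunc (1 / (k + 1)) (f x) * fderiv ℝ φ x e =
        -∫ x in U, inner ℝ (truncDeriv (1 / (k + 1)) (f x) • P x) e * φ x := fun k =>
      integral_mul_fderiv_eq_neg hU (fun x hx => h.hasGradientAt_trunc hU (hk k) hx)
        (h.continuousOn_trunc_grad hU (hk k)) hφ1 hc hs e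
    have hm1 := h.aestronglyMeasurable hU
    have hm2 := h.aestronglyMeasurable_grad hU
    have t1 : Tendsto (fun k : ℕ => ∫ x in U, trunc (1 / (k + 1)) (f x) * fderiv ℝ φ x e) atTop
        (𝓝 (∫ x in U, f x * fderiv ℝ φ x e)) := by
      refine tendsto_integral_of_dominated_convergence (fun x => ‖fderiv ℝ φ x e • f x‖) ?_ ?_ ?_ ?_
      · intro k
        exact ((continuous_trunc (hk k)).comp_aestronglyMeasurable hm1).mul
          ((hφ1.continuous_fderiv one_ne_zero).clm_apply continuous_const).aestronglyMeasurable
      · exact (integrable_smul_of_tsupport_subset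
          ((hφ1.continuous_fderiv one_ne_zero).clm_apply continuous_const) (hc.fderiv_apply ℝ e)
          ((tsupport_fderiv_apply_subset ℝ e).trans hs)
          (h.cont.locallyIntegrableOn hU.measurableSet)).norm.integrableOn
      · intro k
        filter_upwards [ae_restrict_mem hU.measurableSet] with x hx
        rw [norm_mul, norm_smul, mul_comm]
        gcongr
        rw [Real.norm_eq_abs, Real.norm_eq_abs, abs_of_nonneg (h.nonneg x hx)]
        exact abs_trunc_le (hk k) (h.nonneg x hx)
      · filter_upwards [ae_restrict_mem hU.measurableSet] with x hx
        exact (tendsto_trunc (h.nonneg x hx)).mul_const _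
    have t2 : Tendsto (fun k : ℕ => ∫ x in U,
          inner ℝ (truncDeriv (1 / (k + 1)) (f x) • P x) e * φ x) atTop
        (𝓝 (∫ x in U, inner ℝ (P x) e * φ x)) := by
      refine tendsto_integral_of_dominated_convergence (fun x => ‖e‖ * ‖φ x • P x‖) ?_ ?_ ?_ ?_
      · intro k
        exact ((((continuous_truncDeriv (hk k)).comp_aestronglyMeasurable hm1).smul hm2).inner
          aestronglyMeasurable_const).mul hφ1.continuous.aestronglyMeasurable
      · exact ((integrable_smul_of_tsupport_subset hφ1.continuous hc hs hP).norm.const_mul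
          _).integrableOn
      · intro k
        filter_upwards with x
        rw [norm_mul, norm_smul, inner_smul_left, norm_mul]
        have h2 : ‖inner ℝ (P x) e‖ ≤ ‖P x‖ * ‖e‖ := norm_inner_le_norm _ _
        have h3 := abs_truncDeriv_le (hk k) (f x)
        calc _ ≤ 1 * (‖P x‖ * ‖e‖) * ‖φ x‖ := by
              gcongr
              simpa using h3
          _ = _ := by ring
      · filter_upwards [ae_restrict_mem hU.measurableSet] with x hx
        rcases (h.nonneg x hx).eq_or_lt with h0 | h0
        · simp [h.grad_zero x hx h0.symm]
        · have := ((tendsto_truncDeriv h0).mul_const (inner ℝ (P x) e)).mul_const (φ x)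
          simpa [inner_smul_left] using this
    exact tendsto_nhds_unique t1 ((t2.neg).congr fun k => (h1 k).symm)

/-- The mean value inequality along a segment. -/
lemma abs_sub_le_of_segment (h : IsTruncC1 U f P) (hU : IsOpen U) {x v : Rn n}
    (hs : ∀ t ∈ Set.Icc (0 : ℝ) 1, x + t • v ∈ U) {B B' : ℝ → ℝ}
    (hB : ContinuousOn B (Set.Icc 0 1)) (hB' : ∀ t ∈ Set.Ico (0 : ℝ) 1, HasDerivWithinAt B (B' t) (Set.Ici t) t)
    (hb : ∀ t ∈ Set.Ico (0 : ℝ) 1, ‖P (x + t • v)‖ * ‖v‖ ≤ B' t) :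
    |f (x + v) - f x| ≤ B 1 - B 0 := by
  -- The segment may cross the set where f is not differentiable, so the inequality is proved for
  -- the truncations, with a bound that does not depend on k.
  have key : ∀ k : ℕ, |trunc (1 / (k + 1)) (f (x + v)) - trunc (1 / (k + 1)) (f x)| ≤ B 1 - B 0 := by
    intro k
    have hk : (0 : ℝ) < 1 / (k + 1) := by positivity
    set g : ℝ → ℝ := fun t => trunc (1 / (k + 1)) (f (x + t • v)) - trunc (1 / (k + 1)) (f x)
    have hg : ∀ t ∈ Set.Icc (0 : ℝ) 1,
        HasDerivAt g (inner ℝ (truncDeriv (1 / (k + 1)) (f (x + t • v)) • P (x + t • v)) v) t := by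
      intro t ht
      have h1 := (h.hasGradientAt_trunc hU hk (hs t ht)).hasFDerivAt
      have h2 : HasDerivAt (fun t : ℝ => x + t • v) v t := by
        simpa using ((hasDerivAt_id t).smul_const v).const_add x
      exact (h1.comp_hasDerivAt t h2).sub_const (trunc (1 / (k + 1)) (f x))
    have := image_norm_le_of_norm_deriv_right_le_deriv_boundary' (f := g) (a := 0) (b := 1)
      (B := fun t => B t - B 0) (B' := B')
      (fun t ht => (hg t ht).continuousAt.continuousWithinAt)
      (fun t ht => (hg t ⟨ht.1, ht.2.le⟩).hasDerivWithinAt) (by simp [g])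
      (hB.sub continuousOn_const) (fun t ht => (hB' t ht).sub_const _)
      (fun t ht => by
        refine (norm_inner_le_norm _ _).trans (le_trans ?_ (hb t ht))
        gcongr
        rw [norm_smul]
        exact mul_le_of_le_one_left (norm_nonneg _) (abs_truncDeriv_le hk _))
      (Set.right_mem_Icc.2 zero_le_one)
    simpa [g] using this
  have hx := h.nonneg x (by simpa using hs 0 (by simp))
  have hxv := h.nonneg (x + v) (by simpa using hs 1 (by simp))
  exact le_of_tendsto ((tendsto_trunc hxv).sub (tendsto_trunc hx)).abs (Eventually.of_forall key)

lemma exists_lipschitz (h : IsTruncC1 U f P) (hU : IsOpen U)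
    (hb : ∀ x ∈ U, ∃ K, ∀ᶠ y in 𝓝 x, ‖P y‖ ≤ K) {x : Rn n} (hx : x ∈ U) :
    ∃ K, 0 ≤ K ∧ ∀ᶠ y in 𝓝 x, |f y - f x| ≤ K * ‖y - x‖ := by
  obtain ⟨K, hK⟩ := hb x hx
  obtain ⟨δ, hδ, hball⟩ := Metric.eventually_nhds_iff_ball.1 (hK.and (hU.mem_nhds hx))
  refine ⟨K, (norm_nonneg _).trans (hball x (mem_ball_self hδ)).1, ?_⟩
  filter_upwards [ball_mem_nhds x hδ] with y hy
  have hseg : ∀ t ∈ Set.Icc (0 : ℝ) 1, x + t • (y - x) ∈ ball x δ := by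
    intro t ht
    rw [mem_ball, dist_eq_norm, add_sub_cancel_left, norm_smul, Real.norm_eq_abs, abs_of_nonneg ht.1]
    rw [mem_ball, dist_eq_norm] at hy
    exact (mul_le_of_le_one_left (norm_nonneg _) ht.2).trans_lt hy
  have := h.abs_sub_le_of_segment hU (x := x) (v := y - x) (fun t ht => (hball _ (hseg t ht)).2)
    (B := fun t => t * (K * ‖y - x‖)) (B' := fun _ => K * ‖y - x‖) (by fun_prop)
    (fun t _ => by simpa using ((hasDerivAt_id t).mul_const (K * ‖y - x‖)).hasDerivWithinAt)
    (fun t ht => by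
      have := (hball _ (hseg t ⟨ht.1, ht.2.le⟩)).1
      gcongr)
  simpa using this

/-- At a zero of f the local Lipschitz bound gives f(x+v)² = O(|v|²), so the square is
differentiable across the free boundary although f need not be. -/
lemma hasGradientAt_sq (h : IsTruncC1 U f P) (hU : IsOpen U)
    (hb : ∀ x ∈ U, ∃ K, ∀ᶠ y in 𝓝 x, ‖P y‖ ≤ K) {x : Rn n} (hx : x ∈ U) :
    HasGradientAt (fun y => f y ^ 2) ((2 * f x) • P x) x := by
  rcases (h.nonneg x hx).eq_or_lt with h0 | h0
  · obtain ⟨K, hK0, hK⟩ := h.exists_lipschitz hU hb hx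
    rw [h.grad_zero x hx h0.symm, smul_zero, hasGradientAt_iff_hasFDerivAt, map_zero,
      hasFDerivAt_iff_isLittleO_nhds_zero]
    have h1 : (fun v : Rn n => f (x + v) ^ 2) =O[𝓝 0] fun v => ‖v‖ ^ 2 := by
      refine Asymptotics.IsBigO.of_bound (K ^ 2) ?_
      have ht : Tendsto (fun v : Rn n => x + v) (𝓝 0) (𝓝 x) := by
        simpa using (continuous_const_add x).tendsto (0 : Rn n)
      filter_upwards [ht.eventually hK] with v hv
      rw [← h0, sub_zero, add_sub_cancel_left] at hv
      rw [norm_pow, norm_pow, norm_norm, ← mul_pow]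
      exact pow_le_pow_left₀ (norm_nonneg _) hv 2
    have h2 : (fun v : Rn n => ‖v‖ ^ 2) =o[𝓝 0] fun v => v := by
      have := Asymptotics.isLittleO_pow_pow (𝕜 := ℝ) (m := 1) (n := 2) one_lt_two
      have h3 := (this.comp_tendsto (tendsto_norm_zero (E := Rn n)))
      refine Asymptotics.IsLittleO.of_norm_right ?_
      simpa [Function.comp_def] using h3
    have := h1.trans_isLittleO h2
    simpa [← h0] using this
  · rw [hasGradientAt_iff_hasFDerivAt, map_smul]
    refine ((h.grad x hx h0).hasFDerivAt.pow 2).congr_fderiv ?_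
    simp

/-- At a zero of f, P may jump but stays bounded, while f tends to 0. Together with
`hasGradientAt_sq` this makes f² a C¹ function. -/
lemma continuousOn_smul_grad (h : IsTruncC1 U f P) (hU : IsOpen U)
    (hb : ∀ x ∈ U, ∃ K, ∀ᶠ y in 𝓝 x, ‖P y‖ ≤ K) :
    ContinuousOn (fun x => f x • P x) U := by
  intro x hx
  refine ContinuousAt.continuousWithinAt ?_
  have hf := h.cont.continuousAt (hU.mem_nhds hx)
  rcases (h.nonneg x hx).eq_or_lt with h0 | h0
  · obtain ⟨K, hK⟩ := hb x hx
    rw [ContinuousAt, ← h0, zero_smul]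
    refine squeeze_zero_norm' (a := fun y => ‖f y‖ * K) ?_ ?_
    · filter_upwards [hK] with y hy
      rw [norm_smul]; gcongr
    · have := (hf.norm).mul_const K
      simpa [← h0] using this.tendsto
  · exact hf.smul (h.cont_grad.continuousAt ((h.isOpen_pos hU).mem_nhds ⟨hx, h0⟩))

end IsTruncC1

/-! ### The weights, and Hölder bounds up to the axis. -/

/-- The weight `x₁ ^ (1 - 2σ)`: it is `x₁` for `σ = 0` and `1 / x₁` for `σ = 1`. -/
def wt (σ : ℝ) (x : Rn n) : ℝ := x 0 ^ (1 - 2 * σ)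

lemma wt_zero (x : Rn n) : wt 0 x = x 0 := by simp [wt]

lemma wt_one (x : Rn n) : wt 1 x = 1 / x 0 := by
  rw [wt, show (1 : ℝ) - 2 * 1 = -1 by norm_num, Real.rpow_neg_one, one_div]

lemma wt_pos {σ : ℝ} {x : Rn n} (hx : 0 < x 0) : 0 < wt σ x := Real.rpow_pos_of_pos hx _

lemma measurable_wt (σ : ℝ) : Measurable (wt σ : Rn n → ℝ) :=
  (by fun_prop : Measurable fun t : ℝ => t ^ (1 - 2 * σ)).comp (continuous_coord 0).measurable

lemma continuousOn_wt (σ : ℝ) : ContinuousOn (wt σ : Rn n → ℝ) (halfSpace n) := fun x hx =>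
  ((continuous_coord 0).continuousAt.rpow_const (Or.inl (ne_of_gt hx))).continuousWithinAt

lemma wt_smul (σ : ℝ) {s : ℝ} (hs : 0 < s) {x : Rn n} (hx : 0 < x 0) :
    wt σ (s • x) = s ^ (1 - 2 * σ) * wt σ x := by
  simp [wt, Real.mul_rpow hs.le hx.le]

lemma integrableOn_of_le_rpow {F : Rn n → ℝ} {ρ K a : ℝ} (ha : -1 < a)
    (hm : AEStronglyMeasurable F (volume.restrict (halfBall n ρ)))
    (hb : ∀ x ∈ halfBall n ρ, |F x| ≤ K * x 0 ^ a) : IntegrableOn F (halfBall n ρ) := by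
  refine ((integrableOn_rpow_coord ha ρ).const_mul K).mono' hm ?_
  filter_upwards [ae_restrict_mem (isOpen_halfBall ρ).measurableSet] with x hx
  exact hb x hx

lemma add_smul_e₁_coord (x : Rn n) (h : ℝ) : (x + h • e₁ n) 0 = x 0 + h := by
  simp [e₁]

lemma norm_e₁ : ‖e₁ n‖ = 1 := by simp [e₁]

namespace IsTruncC1

variable {f : Rn n → ℝ} {P : Rn n → Rn n} {ρ : ℝ}

/-- The singular bound L x₁^(b-1) is integrated in the direction e₁, where (L/b)(x₁+t)^b is its
primitive. -/
lemma abs_sub_le_vertical (h : IsTruncC1 (halfBall n ρ) f P) {L b : ℝ} (hb : 0 < b)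
    (hP : ∀ x ∈ halfBall n ρ, ‖P x‖ ≤ L * x 0 ^ (b - 1)) {x : Rn n} {s : ℝ} (hs : 0 ≤ s)
    (hx : 0 < x 0) (hxs : ∀ t ∈ Set.Icc 0 s, ‖x + t • e₁ n‖ < ρ) :
    |f (x + s • e₁ n) - f x| ≤ L / b * ((x 0 + s) ^ b - x 0 ^ b) := by
  have hmem : ∀ t ∈ Set.Icc (0 : ℝ) 1, x + t • s • e₁ n ∈ halfBall n ρ := by
    intro t ht
    rw [smul_smul]
    refine ⟨?_, hxs _ ⟨mul_nonneg ht.1 hs, mul_le_of_le_one_left hs ht.2⟩⟩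
    rw [add_smul_e₁_coord]
    have := mul_nonneg ht.1 hs; linarith
  have hd : ∀ t ∈ Set.Icc (0 : ℝ) 1, HasDerivAt (fun t => L / b * (x 0 + t * s) ^ b)
      (L * (x 0 + t * s) ^ (b - 1) * s) t := by
    intro t ht
    have hpos : 0 < x 0 + t * s := by have := mul_nonneg ht.1 hs; linarith
    have h1 : HasDerivAt (fun t => x 0 + t * s) s t := by
      simpa using ((hasDerivAt_id t).mul_const s).const_add (x 0)
    refine ((h1.rpow_const (p := b) (Or.inl hpos.ne')).const_mul (L / b)).congr_deriv ?_
    field_simp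
  have := h.abs_sub_le_of_segment (isOpen_halfBall ρ) (x := x) (v := s • e₁ n) hmem
    (B := fun t => L / b * (x 0 + t * s) ^ b) (B' := fun t => L * (x 0 + t * s) ^ (b - 1) * s)
    (fun t ht => (hd t ht).continuousAt.continuousWithinAt)
    (fun t ht => (hd t ⟨ht.1, ht.2.le⟩).hasDerivWithinAt) (fun t ht => by
      have h1 := hP _ (hmem t ⟨ht.1, ht.2.le⟩)
      rw [smul_smul, add_smul_e₁_coord] at h1
      rw [norm_smul, norm_e₁, mul_one, Real.norm_eq_abs, abs_of_nonneg hs, smul_smul]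
      gcongr)
  refine this.trans (le_of_eq ?_)
  simp; ring

/-- The detour through the interior: both points are lifted by s = |x-y|, at a cost of (L/b) s^b
each, and then joined at height at least s, where the gradient is at most L s^(b-1). The radius ρ/3
keeps the lifted points inside the half-ball of radius ρ, since s < 2ρ/3. -/
lemma holder (h : IsTruncC1 (halfBall n ρ) f P) {L b : ℝ} (hb : 0 < b) (hb1 : b ≤ 1) (hL : 0 ≤ L)
    (hP : ∀ x ∈ halfBall n ρ, ‖P x‖ ≤ L * x 0 ^ (b - 1)) {x y : Rn n}
    (hx : x ∈ halfBall n (ρ / 3)) (hy : y ∈ halfBall n (ρ / 3)) :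
    |f x - f y| ≤ (2 / b + 1) * L * ‖x - y‖ ^ b := by
  rcases eq_or_ne x y with rfl | hne
  · simp only [sub_self, abs_zero]; positivity
  set s := ‖x - y‖ with hs
  have hs0 : 0 < s := norm_pos_iff.2 (sub_ne_zero.2 hne)
  have hs1 : s < 2 * (ρ / 3) := (norm_sub_le x y).trans_lt (by linarith [hx.2, hy.2])
  have hup : ∀ z ∈ halfBall n (ρ / 3), ∀ t ∈ Set.Icc 0 s, ‖z + t • e₁ n‖ < ρ := by
    intro z hz t ht
    refine (norm_add_le _ _).trans_lt ?_
    rw [norm_smul, norm_e₁, mul_one, Real.norm_eq_abs, abs_of_nonneg ht.1]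
    linarith [hz.2, ht.2]
  have hv : ∀ z ∈ halfBall n (ρ / 3), |f (z + s • e₁ n) - f z| ≤ L / b * s ^ b := by
    intro z hz
    refine (h.abs_sub_le_vertical hb hP hs0.le hz.1 (hup z hz)).trans ?_
    gcongr
    -- Subadditivity of t ↦ t^b, which is where b ≤ 1 enters.
    have := Real.rpow_add_le_add_rpow hz.1.le hs0.le hb.le hb1
    linarith
  have hseg : ∀ t ∈ Set.Icc (0 : ℝ) 1, x + t • (y - x) ∈ halfBall n (ρ / 3) := by
    intro t ht
    have hconv : Convex ℝ (halfBall n (ρ / 3)) := by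
      have h1 : Convex ℝ {x : Rn n | 0 < x 0} := by
        intro a ha b hb s t hs ht hst
        simp only [Set.mem_ofPred_eq, PiLp.add_apply, PiLp.smul_apply, smul_eq_mul] at *
        rcases hs.eq_or_lt with rfl | hs
        · rw [zero_add] at hst; subst hst; simpa using hb
        · have := mul_pos hs ha; have := mul_nonneg ht hb.le; linarith
      have h2 : halfBall n (ρ / 3) = {x : Rn n | 0 < x 0} ∩ ball 0 (ρ / 3) := by
        ext; simp [halfBall]
      rw [h2]; exact h1.inter (convex_ball _ _)
    exact hconv.add_smul_sub_mem hx hy ht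
  have hlat : |f (x + s • e₁ n + (y - x)) - f (x + s • e₁ n)| ≤ L * s ^ (b - 1) * s := by
    have hmem : ∀ t ∈ Set.Icc (0 : ℝ) 1, x + s • e₁ n + t • (y - x) ∈ halfBall n ρ := by
      intro t ht
      have h1 := hseg t ht
      rw [add_right_comm]
      refine ⟨?_, hup _ h1 s ⟨hs0.le, le_rfl⟩⟩
      rw [add_smul_e₁_coord]; linarith [h1.1]
    have := h.abs_sub_le_of_segment (isOpen_halfBall ρ) hmem
      (B := fun t => t * (L * s ^ (b - 1) * s)) (B' := fun _ => L * s ^ (b - 1) * s) (by fun_prop)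
      (fun t _ => by simpa using ((hasDerivAt_id t).mul_const (L * s ^ (b - 1) * s)).hasDerivWithinAt)
      (fun t ht => by
        have h1 := hP _ (hmem t ⟨ht.1, ht.2.le⟩)
        have h2 : s ≤ (x + s • e₁ n + t • (y - x)) 0 := by
          have h3 := (hseg t ⟨ht.1, ht.2.le⟩).1
          rw [add_right_comm, add_smul_e₁_coord]; linarith
        rw [norm_sub_rev y x, ← hs]
        gcongr
        refine h1.trans ?_
        gcongr ?_ * ?_
        exact Real.rpow_le_rpow_of_nonpos hs0 h2 (by linarith))
    simpa using this
  have e1 : x + s • e₁ n + (y - x) = y + s • e₁ n := by abel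
  rw [e1] at hlat
  have e2 : s ^ (b - 1) * s = s ^ b := by
    rw [← Real.rpow_add_one hs0.ne']; simp
  rw [mul_assoc, e2] at hlat
  have h1 := abs_le.1 (hv x hx)
  have h2 := abs_le.1 (hv y hy)
  have h3 := abs_le.1 hlat
  have e3 : (2 / b + 1) * L * s ^ b = L / b * s ^ b + L / b * s ^ b + L * s ^ b := by ring
  rw [e3]
  exact abs_le.2 ⟨by linarith, by linarith⟩

end IsTruncC1

lemma exists_bound_deriv_smoothTransition :
    ∃ A : ℝ, 0 ≤ A ∧ (∀ t, |deriv Real.smoothTransition t| ≤ A) ∧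
      ∀ t, t ∉ Set.Icc (0 : ℝ) 1 → deriv Real.smoothTransition t = 0 := by
  have hz : ∀ t, t ∉ Set.Icc (0 : ℝ) 1 → deriv Real.smoothTransition t = 0 := by
    intro t ht
    rw [Set.mem_Icc, not_and_or, not_le, not_le] at ht
    rcases ht with ht | ht
    · have : Real.smoothTransition =ᶠ[𝓝 t] fun _ => 0 := by
        filter_upwards [Iio_mem_nhds ht] with s hs
        exact Real.smoothTransition.zero_of_nonpos (le_of_lt hs)
      rw [this.deriv_eq]; simp
    · have : Real.smoothTransition =ᶠ[𝓝 t] fun _ => 1 := by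
        filter_upwards [Ioi_mem_nhds ht] with s hs
        exact Real.smoothTransition.one_of_one_le (le_of_lt hs)
      rw [this.deriv_eq]; simp
  have hc : Continuous (deriv Real.smoothTransition) :=
    (Real.smoothTransition.contDiff (n := 1)).continuous_deriv le_rfl
  obtain ⟨A, hA⟩ := isCompact_Icc.exists_bound_of_continuousOn
    (s := Set.Icc (0 : ℝ) 1) hc.continuousOn
  refine ⟨A, (norm_nonneg _).trans (hA 0 (by simp)), fun t => ?_, hz⟩
  by_cases ht : t ∈ Set.Icc (0 : ℝ) 1
  · exact hA t ht
  · rw [hz t ht, abs_zero]; exact (norm_nonneg _).trans (hA 0 (by simp))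

/-! ### A single phase: weighted bounds and the equation up to the axis. -/

/-- One phase of a solution in `B_ρ⁺`: `f ≥ 0` has gradient `P`, solves `div(x₁^(1-2σ) P) = 0` weakly
in `{f > 0}`, and has the growth of a function that is homogeneous of degree `β + σ`. -/
structure IsPhase (σ β C ρ : ℝ) (f : Rn n → ℝ) (P : Rn n → Rn n) : Prop
    extends IsTruncC1 (halfBall n ρ) f P where
  C_nonneg : 0 ≤ C
  grad_le : ∀ x ∈ halfBall n ρ, ‖P x‖ ≤ C * x 0 ^ (β + σ - 1)
  le : ∀ x ∈ halfBall n ρ, f x ≤ C * x 0 ^ σ * ‖x‖ ^ β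
  eqn : ∀ ζ : Rn n → ℝ, ContDiff ℝ 1 ζ → HasCompactSupport ζ →
    tsupport ζ ⊆ {x ∈ halfBall n ρ | 0 < f x} →
    ∫ x in halfBall n ρ, wt σ x * fderiv ℝ ζ x (P x) = 0

namespace IsPhase

variable {σ β C C' ρ : ℝ} {f g : Rn n → ℝ} {P Q : Rn n → Rn n}

lemma wt_grad_le (h : IsPhase σ β C ρ f P) {x : Rn n} (hx : x ∈ halfBall n ρ) :
    wt σ x * ‖P x‖ ≤ C * x 0 ^ (β - σ) := by
  calc wt σ x * ‖P x‖ ≤ wt σ x * (C * x 0 ^ (β + σ - 1)) := by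
        gcongr
        · exact (wt_pos hx.1).le
        · exact h.grad_le x hx
    _ = C * x 0 ^ (β - σ) := by
        rw [wt, mul_left_comm, ← Real.rpow_add hx.1]; congr 2; ring

/-- The parameter σ cancels: the weight x₁^(1-2σ) times two factors x₁^(β+σ-1) is x₁^(2β-1). This
power is integrable at the axis when β > 0, for both phases alike. -/
lemma wt_grad_mul_grad_le (h : IsPhase σ β C ρ f P) (h' : IsPhase σ β C' ρ g Q) {x : Rn n}
    (hx : x ∈ halfBall n ρ) : wt σ x * (‖P x‖ * ‖Q x‖) ≤ C * C' * x 0 ^ (2 * β - 1) := by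
  calc wt σ x * (‖P x‖ * ‖Q x‖) = (wt σ x * ‖P x‖) * ‖Q x‖ := by ring
    _ ≤ (C * x 0 ^ (β - σ)) * (C' * x 0 ^ (β + σ - 1)) := by
        exact mul_le_mul (h.wt_grad_le hx) (h'.grad_le x hx) (norm_nonneg _)
          (mul_nonneg h.C_nonneg (Real.rpow_nonneg hx.1.le _))
    _ = C * C' * (x 0 ^ (β - σ) * x 0 ^ (β + σ - 1)) := by ring
    _ = _ := by rw [← Real.rpow_add hx.1]; congr 2; ring

lemma wt_grad_mul_le (h : IsPhase σ β C ρ f P) (h' : IsPhase σ β C' ρ g Q) {x : Rn n}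
    (hx : x ∈ halfBall n ρ) : wt σ x * ‖P x‖ * g x ≤ C * C' * x 0 ^ β * ‖x‖ ^ β := by
  calc wt σ x * ‖P x‖ * g x ≤ (C * x 0 ^ (β - σ)) * (C' * x 0 ^ σ * ‖x‖ ^ β) := by
        exact mul_le_mul (h.wt_grad_le hx) (h'.le x hx) (h'.nonneg x hx)
          (mul_nonneg h.C_nonneg (Real.rpow_nonneg hx.1.le _))
    _ = C * C' * (x 0 ^ (β - σ) * x 0 ^ σ) * ‖x‖ ^ β := by ring
    _ = _ := by rw [← Real.rpow_add hx.1, sub_add_cancel]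

lemma wt_sq_le (h : IsPhase σ β C ρ f P) {x : Rn n} (hx : x ∈ halfBall n ρ) :
    wt σ x * f x ^ 2 ≤ C ^ 2 * x 0 * ‖x‖ ^ (2 * β) := by
  calc wt σ x * f x ^ 2 ≤ wt σ x * (C * x 0 ^ σ * ‖x‖ ^ β) ^ 2 := by
        gcongr
        · exact (wt_pos hx.1).le
        · exact h.nonneg x hx
        · exact h.le x hx
    _ = C ^ 2 * (x 0 ^ (1 - 2 * σ) * (x 0 ^ σ) ^ 2) * (‖x‖ ^ β) ^ 2 := by rw [wt]; ring
    _ = _ := by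
        rw [← Real.rpow_natCast (x 0 ^ σ), ← Real.rpow_mul hx.1.le, ← Real.rpow_add hx.1,
          ← Real.rpow_natCast (‖x‖ ^ β), ← Real.rpow_mul (norm_nonneg _)]
        push_cast
        rw [show 1 - 2 * σ + σ * 2 = 1 by ring, Real.rpow_one, mul_comm β 2]

lemma locally_bounded (h : IsPhase σ β C ρ f P) (x : Rn n) (hx : x ∈ halfBall n ρ) :
    ∃ K, ∀ᶠ y in 𝓝 x, ‖P y‖ ≤ K := by
  have hc : ContinuousAt (fun y : Rn n => C * y 0 ^ (β + σ - 1)) x :=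
    continuousAt_const.mul ((continuous_coord 0).continuousAt.rpow_const (Or.inl hx.1.ne'))
  refine ⟨C * x 0 ^ (β + σ - 1) + 1, ?_⟩
  filter_upwards [hc.eventually_lt continuousAt_const (lt_add_one _),
    (isOpen_halfBall ρ).mem_nhds hx] with y hy hyU
  exact (h.grad_le y hyU).trans hy.le

lemma mono (h : IsPhase σ β C ρ f P) {r : ℝ} (hr : r ≤ ρ) : IsPhase σ β C r f P where
  toIsTruncC1 := h.toIsTruncC1.mono (halfBall_mono hr)
  C_nonneg := h.C_nonneg
  grad_le x hx := h.grad_le x (halfBall_mono hr hx)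
  le x hx := h.le x (halfBall_mono hr hx)
  eqn ζ h1 h2 h3 := by
    have hz : ∀ x, x ∉ halfBall n r → fderiv ℝ ζ x = 0 := fun x hx =>
      fderiv_of_notMem_tsupport ℝ fun h => hx (h3 h).1
    have := h.eqn ζ h1 h2 (h3.trans fun x hx => ⟨halfBall_mono hr hx.1, hx.2⟩)
    rw [setIntegral_eq_integral_of_forall_compl_eq_zero
      (fun x hx => by simp [hz x fun h => hx (halfBall_mono hr h)])] at this
    rwa [setIntegral_eq_integral_of_forall_compl_eq_zero (fun x hx => by simp [hz x hx])]

/-- Test functions that need not vanish near `{x₁ = 0}`. -/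
lemma eqn_up_to_axis (h : IsPhase σ β C ρ f P) {ζ : Rn n → ℝ} (hζ : ContDiffOn ℝ 1 ζ (halfBall n ρ))
    {R ε K γ : ℝ} (hR : R < ρ) (hζR : ∀ x ∈ halfBall n ρ, R ≤ ‖x‖ → ζ x = 0) (hε : 0 < ε)
    (hζε : ∀ x ∈ halfBall n ρ, f x ≤ ε → ζ x = 0) (hγ : 0 < γ)
    (hK : ∀ x ∈ halfBall n ρ, wt σ x * ‖P x‖ * |ζ x| ≤ K * x 0 ^ γ)
    (hint : IntegrableOn (fun x => wt σ x * fderiv ℝ ζ x (P x)) (halfBall n ρ)) :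
    ∫ x in halfBall n ρ, wt σ x * fderiv ℝ ζ x (P x) = 0 := by
  set U := halfBall n ρ with hUdef
  have hU : IsOpen U := isOpen_halfBall ρ
  obtain ⟨A, hA0, hA, hA'⟩ := exists_bound_deriv_smoothTransition
  have hχ : ContDiff ℝ 1 Real.smoothTransition := Real.smoothTransition.contDiff (n := 1)
  -- The cutoff θ_k vanishes for x₁ ≤ 1/(k+1) and equals 1 for x₁ ≥ 2/(k+1).
  set a : ℕ → Rn n → ℝ := fun k x => ((k : ℝ) + 1) * x 0 - 1 with ha
  set θ : ℕ → Rn n → ℝ := fun k x => Real.smoothTransition (a k x) with hθ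
  have hac : ∀ k, ContDiff ℝ 1 (a k) := fun k => by
    have : ContDiff ℝ 1 fun x : Rn n => x 0 := by fun_prop
    exact (contDiff_const.mul this).sub contDiff_const
  have hθc : ∀ k, ContDiff ℝ 1 (θ k) := fun k => hχ.comp (hac k)
  have hθd : ∀ k x v, fderiv ℝ (θ k) x v =
      deriv Real.smoothTransition (a k x) * (((k : ℝ) + 1) * v 0) := by
    intro k x v
    have h1 : HasFDerivAt (a k) (((k : ℝ) + 1) • EuclideanSpace.proj (𝕜 := ℝ) (0 : Fin n)) x :=
      ((EuclideanSpace.proj (𝕜 := ℝ) (0 : Fin n)).hasFDerivAt.const_mul ((k : ℝ) + 1)).sub_const 1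
    have h2 := (hχ.differentiable one_ne_zero (a k x)).hasDerivAt.comp_hasFDerivAt x h1
    rw [show θ k = Real.smoothTransition ∘ a k from rfl, h2.fderiv]
    simp
  -- the truncated test functions
  have key : ∀ k : ℕ, ∫ x in U, (wt σ x * fderiv ℝ ζ x (P x)) * θ k x +
      wt σ x * ζ x * (deriv Real.smoothTransition (a k x) * (((k : ℝ) + 1) * P x 0)) = 0 := by
    intro k
    have hk : (0 : ℝ) < (k : ℝ) + 1 := by positivity
    -- ζ is C¹ in U only, so the product is extended by zero. The closed set S below contains its
    -- support and lies in U ∩ {f > 0}: it stays away from the axis, from the sphere |x| = ρ and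
    -- from {f = 0}.
    set Z : Rn n → ℝ := U.indicator fun x => ζ x * θ k x with hZ
    set S : Set (Rn n) := {x | (1 / ((k : ℝ) + 1) ≤ x 0 ∧ ‖x‖ ≤ R) ∧ f x ∈ Set.Ici ε} with hS
    set T : Set (Rn n) := {x | 1 / ((k : ℝ) + 1) ≤ x 0 ∧ ‖x‖ ≤ R} with hT
    have hTc : IsClosed T := (isClosed_le continuous_const (continuous_coord 0)).inter
      (isClosed_le continuous_norm continuous_const)
    have hTU : T ⊆ U := fun x hx => ⟨(by positivity : (0 : ℝ) < 1 / ((k : ℝ) + 1)).trans_le hx.1,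
      hx.2.trans_lt hR⟩
    have hSc : IsClosed S := (h.cont.mono hTU).preimage_isClosed_of_isClosed hTc isClosed_Ici
    have hsupp : Function.support Z ⊆ S := by
      intro x hx
      have hxU : x ∈ U := Set.mem_of_indicator_ne_zero hx
      rw [Function.mem_support, hZ, Set.indicator_of_mem hxU] at hx
      have h1 := left_ne_zero_of_mul hx
      have h2 := right_ne_zero_of_mul hx
      refine ⟨⟨?_, ?_⟩, ?_⟩
      · by_contra hcon
        refine h2 (Real.smoothTransition.zero_of_nonpos ?_)
        rw [not_le, lt_div_iff₀ hk] at hcon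
        simp only [ha]; linarith
      · by_contra hcon; exact h1 (hζR x hxU (not_le.1 hcon).le)
      · by_contra hcon; exact h1 (hζε x hxU (not_le.1 hcon).le)
    have hts : tsupport Z ⊆ S := closure_minimal hsupp hSc
    have hSU : S ⊆ {x ∈ U | 0 < f x} := fun x hx => ⟨hTU hx.1, hε.trans_le hx.2⟩
    have hcomp : HasCompactSupport Z :=
      HasCompactSupport.of_support_subset_isCompact
        ((isCompact_closedBall (0 : Rn n) R).of_isClosed_subset hSc
          fun x hx => by simpa using hx.1.2) hsupp
    have hev : ∀ x ∈ U, Z =ᶠ[𝓝 x] fun x => ζ x * θ k x := fun x hx => by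
      filter_upwards [hU.mem_nhds hx] with y hy
      exact Set.indicator_of_mem hy _
    have hZc : ContDiff ℝ 1 Z := by
      refine contDiff_iff_contDiffAt.2 fun x => ?_
      by_cases hx : x ∈ U
      · exact ((hζ.contDiffAt (hU.mem_nhds hx)).mul (hθc k).contDiffAt).congr_of_eventuallyEq (hev x hx)
      · have hx' : x ∉ tsupport Z := fun hx' => hx (hSU (hts hx')).1
        exact contDiffAt_const.congr_of_eventuallyEq (notMem_tsupport_iff_eventuallyEq.1 hx')
    rw [← h.eqn Z hZc hcomp (hts.trans hSU)]
    refine setIntegral_congr_fun hU.measurableSet fun x hx => ?_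
    have h1 := ((hζ.contDiffAt (hU.mem_nhds hx)).differentiableAt one_ne_zero).hasFDerivAt.mul
      ((hθc k).differentiable one_ne_zero x).hasFDerivAt
    have h2 : fderiv ℝ Z x = ζ x • fderiv ℝ (θ k) x + θ k x • fderiv ℝ ζ x := by
      rw [(hev x hx).fderiv_eq]; exact h1.fderiv
    simp only [h2, add_apply, smul_apply, hθd, smul_eq_mul]
    ring
  have hmeas1 : ∀ k, AEStronglyMeasurable (θ k) (volume.restrict U) := fun k =>
    (hθc k).continuous.aestronglyMeasurable
  have hP := h.aestronglyMeasurable_grad hU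
  have hP0 : AEStronglyMeasurable (fun x => P x 0) (volume.restrict U) :=
    (continuous_coord 0).comp_aestronglyMeasurable hP
  have hζm : AEStronglyMeasurable ζ (volume.restrict U) :=
    hζ.continuousOn.aestronglyMeasurable hU.measurableSet
  have hwm : AEStronglyMeasurable (wt σ) (volume.restrict U) := (measurable_wt σ).aestronglyMeasurable
  have hθ1 : ∀ x ∈ U, Tendsto (fun k => θ k x) atTop (𝓝 1) ∧
      ∀ᶠ k in atTop, deriv Real.smoothTransition (a k x) = 0 := by
    intro x hx
    have hlarge : ∀ᶠ k : ℕ in atTop, 1 < a k x := by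
      have h1 : Tendsto (fun k : ℕ => ((k : ℝ) + 1) * x 0 - 1) atTop atTop :=
        tendsto_atTop_add_const_right _ _ ((tendsto_atTop_add_const_right _ _
          tendsto_natCast_atTop_atTop).atTop_mul_const hx.1)
      exact h1.eventually_gt_atTop 1
    refine ⟨tendsto_const_nhds.congr' ?_, ?_⟩
    · filter_upwards [hlarge] with k hk
      exact (Real.smoothTransition.one_of_one_le hk.le).symm
    · filter_upwards [hlarge] with k hk
      exact hA' _ fun h => not_lt.2 h.2 hk
  -- The derivative of the cutoff has size k+1, but it is supported where k+1 ≤ 2/x₁. So the error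
  -- term is dominated by a multiple of x₁^(γ-1), which is integrable since γ > 0, and it tends to 0
  -- pointwise.
  have hbd2 : ∀ k : ℕ, ∀ x ∈ U, |wt σ x * ζ x * (deriv Real.smoothTransition (a k x) *
      (((k : ℝ) + 1) * P x 0))| ≤ 2 * A * K * x 0 ^ (γ - 1) := by
    intro k x hx
    have hk : (0 : ℝ) < (k : ℝ) + 1 := by positivity
    have hx0 : 0 < x 0 := hx.1
    have h3 : 0 ≤ K * x 0 ^ γ := le_trans (by have := wt_pos (σ := σ) hx0; positivity) (hK x hx)
    have h4 : K * x 0 ^ (γ - 1) = K * x 0 ^ γ / x 0 := by rw [Real.rpow_sub_one hx0.ne']; ring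
    by_cases ht : a k x ∈ Set.Icc (0 : ℝ) 1
    · have h1 : (k : ℝ) + 1 ≤ 2 / x 0 := by
        rw [le_div_iff₀ hx0]; have := ht.2; simp only [ha] at this; linarith
      have h2 := hK x hx
      have hp0 := abs_coord_le_norm (P x) 0
      have hw := wt_pos (σ := σ) hx0
      rw [abs_mul, abs_mul, abs_mul, abs_mul, abs_of_pos hw, abs_of_pos hk]
      calc wt σ x * |ζ x| * (|deriv Real.smoothTransition (a k x)| * (((k : ℝ) + 1) * |P x 0|))
          ≤ wt σ x * |ζ x| * (A * (2 / x 0 * ‖P x‖)) := by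
            gcongr; exact hA _
        _ = 2 * A / x 0 * (wt σ x * ‖P x‖ * |ζ x|) := by ring
        _ ≤ 2 * A / x 0 * (K * x 0 ^ γ) := by gcongr
        _ = 2 * A * (K * x 0 ^ (γ - 1)) := by rw [h4]; ring
        _ = _ := by ring
    · rw [hA' _ ht]
      simp only [zero_mul, mul_zero, abs_zero]
      rw [mul_assoc, h4]; positivity
  have hm2 : ∀ k : ℕ, AEStronglyMeasurable (fun x => wt σ x * ζ x *
      (deriv Real.smoothTransition (a k x) * (((k : ℝ) + 1) * P x 0))) (volume.restrict U) := fun k =>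
    (hwm.mul hζm).mul (((hχ.continuous_deriv le_rfl).comp (hac k).continuous).aestronglyMeasurable.mul
      (aestronglyMeasurable_const.mul hP0))
  have hint2 : ∀ k : ℕ, IntegrableOn (fun x => wt σ x * ζ x *
      (deriv Real.smoothTransition (a k x) * (((k : ℝ) + 1) * P x 0))) U := fun k =>
    integrableOn_of_le_rpow (by linarith) (hm2 k) (hbd2 k)
  have hθle : ∀ k x, ‖θ k x‖ ≤ 1 := fun k x => by
    rw [Real.norm_eq_abs, abs_of_nonneg (Real.smoothTransition.nonneg _)]
    exact Real.smoothTransition.le_one _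
  have hint1 : ∀ k : ℕ, IntegrableOn (fun x => (wt σ x * fderiv ℝ ζ x (P x)) * θ k x) U := fun k =>
    hint.mul_bdd (c := 1) (hmeas1 k) (ae_of_all _ (hθle k))
  have t1 : Tendsto (fun k => ∫ x in U, (wt σ x * fderiv ℝ ζ x (P x)) * θ k x) atTop
      (𝓝 (∫ x in U, wt σ x * fderiv ℝ ζ x (P x))) := by
    refine tendsto_integral_of_dominated_convergence
      (fun x => ‖wt σ x * fderiv ℝ ζ x (P x)‖) (fun k => (hint1 k).1) hint.norm ?_ ?_
    · intro k
      refine ae_of_all _ fun x => ?_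
      rw [norm_mul]
      exact mul_le_of_le_one_right (norm_nonneg _) (hθle k x)
    · filter_upwards [ae_restrict_mem hU.measurableSet] with x hx
      simpa using tendsto_const_nhds.mul (hθ1 x hx).1
  have t2 : Tendsto (fun k : ℕ => ∫ x in U, wt σ x * ζ x *
      (deriv Real.smoothTransition (a k x) * (((k : ℝ) + 1) * P x 0))) atTop
      (𝓝 (∫ x in U, (0 : ℝ))) := by
    refine tendsto_integral_of_dominated_convergence
      (fun x => 2 * A * K * x 0 ^ (γ - 1)) hm2
      ((integrableOn_rpow_coord (by linarith) ρ).const_mul _) ?_ ?_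
    · intro k
      filter_upwards [ae_restrict_mem hU.measurableSet] with x hx
      exact hbd2 k x hx
    · filter_upwards [ae_restrict_mem hU.measurableSet] with x hx
      refine tendsto_const_nhds.congr' ?_
      filter_upwards [(hθ1 x hx).2] with k hk
      simp [hk]
  have t3 := t1.add t2
  rw [integral_zero, add_zero] at t3
  refine tendsto_nhds_unique t3 (tendsto_const_nhds.congr fun k => ?_)
  rw [← key k, integral_add (hint1 k) (hint2 k)]

end IsPhase

open scoped Pointwise in
lemma smul_halfBall {r ρ : ℝ} (hr : 0 < r) : r • halfBall n (ρ / r) = halfBall n ρ := by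
  ext x
  rw [Set.mem_smul_set_iff_inv_smul_mem₀ hr.ne']
  simp only [halfBall, Set.mem_ofPred_eq, PiLp.smul_apply, smul_eq_mul, norm_smul, norm_inv,
    Real.norm_eq_abs, abs_of_pos hr, lt_div_iff₀ hr, mul_pos_iff_of_pos_left (inv_pos.2 hr)]
  rw [mul_comm r⁻¹ ‖x‖, inv_mul_cancel_right₀ hr.ne']

lemma integral_halfBall_comp_smul {r ρ : ℝ} (hr : 0 < r) (F : Rn n → ℝ) :
    ∫ x in halfBall n (ρ / r), F (r • x) = (r ^ n)⁻¹ * ∫ x in halfBall n ρ, F x := by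
  have h := Measure.setIntegral_comp_smul_of_pos (volume : Measure (Rn n)) F (halfBall n (ρ / r)) hr
  rw [smul_halfBall hr] at h
  simpa using h

lemma smul_mem_halfBall {r ρ : ℝ} (hr : 0 < r) {x : Rn n} (hx : x ∈ halfBall n (ρ / r)) :
    r • x ∈ halfBall n ρ := by
  rw [← smul_halfBall (n := n) (ρ := ρ) hr]; exact Set.smul_mem_smul_set hx

lemma hasCompactSupport_of_norm_le {η : Rn n → ℝ} {R : ℝ} (h : ∀ x, R ≤ ‖x‖ → η x = 0) :
    HasCompactSupport η := by
  refine HasCompactSupport.of_support_subset_isCompact (isCompact_closedBall (0 : Rn n) R) ?_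
  intro x hx
  by_contra hcon
  rw [mem_closedBall_zero_iff, not_le] at hcon
  exact hx (h x hcon.le)

lemma exists_bound_test {η : Rn n → ℝ} (hη : ContDiff ℝ 1 η) {R : ℝ}
    (h : ∀ x, R ≤ ‖x‖ → η x = 0) :
    ∃ A, 0 ≤ A ∧ (∀ x, |η x| ≤ A) ∧ ∀ x, ‖fderiv ℝ η x‖ ≤ A := by
  have hc := hasCompactSupport_of_norm_le h
  obtain ⟨A, hA⟩ := hc.exists_bound_of_continuous hη.continuous
  obtain ⟨B, hB⟩ := (hc.fderiv (𝕜 := ℝ)).exists_bound_of_continuous (hη.continuous_fderiv one_ne_zero)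
  exact ⟨max A B, (norm_nonneg _).trans ((hA 0).trans (le_max_left _ _)),
    fun x => (hA x).trans (le_max_left _ _), fun x => (hB x).trans (le_max_right _ _)⟩

namespace IsPhase

variable {σ β C C' ρ : ℝ} {f g : Rn n → ℝ} {P Q : Rn n → Rn n}

lemma aestronglyMeasurable_fderiv_apply (h : IsPhase σ β C ρ f P) {η : Rn n → ℝ}
    (hη : ContDiff ℝ 1 η) :
    AEStronglyMeasurable (fun x => fderiv ℝ η x (P x)) (volume.restrict (halfBall n ρ)) := by
  have h1 := h.aestronglyMeasurable_grad (isOpen_halfBall ρ)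
  have h2 := (hη.continuous_fderiv one_ne_zero).aestronglyMeasurable
    (μ := volume.restrict (halfBall n ρ))
  exact (isBoundedBilinearMap_apply (𝕜 := ℝ) (E := Rn n)
    (F := ℝ)).continuous.comp_aestronglyMeasurable (h2.prodMk h1)

lemma integrableOn_inner (h : IsPhase σ β C ρ f P) (h' : IsPhase σ β C' ρ g Q) (hβ : 0 < β)
    {m : Rn n → ℝ} {A : ℝ} (hm : AEStronglyMeasurable m (volume.restrict (halfBall n ρ)))
    (hA : ∀ x ∈ halfBall n ρ, |m x| ≤ A) :
    IntegrableOn (fun x => m x * (wt σ x * inner ℝ (P x) (Q x))) (halfBall n ρ) := by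
  have hU : IsOpen (halfBall n ρ) := isOpen_halfBall ρ
  refine integrableOn_of_le_rpow (a := 2 * β - 1) (K := A * (C * C')) (by linarith)
    (hm.mul ((measurable_wt σ).aestronglyMeasurable.mul
      ((h.aestronglyMeasurable_grad hU).inner (h'.aestronglyMeasurable_grad hU)))) fun x hx => ?_
  have hw := wt_pos (σ := σ) hx.1
  have hA0 : 0 ≤ A := (abs_nonneg _).trans (hA x hx)
  rw [abs_mul, abs_mul, abs_of_pos hw, mul_assoc A]
  refine mul_le_mul (hA x hx) (le_trans ?_ (h.wt_grad_mul_grad_le h' hx)) (by positivity) hA0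
  exact mul_le_mul_of_nonneg_left (abs_real_inner_le_norm _ _) hw.le

lemma integrableOn_mul_apply (h : IsPhase σ β C ρ f P) (h' : IsPhase σ β C' ρ g Q) (hβ : 0 < β)
    {m : Rn n → ℝ} (hm : AEStronglyMeasurable m (volume.restrict (halfBall n ρ)))
    {F : Rn n → ℝ} {A : ℝ} (hF : AEStronglyMeasurable F (volume.restrict (halfBall n ρ)))
    (hA0 : 0 ≤ A) (hFA : ∀ x ∈ halfBall n ρ, |F x| ≤ A * ‖P x‖)
    (hmg : ∀ x ∈ halfBall n ρ, |m x| ≤ g x) :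
    IntegrableOn (fun x => m x * (wt σ x * F x)) (halfBall n ρ) := by
  refine integrableOn_of_le_rpow (a := β) (K := A * (C * C') * ρ ^ β) (by linarith)
    (hm.mul ((measurable_wt σ).aestronglyMeasurable.mul hF)) fun x hx => ?_
  have hw := wt_pos (σ := σ) hx.1
  have hx0 := hx.1
  have hC := mul_nonneg h.C_nonneg h'.C_nonneg
  rw [abs_mul, abs_mul, abs_of_pos hw]
  calc |m x| * (wt σ x * |F x|) ≤ g x * (wt σ x * (A * ‖P x‖)) := by
        gcongr
        · exact h'.nonneg x hx
        · exact hmg x hx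
        · exact hFA x hx
    _ = A * (wt σ x * ‖P x‖ * g x) := by ring
    _ ≤ A * (C * C' * x 0 ^ β * ‖x‖ ^ β) :=
      mul_le_mul_of_nonneg_left (h.wt_grad_mul_le h' hx) hA0
    _ ≤ A * (C * C' * x 0 ^ β * ρ ^ β) := by
        have := Real.rpow_nonneg hx0.le β
        gcongr; exact hx.2.le
    _ = _ := by ring

/-- The equation for `f`, tested with a truncation of `g`. -/
lemma integral_inner_eq (h : IsPhase σ β C ρ f P) (h' : IsPhase σ β C' ρ g Q) (hβ : 0 < β)
    {η : Rn n → ℝ} (hη : ContDiff ℝ 1 η) {R : ℝ} (hR : R < ρ) (hηR : ∀ x, R ≤ ‖x‖ → η x = 0)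
    {ε δ : ℝ} (hε : 0 < ε) (hδ : 0 < δ)
    (hsub : ∀ x ∈ halfBall n ρ, ‖x‖ < R → ε < g x → δ < f x) :
    ∫ x in halfBall n ρ, (η x * truncDeriv ε (g x)) * (wt σ x * inner ℝ (P x) (Q x)) =
      -∫ x in halfBall n ρ, trunc ε (g x) * (wt σ x * fderiv ℝ η x (P x)) := by
  have hU : IsOpen (halfBall n ρ) := isOpen_halfBall ρ
  obtain ⟨A, hA0, hA, hA'⟩ := exists_bound_test hη hηR
  have hgc := contDiffOn_one_of_hasGradientAt hU (fun x hx => h'.hasGradientAt_trunc hU hε hx)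
    (h'.continuousOn_trunc_grad hU hε)
  have hgm := h'.aestronglyMeasurable hU
  have i1 := h.integrableOn_inner h' hβ (m := fun x => η x * truncDeriv ε (g x)) (A := A)
    (hη.continuous.aestronglyMeasurable.mul
      ((continuous_truncDeriv hε).comp_aestronglyMeasurable hgm))
    (fun x _ => by
      rw [abs_mul]
      calc |η x| * |truncDeriv ε (g x)| ≤ A * 1 :=
            mul_le_mul (hA x) (abs_truncDeriv_le hε _) (abs_nonneg _) hA0
        _ = A := mul_one A)
  have i2 := h.integrableOn_mul_apply h' hβ (m := fun x => trunc ε (g x))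
    (F := fun x => fderiv ℝ η x (P x))
    ((continuous_trunc hε).comp_aestronglyMeasurable hgm)
    (h.aestronglyMeasurable_fderiv_apply hη) hA0
    (fun x _ => ((fderiv ℝ η x).le_opNorm (P x)).trans (by gcongr; exact hA' x))
    (fun x hx => abs_trunc_le hε (h'.nonneg x hx))
  have heq : ∀ x ∈ halfBall n ρ, wt σ x * fderiv ℝ (fun x => η x * trunc ε (g x)) x (P x) =
      (η x * truncDeriv ε (g x)) * (wt σ x * inner ℝ (P x) (Q x)) +
        trunc ε (g x) * (wt σ x * fderiv ℝ η x (P x)) := by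
    intro x hx
    have h1 := (hη.differentiable one_ne_zero x).hasFDerivAt.mul
      (h'.hasGradientAt_trunc hU hε hx).hasFDerivAt
    rw [show (fun x => η x * trunc ε (g x)) = η * fun x => trunc ε (g x) from rfl, h1.fderiv]
    simp only [add_apply, smul_apply, smul_eq_mul, InnerProductSpace.toDual_apply_apply,
      real_inner_comm (P x), inner_smul_right]
    ring
  -- By `hsub` the function η · trunc ε(g) vanishes where f ≤ δ, so it is admissible in the equation
  -- for f although it is built from another function. This freedom is used for two members of a
  -- blow-up sequence.
  have hz := h.eqn_up_to_axis (ζ := fun x => η x * trunc ε (g x)) (hη.contDiffOn.mul hgc) hR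
    (fun x _ hx => by simp [hηR x hx]) hδ
    (fun x hx hfx => by
      rcases lt_or_ge ‖x‖ R with hxR | hxR
      · rw [trunc_of_le hε, mul_zero]
        by_contra hcon
        exact absurd hfx (not_le.2 (hsub x hx hxR (not_le.1 hcon)))
      · simp [hηR x hxR]) hβ (K := A * (C * C') * ρ ^ β)
    (fun x hx => by
      have hw := wt_pos (σ := σ) hx.1
      have hx0 := hx.1
      have hC := mul_nonneg h.C_nonneg h'.C_nonneg
      rw [abs_mul]
      calc wt σ x * ‖P x‖ * (|η x| * |trunc ε (g x)|) ≤ wt σ x * ‖P x‖ * (A * g x) := by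
            gcongr
            · exact hA x
            · exact abs_trunc_le hε (h'.nonneg x hx)
        _ = A * (wt σ x * ‖P x‖ * g x) := by ring
        _ ≤ A * (C * C' * x 0 ^ β * ‖x‖ ^ β) :=
      mul_le_mul_of_nonneg_left (h.wt_grad_mul_le h' hx) hA0
        _ ≤ A * (C * C' * x 0 ^ β * ρ ^ β) := by
            have := Real.rpow_nonneg hx0.le β
            gcongr; exact hx.2.le
        _ = _ := by ring)
    ((i1.add i2).congr_fun (fun x hx => (heq x hx).symm) hU.measurableSet)
  rw [setIntegral_congr_fun hU.measurableSet heq, integral_add i1 i2] at hz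
  linarith

/-- The case g = f of `integral_inner_eq`, with the truncation level tending to 0. It recovers the
energy from an expression with only one gradient factor, which passes to weak limits. -/
lemma integral_energy_eq (h : IsPhase σ β C ρ f P) (hβ : 0 < β)
    {η : Rn n → ℝ} (hη : ContDiff ℝ 1 η) {R : ℝ} (hR : R < ρ) (hηR : ∀ x, R ≤ ‖x‖ → η x = 0) :
    ∫ x in halfBall n ρ, η x * (wt σ x * ‖P x‖ ^ 2) =
      -∫ x in halfBall n ρ, f x * (wt σ x * fderiv ℝ η x (P x)) := by
  have hU : IsOpen (halfBall n ρ) := isOpen_halfBall ρ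
  obtain ⟨A, hA0, hA, hA'⟩ := exists_bound_test hη hηR
  have hk : ∀ k : ℕ, (0 : ℝ) < 1 / (k + 1) := fun k => by positivity
  have hfm := h.aestronglyMeasurable hU
  have hPm := h.aestronglyMeasurable_grad hU
  have hwm : AEStronglyMeasurable (wt σ) (volume.restrict (halfBall n ρ)) :=
    (measurable_wt σ).aestronglyMeasurable
  have i1 := h.integrableOn_inner h hβ (m := η) (A := A) hη.continuous.aestronglyMeasurable
    (fun x _ => hA x)
  have i2 := h.integrableOn_mul_apply h hβ (m := f) (F := fun x => fderiv ℝ η x (P x)) hfm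
    (h.aestronglyMeasurable_fderiv_apply hη) hA0
    (fun x _ => ((fderiv ℝ η x).le_opNorm (P x)).trans (by gcongr; exact hA' x))
    (fun x hx => (abs_of_nonneg (h.nonneg x hx)).le)
  have t1 : Tendsto (fun k : ℕ => ∫ x in halfBall n ρ,
      (η x * truncDeriv (1 / (k + 1)) (f x)) * (wt σ x * inner ℝ (P x) (P x))) atTop
      (𝓝 (∫ x in halfBall n ρ, η x * (wt σ x * inner ℝ (P x) (P x)))) := by
    refine tendsto_integral_of_dominated_convergence _ (fun k => ?_) i1.norm (fun k => ?_) ?_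
    · exact (hη.continuous.aestronglyMeasurable.mul ((continuous_truncDeriv
        (hk k)).comp_aestronglyMeasurable hfm)).mul (hwm.mul (hPm.inner hPm))
    · refine ae_of_all _ fun x => ?_
      rw [norm_mul, norm_mul (η x), norm_mul (η x)]
      gcongr
      exact mul_le_of_le_one_right (norm_nonneg _) (abs_truncDeriv_le (hk k) _)
    · filter_upwards [ae_restrict_mem hU.measurableSet] with x hx
      -- The derivative of the truncation does not tend to 1 on {f = 0}, but there P = 0.
      rcases (h.nonneg x hx).eq_or_lt with h0 | h0
      · simp [h.grad_zero x hx h0.symm]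
      · have := ((tendsto_truncDeriv h0).const_mul (η x)).mul_const (wt σ x * inner ℝ (P x) (P x))
        simpa using this
  have t2 : Tendsto (fun k : ℕ => ∫ x in halfBall n ρ,
      trunc (1 / (k + 1)) (f x) * (wt σ x * fderiv ℝ η x (P x))) atTop
      (𝓝 (∫ x in halfBall n ρ, f x * (wt σ x * fderiv ℝ η x (P x)))) := by
    refine tendsto_integral_of_dominated_convergence _ (fun k => ?_) i2.norm (fun k => ?_) ?_
    · exact ((continuous_trunc (hk k)).comp_aestronglyMeasurable hfm).mul
        (hwm.mul (h.aestronglyMeasurable_fderiv_apply hη))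
    · filter_upwards [ae_restrict_mem hU.measurableSet] with x hx
      rw [norm_mul, norm_mul (f x)]
      gcongr
      rw [Real.norm_eq_abs, Real.norm_eq_abs, abs_of_nonneg (h.nonneg x hx)]
      exact abs_trunc_le (hk k) (h.nonneg x hx)
    · filter_upwards [ae_restrict_mem hU.measurableSet] with x hx
      exact (tendsto_trunc (h.nonneg x hx)).mul_const _
  simp only [real_inner_self_eq_norm_sq] at t1
  refine tendsto_nhds_unique t1 (t2.neg.congr fun k => ?_)
  rw [← h.integral_inner_eq h hβ hη hR hηR (hk k) (hk k) (fun x _ _ hx => hx)]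
  simp only [real_inner_self_eq_norm_sq]

/-- The blow-up of a phase. -/
lemma scale (h : IsPhase σ β C ρ f P) {r : ℝ} (hr : 0 < r) :
    IsPhase σ β C (ρ / r) (fun x => f (r • x) / r ^ (β + σ))
      (fun x => r ^ (1 - (β + σ)) • P (r • x)) where
  nonneg x hx := div_nonneg (h.nonneg _ (smul_mem_halfBall hr hx)) (Real.rpow_nonneg hr.le _)
  cont := (h.cont.comp (continuous_const_smul r).continuousOn
    fun x hx => smul_mem_halfBall hr hx).div_const _
  grad x hx hpos := by
    have hra : 0 < r ^ (β + σ) := Real.rpow_pos_of_pos hr _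
    have h1 := (h.grad _ (smul_mem_halfBall hr hx) ((div_pos_iff_of_pos_right hra).1 hpos)).hasFDerivAt
    have h2 : HasFDerivAt (fun x : Rn n => r • x) (r • ContinuousLinearMap.id ℝ (Rn n)) x :=
      (hasFDerivAt_id x).const_smul r
    have h3 := (h1.comp x h2).mul_const (r ^ (β + σ))⁻¹
    rw [hasGradientAt_iff_hasFDerivAt]
    simp only [div_eq_mul_inv]
    refine h3.congr_fderiv ?_
    ext v
    rw [Real.rpow_sub hr, Real.rpow_one]
    simp [InnerProductSpace.toDual_apply_apply]
    ring
  grad_zero x hx h0 := by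
    have hra : r ^ (β + σ) ≠ 0 := (Real.rpow_pos_of_pos hr _).ne'
    rw [h.grad_zero _ (smul_mem_halfBall hr hx) ((div_eq_zero_iff.1 h0).resolve_right hra), smul_zero]
  cont_grad := by
    have hra : 0 < r ^ (β + σ) := Real.rpow_pos_of_pos hr _
    exact (h.cont_grad.comp (continuous_const_smul (T := Rn n) r).continuousOn
      (fun x (hx : x ∈ halfBall n (ρ / r) ∧ 0 < f (r • x) / r ^ (β + σ)) =>
        ⟨smul_mem_halfBall hr hx.1, (div_pos_iff_of_pos_right hra).1 hx.2⟩)).const_smul (r ^ (1 - (β + σ)))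
  C_nonneg := h.C_nonneg
  grad_le x hx := by
    have h1 := h.grad_le _ (smul_mem_halfBall hr hx)
    have hra : 0 < r ^ (1 - (β + σ)) := Real.rpow_pos_of_pos hr _
    rw [norm_smul, Real.norm_eq_abs, abs_of_pos hra]
    calc r ^ (1 - (β + σ)) * ‖P (r • x)‖ ≤ r ^ (1 - (β + σ)) * (C * (r • x) 0 ^ (β + σ - 1)) := by
          gcongr
      _ = C * (r ^ (1 - (β + σ)) * r ^ (β + σ - 1)) * x 0 ^ (β + σ - 1) := by
          rw [PiLp.smul_apply, smul_eq_mul, Real.mul_rpow hr.le hx.1.le]; ring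
      _ = _ := by
          rw [← Real.rpow_add hr, show 1 - (β + σ) + (β + σ - 1) = 0 by ring, Real.rpow_zero, mul_one]
  le x hx := by
    have h1 := h.le _ (smul_mem_halfBall hr hx)
    have hra : 0 < r ^ (β + σ) := Real.rpow_pos_of_pos hr _
    rw [div_le_iff₀ hra]
    refine h1.trans (le_of_eq ?_)
    rw [PiLp.smul_apply, smul_eq_mul, Real.mul_rpow hr.le hx.1.le, norm_smul, Real.norm_eq_abs,
      abs_of_pos hr, Real.mul_rpow hr.le (norm_nonneg _), Real.rpow_add hr]
    ring
  eqn ζ hζ hc hs := by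
    have hra : 0 < r ^ (β + σ) := Real.rpow_pos_of_pos hr _
    set ξ : Rn n → ℝ := fun y => ζ (r⁻¹ • y) with hξ
    have hξc : ContDiff ℝ 1 ξ := hζ.comp (contDiff_const_smul r⁻¹)
    have hξs : HasCompactSupport ξ := hc.comp_smul (inv_ne_zero hr.ne')
    have hts : tsupport ξ ⊆ (fun y => r⁻¹ • y) ⁻¹' tsupport ζ :=
      tsupport_comp_subset_preimage ζ (continuous_const_smul r⁻¹)
    have hsub : tsupport ξ ⊆ {x ∈ halfBall n ρ | 0 < f x} := by
      intro y hy
      have h1 := hs (hts hy)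
      have h2 := smul_mem_halfBall hr h1.1
      have h3 := (div_pos_iff_of_pos_right hra).1 h1.2
      simp only [smul_smul, mul_inv_cancel₀ hr.ne', one_smul] at h2 h3
      exact ⟨h2, h3⟩
    have hd : ∀ y, fderiv ℝ ξ y = r⁻¹ • fderiv ℝ ζ (r⁻¹ • y) := by
      intro y
      have h2 : HasFDerivAt (fun x : Rn n => r⁻¹ • x) (r⁻¹ • ContinuousLinearMap.id ℝ (Rn n)) y :=
        (hasFDerivAt_id y).const_smul r⁻¹
      have h3 := ((hζ.differentiable one_ne_zero (r⁻¹ • y)).hasFDerivAt.comp y h2).fderiv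
      rw [show ξ = ζ ∘ fun x => r⁻¹ • x from rfl, h3]
      ext v; simp
    have h0 := h.eqn ξ hξc hξs hsub
    have h1 : ∀ x ∈ halfBall n (ρ / r),
        wt σ x * fderiv ℝ ζ x (r ^ (1 - (β + σ)) • P (r • x)) =
          (r ^ (1 - 2 * σ))⁻¹ * r ^ (1 - (β + σ)) * r *
            (fun y => wt σ y * fderiv ℝ ξ y (P y)) (r • x) := by
      intro x hx
      have hrs : 0 < r ^ (1 - 2 * σ) := Real.rpow_pos_of_pos hr _
      simp only [hd, wt_smul σ hr hx.1, smul_smul, inv_mul_cancel₀ hr.ne', one_smul, map_smul,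
        smul_apply, smul_eq_mul]
      field_simp
    rw [setIntegral_congr_fun (isOpen_halfBall _).measurableSet h1, integral_const_mul,
      integral_halfBall_comp_smul hr (fun y => wt σ y * fderiv ℝ ξ y (P y)), h0]
    simp

end IsPhase

/-! ### One-dimensional calculus and radial test functions. -/

/-- Integration by parts in which the primitive of e is only absolutely continuous, as e is an
arbitrary integrable function (later an integral over spheres). -/
lemma integral_primitive_mul {g g' e : ℝ → ℝ} {a b : ℝ} (ha : 0 ≤ a) (hab : a ≤ b)
    (hg : ∀ t ∈ Set.Icc a b, HasDerivAt g (g' t) t) (hgc : ContDiffOn ℝ 1 g (Set.Icc a b))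
    (he : IntegrableOn e (Set.Ioo 0 b)) :
    ∫ t in a..b, (g' t * (∫ s in (0 : ℝ)..t, e s) + g t * e t) =
      g b * (∫ s in (0 : ℝ)..b, e s) - g a * ∫ s in (0 : ℝ)..a, e s := by
  have hb : 0 ≤ b := ha.trans hab
  have he' : IntervalIntegrable e volume 0 b :=
    (intervalIntegrable_iff_integrableOn_Ioo_of_le hb).2 he
  have hE : AbsolutelyContinuousOnInterval (fun t => ∫ s in (0 : ℝ)..t, e s) a b :=
    (he'.absolutelyContinuousOnInterval_intervalIntegral Set.left_mem_uIcc).mono (by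
      rw [Set.uIcc_of_le hab, Set.uIcc_of_le hb]; exact Set.Icc_subset_Icc_left ha)
  have hG : AbsolutelyContinuousOnInterval g a b := by
    refine ContDiffOn.absolutelyContinuousOnInterval ?_
    rwa [Set.uIcc_of_le hab]
  rw [← hG.integral_deriv_mul_eq_sub hE]
  refine intervalIntegral.integral_congr_ae ?_
  filter_upwards [he'.ae_hasDerivAt_integral] with t ht htab
  rw [Set.uIoc_of_le hab] at htab
  have h1 : t ∈ Set.uIcc 0 b := by
    rw [Set.uIcc_of_le hb]; exact ⟨ha.trans htab.1.le, htab.2⟩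
  rw [(hg t ⟨htab.1.le, htab.2⟩).deriv, (ht h1 0 Set.left_mem_uIcc).deriv]

lemma exists_bounds_tsupport {ψ : ℝ → ℝ} {ρ : ℝ} (hρ : 0 < ρ) (hc : HasCompactSupport ψ)
    (hs : tsupport ψ ⊆ Set.Ioo 0 ρ) :
    ∃ δ R, 0 < δ ∧ R < ρ ∧ ∀ t, t ∉ Set.Ioo δ R → ψ t = 0 := by
  rcases (tsupport ψ).eq_empty_or_nonempty with h | h
  · refine ⟨1, ρ - 1, one_pos, by linarith, fun t _ => image_eq_zero_of_notMem_tsupport (by simp [h])⟩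
  · obtain ⟨a, ha, ha'⟩ := hc.isCompact.exists_isLeast h
    obtain ⟨b, hb, hb'⟩ := hc.isCompact.exists_isGreatest h
    have h1 := hs ha
    have h2 := hs hb
    refine ⟨a / 2, (b + ρ) / 2, by linarith [h1.1], by linarith [h2.2], fun t ht => ?_⟩
    refine image_eq_zero_of_notMem_tsupport fun hmem => ht ⟨?_, ?_⟩
    · linarith [ha' hmem, h1.1]
    · linarith [hb' hmem, h2.2]

/-- A du Bois-Reymond lemma. The test functions Ψ(t) = ∫_ρ^t ψ vanish at ρ but need not vanish near
0, which removes the additive constant: the boundary term at ρ is zero by Ψ(ρ) = 0, and the one at 0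
because the primitive of A starts there. -/
lemma ae_eq_primitive_of_integral {A B : ℝ → ℝ} {ρ : ℝ} (hρ : 0 < ρ)
    (hA : IntegrableOn A (Set.Ioo 0 ρ)) (hB : LocallyIntegrableOn B (Set.Ioo 0 ρ))
    (h : ∀ ψ : ℝ → ℝ, ContDiff ℝ ∞ ψ → HasCompactSupport ψ → tsupport ψ ⊆ Set.Ioo 0 ρ →
      ∫ t in Set.Ioo 0 ρ, (∫ s in ρ..t, ψ s) * A t = -∫ t in Set.Ioo 0 ρ, ψ t * B t) :
    ∀ᵐ t ∂(volume.restrict (Set.Ioo 0 ρ)), B t = ∫ s in (0 : ℝ)..t, A s := by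
  have hA' : IntervalIntegrable A volume 0 ρ :=
    (intervalIntegrable_iff_integrableOn_Ioo_of_le hρ.le).2 hA
  have hEc : ContinuousOn (fun t => ∫ s in (0 : ℝ)..t, A s) (Set.Ioo 0 ρ) := by
    have := intervalIntegral.continuousOn_primitive_interval' hA' Set.left_mem_uIcc
    rw [Set.uIcc_of_le hρ.le] at this
    exact this.mono Set.Ioo_subset_Icc_self
  have hE : LocallyIntegrableOn (fun t => ∫ s in (0 : ℝ)..t, A s) (Set.Ioo 0 ρ) :=
    hEc.locallyIntegrableOn measurableSet_Ioo
  have key := isOpen_Ioo.ae_eq_zero_of_integral_contDiff_smul_eq_zero (hB.sub hE)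
    fun ψ hψ hc hs => by
      have hz : ∀ t, t ∉ Set.Ioo 0 ρ → ψ t = 0 := fun t ht =>
        image_eq_zero_of_notMem_tsupport fun h => ht (hs h)
      have hi : ∀ {F : ℝ → ℝ}, LocallyIntegrableOn F (Set.Ioo 0 ρ) →
          IntegrableOn (fun t => ψ t * F t) (Set.Ioo 0 ρ) := by
        intro F hF
        have h1 : IntegrableOn (fun t => ψ t * F t) (tsupport ψ) :=
          (hF.integrableOn_compact_subset hs hc.isCompact).continuousOn_smul
            hψ.continuous.continuousOn hc.isCompact
        exact ((integrableOn_iff_integrable_of_support_subset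
          ((Function.support_mul_subset_left ψ F).trans (subset_tsupport ψ))).1 h1).integrableOn
      have h1 := h ψ hψ hc hs
      have hΨ : ∀ t, HasDerivAt (fun t => ∫ s in ρ..t, ψ s) (ψ t) t := fun t =>
        (hψ.continuous).integral_hasStrictDerivAt ρ t |>.hasDerivAt
      have hΨc : ContDiff ℝ 1 fun t => ∫ s in ρ..t, ψ s := by
        refine contDiff_one_iff_deriv.2 ⟨fun t => (hΨ t).differentiableAt, ?_⟩
        rw [show deriv (fun t => ∫ s in ρ..t, ψ s) = ψ from funext fun t => (hΨ t).deriv]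
        exact hψ.continuous
      have h2 := integral_primitive_mul (g := fun t => ∫ s in ρ..t, ψ s) (g' := ψ) (e := A)
        le_rfl hρ.le (fun t _ => hΨ t) hΨc.contDiffOn hA
      simp only [intervalIntegral.integral_same, zero_mul, mul_zero, sub_zero] at h2
      rw [intervalIntegral.integral_of_le hρ.le, integral_Ioc_eq_integral_Ioo, integral_add (hi hE)] at h2
      · rw [← setIntegral_eq_integral_of_forall_compl_eq_zero (s := Set.Ioo 0 ρ)
          (fun t ht => by simp [hz t ht])]
        simp only [smul_eq_mul, Pi.sub_apply, mul_sub]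
        rw [integral_sub (hi hB) (hi hE)]
        linarith
      · exact ((hA'.continuousOn_mul hΨc.continuous.continuousOn).1).mono_set Set.Ioo_subset_Ioc_self
  rw [ae_restrict_iff' measurableSet_Ioo]
  filter_upwards [key] with t ht htm
  exact sub_eq_zero.1 (ht htm)

/-- Radial test functions. -/
lemma exists_radial_test {ψ : ℝ → ℝ} {ρ : ℝ} (hρ : 0 < ρ) (hψ : ContDiff ℝ ∞ ψ)
    (hc : HasCompactSupport ψ) (hs : tsupport ψ ⊆ Set.Ioo 0 ρ) :
    ContDiff ℝ 1 (fun x : Rn n => ∫ s in ρ..‖x‖, ψ s) ∧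
    (∃ R < ρ, ∀ x : Rn n, R ≤ ‖x‖ → ∫ s in ρ..‖x‖, ψ s = 0) ∧
    ∀ x v : Rn n, fderiv ℝ (fun x : Rn n => ∫ s in ρ..‖x‖, ψ s) x v =
      ψ ‖x‖ * (‖x‖⁻¹ * inner ℝ x v) := by
  obtain ⟨δ, R, hδ, hR, hz⟩ := exists_bounds_tsupport hρ hc hs
  have hΨ : ∀ t, HasDerivAt (fun t => ∫ s in ρ..t, ψ s) (ψ t) t := fun t =>
    (hψ.continuous).integral_hasStrictDerivAt ρ t |>.hasDerivAt
  have hΨc : ContDiff ℝ 1 fun t => ∫ s in ρ..t, ψ s := by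
    refine contDiff_one_iff_deriv.2 ⟨fun t => (hΨ t).differentiableAt, ?_⟩
    rw [show deriv (fun t => ∫ s in ρ..t, ψ s) = ψ from funext fun t => (hΨ t).deriv]
    exact hψ.continuous
  -- The radial function is constant near the origin, so the singularity of |x| there does no harm.
  have hnear : ∀ x : Rn n, ‖x‖ < δ → (fun x : Rn n => ∫ s in ρ..‖x‖, ψ s) =ᶠ[𝓝 x]
      fun _ => ∫ s in ρ..δ, ψ s := by
    intro x hx
    filter_upwards [(isOpen_lt continuous_norm continuous_const).mem_nhds hx] with y hy
    have hy' : ‖y‖ < δ := hy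
    have h1 := intervalIntegral.integral_add_adjacent_intervals (μ := volume)
      (hψ.continuous.intervalIntegrable ρ ‖y‖) (hψ.continuous.intervalIntegrable ‖y‖ δ)
    have h2 : ∫ s in ‖y‖..δ, ψ s = 0 := by
      refine intervalIntegral.integral_zero_ae (ae_of_all _ fun s hs => hz s fun h => ?_)
      rw [Set.uIoc_of_le hy'.le] at hs
      exact absurd hs.2 (not_le.2 h.1)
    rw [← h1, h2, add_zero]
  have hfar : ∀ x : Rn n, x ≠ 0 → HasFDerivAt (fun x : Rn n => ∫ s in ρ..‖x‖, ψ s)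
      (ψ ‖x‖ • (‖x‖⁻¹ • innerSL ℝ x)) x := by
    intro x hx
    have h1 : HasFDerivAt (fun x : Rn n => ‖x‖) (‖x‖⁻¹ • innerSL ℝ x) x := by
      have h2 : DifferentiableAt ℝ (fun x : Rn n => ‖x‖) x :=
        (contDiffAt_norm ℝ hx (n := 1)).differentiableAt one_ne_zero
      have h3 := h2.hasFDerivAt.pow 2
      have h4 := (hasStrictFDerivAt_norm_sq x).hasFDerivAt.unique h3
      refine h2.hasFDerivAt.congr_fderiv ?_
      ext v
      have h5 := congrArg (fun L => L v) h4
      have hx' := norm_ne_zero_iff.2 hx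
      simp at h5 ⊢
      field_simp
      linarith
    exact (hΨ ‖x‖).comp_hasFDerivAt x h1
  refine ⟨contDiff_iff_contDiffAt.2 fun x => ?_, ⟨R, hR, fun x hx => ?_⟩, fun x v => ?_⟩
  · by_cases hx : ‖x‖ < δ
    · exact contDiffAt_const.congr_of_eventuallyEq (hnear x hx)
    · have hx0 : x ≠ 0 := norm_pos_iff.1 (hδ.trans_le (not_lt.1 hx))
      exact hΨc.contDiffAt.comp x (contDiffAt_norm ℝ hx0)
  · refine intervalIntegral.integral_zero_ae (ae_of_all _ fun s hs => hz s fun h => ?_)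
    rcases le_total ρ ‖x‖ with h1 | h1
    · rw [Set.uIoc_of_le h1] at hs
      linarith [hs.1, h.2]
    · rw [Set.uIoc_of_ge h1] at hs
      linarith [hs.1, h.2]
  · by_cases hx : ‖x‖ < δ
    · rw [(hnear x hx).fderiv_eq, hz ‖x‖ fun h => absurd hx (not_lt.2 h.1.le)]
      simp
    · have hx0 : x ≠ 0 := norm_pos_iff.1 (hδ.trans_le (not_lt.1 hx))
      rw [(hfar x hx0).fderiv]
      simp

/-! ### Green's formula on spheres, and derivatives along rays. -/

/-- `x₁^(1-2σ) |P|²`. -/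
def gradDensity (σ : ℝ) (P : Rn n → Rn n) (x : Rn n) : ℝ := wt σ x * ‖P x‖ ^ 2

/-- `x₁^(1-2σ) f (x · P)`. -/
def mixedDensity (σ : ℝ) (f : Rn n → ℝ) (P : Rn n → Rn n) (x : Rn n) : ℝ :=
  wt σ x * (f x * inner ℝ (P x) x)

/-- `x₁^(1-2σ) (x · P)²`. -/
def radialDensity (σ : ℝ) (P : Rn n → Rn n) (x : Rn n) : ℝ := wt σ x * inner ℝ (P x) x ^ 2

/-- `x₁^(1-2σ) f²`. -/
def sqDensity (σ : ℝ) (f : Rn n → ℝ) (x : Rn n) : ℝ := wt σ x * f x ^ 2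

/-- The defect `x · P - a f` in Euler's identity for homogeneous functions of degree `a`. -/
def euler (a : ℝ) (f : Rn n → ℝ) (P : Rn n → Rn n) (x : Rn n) : ℝ := inner ℝ (P x) x - a * f x

namespace IsPhase

variable {σ β C ρ : ℝ} {f : Rn n → ℝ} {P : Rn n → Rn n}

lemma aestronglyMeasurable_inner_self (h : IsPhase σ β C ρ f P) :
    AEStronglyMeasurable (fun x => inner ℝ (P x) x) (volume.restrict (halfBall n ρ)) :=
  (h.aestronglyMeasurable_grad (isOpen_halfBall ρ)).inner continuous_id.aestronglyMeasurable

lemma integrableOn_gradDensity (h : IsPhase σ β C ρ f P) (hβ : 0 < β) :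
    IntegrableOn (gradDensity σ P) (halfBall n ρ) := by
  have := h.integrableOn_inner h hβ (m := fun _ => 1) (A := 1) aestronglyMeasurable_const (by simp)
  simp only [one_mul, real_inner_self_eq_norm_sq] at this
  exact this

lemma integrableOn_mixedDensity (h : IsPhase σ β C ρ f P) (hβ : 0 < β) :
    IntegrableOn (mixedDensity σ f P) (halfBall n ρ) := by
  rcases le_or_gt ρ 0 with hρ | hρ
  · have : halfBall n ρ = ∅ := Set.eq_empty_of_forall_notMem fun x hx =>
      absurd (hx.2.trans_le hρ) (not_lt.2 (norm_nonneg x))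
    simp [this]
  have := h.integrableOn_mul_apply h hβ (m := f) (F := fun x => inner ℝ (P x) x) (A := ρ)
    (h.aestronglyMeasurable (isOpen_halfBall ρ)) h.aestronglyMeasurable_inner_self hρ.le
    (fun x hx => (abs_real_inner_le_norm _ _).trans (by
      rw [mul_comm]; exact mul_le_mul_of_nonneg_right hx.2.le (norm_nonneg _)))
    (fun x hx => (abs_of_nonneg (h.nonneg x hx)).le)
  refine this.congr_fun (fun x _ => ?_) (isOpen_halfBall ρ).measurableSet
  simp only [mixedDensity]; ring

lemma integrableOn_radialDensity (h : IsPhase σ β C ρ f P) (hβ : 0 < β) :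
    IntegrableOn (radialDensity σ P) (halfBall n ρ) := by
  refine ((h.integrableOn_gradDensity hβ).const_mul (ρ ^ 2)).mono'
    ((measurable_wt σ).aestronglyMeasurable.mul (h.aestronglyMeasurable_inner_self.pow 2)) ?_
  filter_upwards [ae_restrict_mem (isOpen_halfBall ρ).measurableSet] with x hx
  have hw := wt_pos (σ := σ) hx.1
  have h1 : inner ℝ (P x) x ^ 2 ≤ (‖P x‖ * ‖x‖) ^ 2 := by
    rw [← sq_abs]; exact pow_le_pow_left₀ (abs_nonneg _) (abs_real_inner_le_norm _ _) 2
  simp only [radialDensity, gradDensity]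
  rw [Real.norm_eq_abs, abs_of_nonneg (by positivity)]
  calc wt σ x * inner ℝ (P x) x ^ 2 ≤ wt σ x * (‖P x‖ * ‖x‖) ^ 2 := by gcongr
    _ = ‖x‖ ^ 2 * (wt σ x * ‖P x‖ ^ 2) := by ring
    _ ≤ ρ ^ 2 * (wt σ x * ‖P x‖ ^ 2) := by gcongr; exact hx.2.le

lemma integrableOn_sqDensity (h : IsPhase σ β C ρ f P) (hβ : 0 < β) :
    IntegrableOn (sqDensity σ f) (halfBall n ρ) := by
  refine integrableOn_of_le_rpow (a := 1) (K := C ^ 2 * ρ ^ (2 * β)) (by norm_num)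
    ((measurable_wt σ).aestronglyMeasurable.mul ((h.aestronglyMeasurable (isOpen_halfBall ρ)).pow 2))
    fun x hx => ?_
  have hw := wt_pos (σ := σ) hx.1
  have hx0 := hx.1
  simp only [sqDensity]
  rw [abs_of_nonneg (by positivity), Real.rpow_one]
  refine (h.wt_sq_le hx).trans ?_
  calc C ^ 2 * x 0 * ‖x‖ ^ (2 * β) ≤ C ^ 2 * x 0 * ρ ^ (2 * β) := by gcongr; exact hx.2.le
    _ = _ := by ring

lemma integral_gradDensity (h : IsPhase σ β C ρ f P) (hβ : 0 < β) {r : ℝ} (hr : 0 ≤ r)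
    (hrρ : r ≤ ρ) :
    ∫ x in halfBall n r, gradDensity σ P x = ∫ s in (0 : ℝ)..r, sphInt (gradDensity σ P) s := by
  rw [integral_halfBall_eq_sphInt ((h.integrableOn_gradDensity hβ).mono_set (halfBall_mono hrρ)),
    intervalIntegral.integral_of_le hr, integral_Ioc_eq_integral_Ioo]

/-- Green's formula on almost every half-sphere, with no contribution from the axis or from the free
boundary. It is the energy identity with η = Ψ(|x|), whose gradient is ψ(|x|) x/|x|, read through
`ae_eq_primitive_of_integral`. -/
lemma sphInt_mixedDensity (h : IsPhase σ β C ρ f P) (hβ : 0 < β) (hρ : 0 < ρ) :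
    ∀ᵐ s ∂(volume.restrict (Set.Ioo 0 ρ)), s⁻¹ * sphInt (mixedDensity σ f P) s =
      ∫ t in (0 : ℝ)..s, sphInt (gradDensity σ P) t := by
  have hD1 := h.integrableOn_gradDensity hβ
  have hD2 := h.integrableOn_mixedDensity hβ
  have hinv : ContinuousOn (fun s : ℝ => s⁻¹) (Set.Ioo 0 ρ) :=
    continuousOn_inv₀.mono fun s hs => hs.1.ne'
  refine ae_eq_primitive_of_integral hρ (integrableOn_sphInt hD1)
    ((integrableOn_sphInt hD2).locallyIntegrableOn.continuousOn_smul isOpen_Ioo.isLocallyClosed hinv) fun ψ hψ hc hs => ?_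
  obtain ⟨h1, ⟨R, hR, h2⟩, h3⟩ := exists_radial_test (n := n) hρ hψ hc hs
  have h4 := h.integral_energy_eq hβ h1 hR h2
  obtain ⟨A, hA0, hA, hA'⟩ := exists_bound_test h1 h2
  have i1 : IntegrableOn (fun x : Rn n => (∫ s in ρ..‖x‖, ψ s) * gradDensity σ P x) (halfBall n ρ) :=
    hD1.bdd_mul (c := A) h1.continuous.aestronglyMeasurable (ae_of_all _ hA)
  have i2 : IntegrableOn (fun x : Rn n => (ψ ‖x‖ * ‖x‖⁻¹) * mixedDensity σ f P x) (halfBall n ρ) := by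
    obtain ⟨δ, R', hδ, -, hz⟩ := exists_bounds_tsupport hρ hc hs
    obtain ⟨B, hB⟩ := hc.exists_bound_of_continuous hψ.continuous
    refine hD2.bdd_mul (c := B * δ⁻¹) ?_ (ae_of_all _ fun x => ?_)
    · exact ((hψ.continuous.comp continuous_norm).measurable.mul
        measurable_norm.inv).aestronglyMeasurable
    · have hB0 : 0 ≤ B := (norm_nonneg _).trans (hB 0)
      by_cases hx : ‖x‖ ∈ Set.Ioo δ R'
      · rw [norm_mul, norm_inv, norm_norm]
        gcongr
        · exact hB _
        · exact hx.1.le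
      · rw [hz _ hx, zero_mul, norm_zero]; positivity
  rw [← integral_halfBall_radial (fun t => ∫ s in ρ..t, ψ s) i1]
  have h5 := integral_halfBall_radial (fun t => ψ t * t⁻¹) i2
  have h6 : ∫ t in Set.Ioo 0 ρ, ψ t * (t⁻¹ • sphInt (mixedDensity σ f P) t) =
      ∫ t in Set.Ioo 0 ρ, (ψ t * t⁻¹) * sphInt (mixedDensity σ f P) t := by
    simp only [smul_eq_mul, mul_assoc]
  refine Eq.trans h4 ?_
  refine (congrArg Neg.neg ?_ : _ = -∫ t in Set.Ioo 0 ρ, ψ t * (t⁻¹ • sphInt (mixedDensity σ f P) t))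
  rw [h6, ← h5]
  refine setIntegral_congr_fun (isOpen_halfBall ρ).measurableSet fun x _ => ?_
  simp only [h3, mixedDensity, real_inner_comm (P x) x]
  ring

/-- The derivative of `s ↦ s^(-2a) f(s y)²`, `a = β + σ`, along a ray. -/
lemma hasDerivAt_ray (h : IsPhase σ β C ρ f P) {y : sphere (0 : Rn n) 1} (hy : y ∈ halfSphere n)
    {s : ℝ} (hs : s ∈ Set.Ioo 0 ρ) :
    HasDerivAt (fun s : ℝ => s ^ (-2 * (β + σ)) * f (s • (y : Rn n)) ^ 2)
      (2 * s ^ (-2 * (β + σ) - 1) * (f (s • (y : Rn n)) * euler (β + σ) f P (s • (y : Rn n)))) s := by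
  have hmem : s • (y : Rn n) ∈ halfBall n ρ := (smul_mem_halfBall_iff hs.1).2 ⟨hy, hs.2⟩
  have h1 := (h.hasGradientAt_sq (isOpen_halfBall ρ) h.locally_bounded hmem).hasFDerivAt
  have h2 : HasDerivAt (fun s : ℝ => s • (y : Rn n)) (y : Rn n) s := by
    simpa using (hasDerivAt_id s).smul_const (y : Rn n)
  have h3 := h1.comp_hasDerivAt s h2
  have h4 : HasDerivAt (fun s : ℝ => s ^ (-2 * (β + σ))) (-2 * (β + σ) * s ^ (-2 * (β + σ) - 1)) s :=
    Real.hasDerivAt_rpow_const (Or.inl hs.1.ne')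
  refine (h4.mul h3).congr_deriv ?_
  have h5 : s ^ (-2 * (β + σ)) = s ^ (-2 * (β + σ) - 1) * s := by
    rw [← Real.rpow_add_one hs.1.ne']; congr 1; ring
  simp only [InnerProductSpace.toDual_apply_apply, euler, inner_smul_left, inner_smul_right,
    RCLike.conj_to_real, Function.comp_apply]
  rw [h5]; ring

/-- The product f · (x·P - af) equals (fP)·x - af², and fP is continuous even where P is not. -/
lemma continuousOn_ray (h : IsPhase σ β C ρ f P) {y : sphere (0 : Rn n) 1} (hy : y ∈ halfSphere n) :
    ContinuousOn (fun s : ℝ => 2 * s ^ (-2 * (β + σ) - 1) *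
      (f (s • (y : Rn n)) * euler (β + σ) f P (s • (y : Rn n)))) (Set.Ioo 0 ρ) := by
  have hm : Set.MapsTo (fun s : ℝ => s • (y : Rn n)) (Set.Ioo 0 ρ) (halfBall n ρ) := fun s hs =>
    (smul_mem_halfBall_iff hs.1).2 ⟨hy, hs.2⟩
  have hc : ContinuousOn (fun s : ℝ => s • (y : Rn n)) (Set.Ioo 0 ρ) := by fun_prop
  have h1 : ContinuousOn (fun x => f x * euler (β + σ) f P x) (halfBall n ρ) := by
    have h2 : ∀ x, f x * euler (β + σ) f P x =
        inner ℝ (f x • P x) x - (β + σ) * f x ^ 2 := by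
      intro x; simp only [euler, inner_smul_left, RCLike.conj_to_real]; ring
    simp_rw [h2]
    exact ((h.continuousOn_smul_grad (isOpen_halfBall ρ) h.locally_bounded).inner
      continuousOn_id).sub (continuousOn_const.mul (h.cont.pow 2))
  refine (continuousOn_const.mul ?_).mul (h1.comp hc hm)
  exact continuousOn_id.rpow_const fun s hs => Or.inl hs.1.ne'

/-- Since f² is C¹, the fundamental theorem of calculus holds on every ray, however often the ray
meets the free boundary. -/
lemma ray_sub (h : IsPhase σ β C ρ f P) {y : sphere (0 : Rn n) 1} (hy : y ∈ halfSphere n)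
    {a b : ℝ} (ha : 0 < a) (hab : a ≤ b) (hb : b < ρ) :
    b ^ (-2 * (β + σ)) * f (b • (y : Rn n)) ^ 2 - a ^ (-2 * (β + σ)) * f (a • (y : Rn n)) ^ 2 =
      ∫ s in Set.Ioo a b, 2 * s ^ (-2 * (β + σ) - 1) *
        (f (s • (y : Rn n)) * euler (β + σ) f P (s • (y : Rn n))) := by
  have hsub : Set.Icc a b ⊆ Set.Ioo 0 ρ := fun s hs => ⟨ha.trans_le hs.1, hs.2.trans_lt hb⟩
  rw [← integral_Ioc_eq_integral_Ioo, ← intervalIntegral.integral_of_le hab]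
  symm
  refine intervalIntegral.integral_eq_sub_of_hasDerivAt (f := fun s : ℝ => s ^ (-2 * (β + σ)) * f (s • (y : Rn n)) ^ 2) (fun s hs => ?_) ?_
  · rw [Set.uIcc_of_le hab] at hs
    exact h.hasDerivAt_ray hy (hsub hs)
  · refine ContinuousOn.intervalIntegrable ?_
    rw [Set.uIcc_of_le hab]
    exact (h.continuousOn_ray hy).mono hsub

end IsPhase

/-- `x₁^(1-2σ) f (x · P - a f)`. -/
def crossDensity (σ a : ℝ) (f : Rn n → ℝ) (P : Rn n → Rn n) (x : Rn n) : ℝ :=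
  wt σ x * (f x * euler a f P x)

/-- `x₁^(1-2σ) (x · P - a f)²`. -/
def eulerDensity (σ a : ℝ) (f : Rn n → ℝ) (P : Rn n → Rn n) (x : Rn n) : ℝ :=
  wt σ x * euler a f P x ^ 2

/-- `r^(-2a) ∫_{∂B₁⁺} y₁^(1-2σ) f(r y)² dS`. -/
def sphereMean (σ a : ℝ) (f : Rn n → ℝ) (r : ℝ) : ℝ :=
  r ^ (-2 * a) * ∫ y, wt σ (y : Rn n) * f (r • (y : Rn n)) ^ 2 ∂sphereMeasure n

lemma ae_mem_halfSphere : ∀ᵐ y ∂sphereMeasure n, y ∈ halfSphere n :=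
  ae_restrict_mem isOpen_halfSphere.measurableSet

lemma sphInt_nonneg {F : Rn n → ℝ} {s R : ℝ} (hs : s ∈ Set.Ioo 0 R)
    (hF : ∀ x ∈ halfBall n R, 0 ≤ F x) : 0 ≤ sphInt F s := by
  refine mul_nonneg (pow_nonneg hs.1.le _) (integral_nonneg_of_ae ?_)
  filter_upwards [ae_mem_halfSphere] with y hy
  exact hF _ ((smul_mem_halfBall_iff hs.1).2 ⟨hy, hs.2⟩)

/-- Bookkeeping of exponents: the degree contributes s^(-2β-2σ), the weight s^(1-2σ) and the surface
measure s^(n-1), so both phases carry the same power s^(-2β-n). -/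
lemma rpow_neg_mul_pow (hn : 1 ≤ n) {s : ℝ} (hs : 0 < s) (a σ β : ℝ) (ha : a = β + σ) (c : ℝ) :
    s ^ (-2 * a + c) = s ^ (-2 * β - n + c) * (s ^ (n - 1) * s ^ (1 - 2 * σ)) := by
  rw [← Real.rpow_natCast, ← Real.rpow_add hs, ← Real.rpow_add hs, Nat.cast_sub hn, ha]
  congr 1; push_cast; ring

namespace IsPhase

variable {σ β C ρ : ℝ} {f : Rn n → ℝ} {P : Rn n → Rn n}

lemma integrableOn_crossDensity (h : IsPhase σ β C ρ f P) (hβ : 0 < β) (a : ℝ) :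
    IntegrableOn (crossDensity σ a f P) (halfBall n ρ) := by
  refine ((h.integrableOn_mixedDensity hβ).sub ((h.integrableOn_sqDensity hβ).const_mul a)).congr
    (ae_of_all _ fun x => ?_)
  simp only [mixedDensity, sqDensity, crossDensity, euler, Pi.sub_apply]; ring

lemma integrableOn_eulerDensity (h : IsPhase σ β C ρ f P) (hβ : 0 < β) (a : ℝ) :
    IntegrableOn (eulerDensity σ a f P) (halfBall n ρ) := by
  refine (((h.integrableOn_radialDensity hβ).sub ((h.integrableOn_mixedDensity hβ).const_mul
    (2 * a))).add ((h.integrableOn_sqDensity hβ).const_mul (a ^ 2))).congr (ae_of_all _ fun x => ?_)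
  simp only [mixedDensity, sqDensity, eulerDensity, radialDensity, euler, Pi.sub_apply, Pi.add_apply]
  ring

lemma sphInt_crossDensity (h : IsPhase σ β C ρ f P) (hβ : 0 < β) (a : ℝ) :
    ∀ᵐ s ∂(volume.restrict (Set.Ioo 0 ρ)), sphInt (crossDensity σ a f P) s =
      sphInt (mixedDensity σ f P) s - a * sphInt (sqDensity σ f) s := by
  filter_upwards [ae_integrable_sphere (h.integrableOn_mixedDensity hβ),
    ae_integrable_sphere (h.integrableOn_sqDensity hβ)] with s h1 h2
  have h3 : ∀ y : sphere (0 : Rn n) 1, crossDensity σ a f P (s • (y : Rn n)) =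
      mixedDensity σ f P (s • (y : Rn n)) - a * sqDensity σ f (s • (y : Rn n)) := by
    intro y; simp only [mixedDensity, sqDensity, crossDensity, euler]; ring
  simp only [sphInt, h3]
  rw [integral_sub h1 (h2.const_mul a), integral_const_mul]
  ring

/-- The expansion of the square (x·P - af)². This is the combination that the derivative of M is
made of. -/
lemma sphInt_eulerDensity (h : IsPhase σ β C ρ f P) (hβ : 0 < β) (a : ℝ) :
    ∀ᵐ s ∂(volume.restrict (Set.Ioo 0 ρ)), sphInt (eulerDensity σ a f P) s =
      sphInt (radialDensity σ P) s - 2 * a * sphInt (mixedDensity σ f P) s +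
        a ^ 2 * sphInt (sqDensity σ f) s := by
  filter_upwards [ae_integrable_sphere (h.integrableOn_mixedDensity hβ),
    ae_integrable_sphere (h.integrableOn_sqDensity hβ),
    ae_integrable_sphere (h.integrableOn_radialDensity hβ)] with s h1 h2 h0
  have h3 : ∀ y : sphere (0 : Rn n) 1, eulerDensity σ a f P (s • (y : Rn n)) =
      radialDensity σ P (s • (y : Rn n)) - 2 * a * mixedDensity σ f P (s • (y : Rn n)) +
        a ^ 2 * sqDensity σ f (s • (y : Rn n)) := by
    intro y; simp only [mixedDensity, sqDensity, eulerDensity, radialDensity, euler]; ring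
  simp only [sphInt, h3]
  have h4 : Integrable (fun y : sphere (0 : Rn n) 1 => radialDensity σ P (s • (y : Rn n)) -
      2 * a * mixedDensity σ f P (s • (y : Rn n))) (sphereMeasure n) := h0.sub (h1.const_mul _)
  rw [integral_add h4 (h2.const_mul _), integral_sub h0 (h1.const_mul _),
    integral_const_mul, integral_const_mul]
  ring

/-- Young's inequality with a free parameter instead of Cauchy–Schwarz: in the applications t is
fixed small first, and the defect term is dealt with afterwards. -/
lemma sphInt_abs_crossDensity_le (h : IsPhase σ β C ρ f P) (hβ : 0 < β) (a : ℝ) {t : ℝ} (ht : 0 < t) :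
    ∀ᵐ s ∂(volume.restrict (Set.Ioo 0 ρ)), sphInt (fun x => |crossDensity σ a f P x|) s ≤
      (t⁻¹ * sphInt (eulerDensity σ a f P) s + t * sphInt (sqDensity σ f) s) / 2 := by
  filter_upwards [ae_integrable_sphere (h.integrableOn_crossDensity hβ a),
    ae_integrable_sphere (h.integrableOn_sqDensity hβ),
    ae_integrable_sphere (h.integrableOn_eulerDensity hβ a), ae_restrict_mem measurableSet_Ioo]
    with s h1 h2 h3 hs
  have hle : ∫ y, |crossDensity σ a f P (s • (y : Rn n))| ∂sphereMeasure n ≤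
      ∫ y, (t⁻¹ * eulerDensity σ a f P (s • (y : Rn n)) + t * sqDensity σ f (s • (y : Rn n))) / 2
        ∂sphereMeasure n := by
    refine integral_mono_ae h1.abs (((h3.const_mul _).add (h2.const_mul _)).div_const 2) ?_
    filter_upwards [ae_mem_halfSphere] with y hy
    have hx : s • (y : Rn n) ∈ halfBall n ρ := (smul_mem_halfBall_iff hs.1).2 ⟨hy, hs.2⟩
    have hw := wt_pos (σ := σ) hx.1
    set x := s • (y : Rn n)
    simp only [crossDensity, eulerDensity, sqDensity]
    rw [abs_mul, abs_of_pos hw, abs_mul]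
    have h5 : |f x| * |euler a f P x| ≤ (t⁻¹ * euler a f P x ^ 2 + t * f x ^ 2) / 2 := by
      have h6 : t⁻¹ * euler a f P x ^ 2 + t * f x ^ 2 - 2 * (|f x| * |euler a f P x|) =
          t⁻¹ * (|euler a f P x| - t * |f x|) ^ 2 := by
        rw [← sq_abs (euler a f P x), ← sq_abs (f x)]; field_simp; ring
      have h7 : 0 ≤ t⁻¹ * (|euler a f P x| - t * |f x|) ^ 2 := by positivity
      linarith
    calc wt σ x * (|f x| * |euler a f P x|) ≤ wt σ x * ((t⁻¹ * euler a f P x ^ 2 + t * f x ^ 2) / 2) := by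
          gcongr
      _ = _ := by ring
  simp only [sphInt]
  rw [integral_div, integral_add (h3.const_mul _) (h2.const_mul _), integral_const_mul,
    integral_const_mul] at hle
  calc _ ≤ s ^ (n - 1) * _ := mul_le_mul_of_nonneg_left hle (pow_nonneg hs.1.le _)
    _ = _ := by ring

lemma abs_sphInt_le {F : Rn n → ℝ} {s : ℝ} (hs : 0 ≤ s) : |sphInt F s| ≤ sphInt (fun x => |F x|) s := by
  simp only [sphInt]
  rw [abs_mul, abs_of_nonneg (pow_nonneg hs _)]
  exact mul_le_mul_of_nonneg_left abs_integral_le_integral_abs (pow_nonneg hs _)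

lemma wt_mul_sq_eq {s : ℝ} (hs : 0 < s) {y : sphere (0 : Rn n) 1} (hy : y ∈ halfSphere n) :
    wt σ (y : Rn n) * f (s • (y : Rn n)) ^ 2 =
      (s ^ (1 - 2 * σ))⁻¹ * sqDensity σ f (s • (y : Rn n)) := by
  have := (Real.rpow_pos_of_pos hs (1 - 2 * σ)).ne'
  rw [sqDensity, wt_smul σ hs hy]; field_simp

lemma integrable_sphere_sq (h : IsPhase σ β C ρ f P) {s : ℝ} (hs : s ∈ Set.Ioo 0 ρ) :
    Integrable (fun y : sphere (0 : Rn n) 1 => wt σ (y : Rn n) * f (s • (y : Rn n)) ^ 2)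
      (sphereMeasure n) := by
  have hm : Set.MapsTo (fun y : sphere (0 : Rn n) 1 => s • (y : Rn n)) (halfSphere n) (halfBall n ρ) :=
    fun y hy => (smul_mem_halfBall_iff hs.1).2 ⟨hy, hs.2⟩
  have hc : ContinuousOn (fun y : sphere (0 : Rn n) 1 => wt σ (y : Rn n) * f (s • (y : Rn n)) ^ 2)
      (halfSphere n) :=
    ((continuousOn_wt σ).comp continuous_subtype_val.continuousOn fun y hy => hy).mul
      ((h.cont.comp (by fun_prop) hm).pow 2)
  refine Integrable.mono' (integrable_const ((s ^ (1 - 2 * σ))⁻¹ * (C ^ 2 * s * s ^ (2 * β))))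
    (hc.aestronglyMeasurable isOpen_halfSphere.measurableSet) ?_
  filter_upwards [ae_mem_halfSphere] with y hy
  have hx := hm hy
  have hw := wt_pos (σ := σ) hy
  rw [Real.norm_eq_abs, abs_of_nonneg (by positivity), wt_mul_sq_eq hs.1 hy]
  have hp := Real.rpow_pos_of_pos hs.1 (1 - 2 * σ)
  have h1 := h.wt_sq_le hx
  have h2 := coord_le_norm (s • (y : Rn n)) 0
  rw [norm_smul_sphere y hs.1.le] at h1 h2
  have := Real.rpow_nonneg hs.1.le (2 * β)
  gcongr
  refine h1.trans ?_
  gcongr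

lemma sphereMean_eq (hn : 1 ≤ n) {s : ℝ} (hs : 0 < s) :
    sphereMean (n := n) σ (β + σ) f s = s ^ (-2 * β - n) * sphInt (sqDensity σ f) s := by
  have h1 : ∫ y, wt σ (y : Rn n) * f (s • (y : Rn n)) ^ 2 ∂sphereMeasure n =
      (s ^ (1 - 2 * σ))⁻¹ * ∫ y, sqDensity σ f (s • (y : Rn n)) ∂sphereMeasure n := by
    rw [← integral_const_mul]
    refine integral_congr_ae ?_
    filter_upwards [ae_mem_halfSphere] with y hy
    exact wt_mul_sq_eq hs hy
  have h2 := rpow_neg_mul_pow hn hs (β + σ) σ β rfl 0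
  simp only [add_zero] at h2
  have := (Real.rpow_pos_of_pos hs (1 - 2 * σ)).ne'
  rw [sphereMean, h1, h2, sphInt]
  field_simp

/-- The normalised spherical means are bounded uniformly in the radius, because the weighted square
of f is at most C² x₁ |x|^(2β). -/
lemma sphereMean_le (h : IsPhase σ β C ρ f P) {s : ℝ} (hs : s ∈ Set.Ioo 0 ρ) :
    sphereMean σ (β + σ) f s ≤ C ^ 2 * (sphereMeasure n).real Set.univ := by
  have h1 : ∫ y, wt σ (y : Rn n) * f (s • (y : Rn n)) ^ 2 ∂sphereMeasure n ≤
      ∫ _ : sphere (0 : Rn n) 1, (s ^ (1 - 2 * σ))⁻¹ * (C ^ 2 * s * s ^ (2 * β)) ∂sphereMeasure n := by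
    refine integral_mono_ae (h.integrable_sphere_sq hs) (integrable_const _) ?_
    filter_upwards [ae_mem_halfSphere] with y hy
    have hx : s • (y : Rn n) ∈ halfBall n ρ := (smul_mem_halfBall_iff hs.1).2 ⟨hy, hs.2⟩
    have hp := Real.rpow_pos_of_pos hs.1 (1 - 2 * σ)
    have h1 := h.wt_sq_le hx
    have h2 := coord_le_norm (s • (y : Rn n)) 0
    rw [norm_smul_sphere y hs.1.le] at h1 h2
    have := Real.rpow_nonneg hs.1.le (2 * β)
    rw [wt_mul_sq_eq hs.1 hy]
    gcongr
    refine h1.trans ?_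
    gcongr
  rw [integral_const, smul_eq_mul] at h1
  have hp := Real.rpow_pos_of_pos hs.1 (-2 * (β + σ))
  rw [sphereMean]
  refine (mul_le_mul_of_nonneg_left h1 hp.le).trans (le_of_eq ?_)
  have h3 : s ^ (-2 * (β + σ)) * ((s ^ (1 - 2 * σ))⁻¹ * (s * s ^ (2 * β))) = 1 := by
    nth_rewrite 3 [← Real.rpow_one s]
    rw [← Real.rpow_neg hs.1.le, ← Real.rpow_add hs.1, ← Real.rpow_add hs.1, ← Real.rpow_add hs.1,
      ← Real.rpow_zero s]
    congr 1; ring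
  calc _ = C ^ 2 * (sphereMeasure n).real Set.univ *
        (s ^ (-2 * (β + σ)) * ((s ^ (1 - 2 * σ))⁻¹ * (s * s ^ (2 * β)))) := by ring
    _ = _ := by rw [h3, mul_one]

/-- The integrand in `ray_sub`, weighted and integrated over `∂B₁⁺ × (a, b)`. -/
lemma integrable_ray (h : IsPhase σ β C ρ f P) (hβ : 0 < β) (hn : 1 ≤ n) {a b : ℝ} (ha : 0 < a)
    (hb : b < ρ) :
    Integrable (fun p : sphere (0 : Rn n) 1 × ℝ => wt σ (p.1 : Rn n) * (2 * p.2 ^ (-2 * (β + σ) - 1) *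
      (f (p.2 • (p.1 : Rn n)) * euler (β + σ) f P (p.2 • (p.1 : Rn n)))))
      ((sphereMeasure n).prod (volume.restrict (Set.Ioo a b))) := by
  have h1 := integrable_polar (h.integrableOn_crossDensity hβ (β + σ))
  have h2 : Integrable (fun p : sphere (0 : Rn n) 1 × ℝ =>
      p.2 ^ (n - 1) * crossDensity σ (β + σ) f P (p.2 • (p.1 : Rn n)))
      ((sphereMeasure n).prod (volume.restrict (Set.Ioo a b))) := by
    have hsub : Set.Ioo a b ⊆ Set.Ioo 0 ρ := fun s hs => ⟨ha.trans hs.1, hs.2.trans hb⟩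
    rw [sphereMeasure, Measure.prod_restrict] at h1 ⊢
    exact h1.mono_measure (Measure.restrict_mono (Set.prod_mono le_rfl hsub) le_rfl)
  have h3 : ∀ᵐ p ∂((sphereMeasure n).prod (volume.restrict (Set.Ioo a b))),
      p ∈ halfSphere n ×ˢ Set.Ioo a b := by
    rw [sphereMeasure, Measure.prod_restrict]
    exact ae_restrict_mem (isOpen_halfSphere.measurableSet.prod measurableSet_Ioo)
  obtain ⟨B, hB⟩ : ∃ B, ∀ s ∈ Set.Icc a b, ‖2 * s ^ (-2 * β - n - 1)‖ ≤ B := by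
    refine isCompact_Icc.exists_bound_of_continuousOn (continuousOn_const.mul ?_)
    exact continuousOn_id.rpow_const fun s hs => Or.inl (ha.trans_le hs.1).ne'
  have h4 := h2.bdd_mul (c := B) (f := fun p : sphere (0 : Rn n) 1 × ℝ => 2 * p.2 ^ (-2 * β - n - 1))
    (by fun_prop : Measurable fun p : sphere (0 : Rn n) 1 × ℝ =>
      2 * p.2 ^ (-2 * β - n - 1)).aestronglyMeasurable
    (by filter_upwards [h3] with p hp using hB _ ⟨hp.2.1.le, hp.2.2.le⟩)
  refine h4.congr ?_
  filter_upwards [h3] with p hp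
  have hs : 0 < p.2 := ha.trans hp.2.1
  have h5 := rpow_neg_mul_pow hn hs (β + σ) σ β rfl (-1)
  simp only [← sub_eq_add_neg] at h5
  rw [crossDensity, wt_smul σ hs hp.1, h5]
  ring

/-- A positively homogeneous F covers both uses at once: the identity for `sphereMean_sub` and the
absolute value for `integral_abs_ray_sub_le`. -/
lemma integral_ray_eq_sphInt (hn : 1 ≤ n) {s : ℝ} (hs : 0 < s) (F : ℝ → ℝ)
    (hF : ∀ c t, 0 ≤ c → F (c * t) = c * F t) :
    ∫ y, F (wt σ (y : Rn n) * (2 * s ^ (-2 * (β + σ) - 1) *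
      (f (s • (y : Rn n)) * euler (β + σ) f P (s • (y : Rn n))))) ∂sphereMeasure n =
      2 * s ^ (-2 * β - n - 1) * sphInt (fun x => F (crossDensity σ (β + σ) f P x)) s := by
  rw [sphInt, ← mul_assoc, ← integral_const_mul]
  refine integral_congr_ae ?_
  filter_upwards [ae_mem_halfSphere] with y hy
  have h5 := rpow_neg_mul_pow hn hs (β + σ) σ β rfl (-1)
  simp only [← sub_eq_add_neg] at h5
  rw [← hF _ _ (by positivity), crossDensity, wt_smul σ hs hy, h5]
  congr 1; ring

/-- `ray_sub` integrated over the half-sphere, with the order of integration exchanged. It yields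
the derivative of the spherical mean without differentiating under the integral sign. -/
lemma sphereMean_sub (h : IsPhase σ β C ρ f P) (hβ : 0 < β) (hn : 1 ≤ n) {a b : ℝ} (ha : 0 < a)
    (hab : a ≤ b) (hb : b < ρ) :
    sphereMean σ (β + σ) f b - sphereMean σ (β + σ) f a =
      ∫ s in Set.Ioo a b, 2 * s ^ (-2 * β - n - 1) * sphInt (crossDensity σ (β + σ) f P) s := by
  have hbρ : b ∈ Set.Ioo 0 ρ := ⟨ha.trans_le hab, hb⟩
  have haρ : a ∈ Set.Ioo 0 ρ := ⟨ha, hab.trans_lt hb⟩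
  have h1 := (h.integrable_sphere_sq hbρ).const_mul (b ^ (-2 * (β + σ)))
  have h2 := (h.integrable_sphere_sq haρ).const_mul (a ^ (-2 * (β + σ)))
  rw [sphereMean, sphereMean, ← integral_const_mul, ← integral_const_mul, ← integral_sub h1 h2]
  have h3 := integral_integral_swap (f := fun (y : sphere (0 : Rn n) 1) (s : ℝ) =>
    wt σ (y : Rn n) * (2 * s ^ (-2 * (β + σ) - 1) *
      (f (s • (y : Rn n)) * euler (β + σ) f P (s • (y : Rn n))))) (h.integrable_ray hβ hn ha hb)
  have h4 : ∫ s in Set.Ioo a b, 2 * s ^ (-2 * β - n - 1) * sphInt (crossDensity σ (β + σ) f P) s =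
      ∫ s in Set.Ioo a b, ∫ y, wt σ (y : Rn n) * (2 * s ^ (-2 * (β + σ) - 1) *
      (f (s • (y : Rn n)) * euler (β + σ) f P (s • (y : Rn n)))) ∂sphereMeasure n :=
    setIntegral_congr_fun measurableSet_Ioo fun s hs =>
      (integral_ray_eq_sphInt hn (ha.trans hs.1) id fun _ _ _ => rfl).symm
  rw [h4, ← h3]
  refine integral_congr_ae ?_
  filter_upwards [ae_mem_halfSphere] with y hy
  rw [integral_const_mul, ← h.ray_sub hy ha hab hb]
  ring

lemma integral_abs_ray_sub_le (h : IsPhase σ β C ρ f P) (hβ : 0 < β) (hn : 1 ≤ n) {a b : ℝ}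
    (ha : 0 < a) (hab : a ≤ b) (hb : b < ρ) :
    ∫ y, wt σ (y : Rn n) * |b ^ (-2 * (β + σ)) * f (b • (y : Rn n)) ^ 2 -
        a ^ (-2 * (β + σ)) * f (a • (y : Rn n)) ^ 2| ∂sphereMeasure n ≤
      ∫ s in Set.Ioo a b, 2 * s ^ (-2 * β - n - 1) *
        sphInt (fun x => |crossDensity σ (β + σ) f P x|) s := by
  have hint := h.integrable_ray hβ hn ha hb
  have h3 := integral_integral_swap (f := fun (y : sphere (0 : Rn n) 1) (s : ℝ) =>
    |wt σ (y : Rn n) * (2 * s ^ (-2 * (β + σ) - 1) *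
      (f (s • (y : Rn n)) * euler (β + σ) f P (s • (y : Rn n))))|) hint.abs
  have h4 : ∫ s in Set.Ioo a b, 2 * s ^ (-2 * β - n - 1) *
        sphInt (fun x => |crossDensity σ (β + σ) f P x|) s =
      ∫ s in Set.Ioo a b, ∫ y, |wt σ (y : Rn n) * (2 * s ^ (-2 * (β + σ) - 1) *
      (f (s • (y : Rn n)) * euler (β + σ) f P (s • (y : Rn n))))| ∂sphereMeasure n :=
    setIntegral_congr_fun measurableSet_Ioo fun s hs =>
      (integral_ray_eq_sphInt hn (ha.trans hs.1) abs fun c t hc => by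
        rw [abs_mul, abs_of_nonneg hc]).symm
  rw [h4]
  refine le_trans (le_trans (integral_mono_of_nonneg ?_ hint.abs.integral_prod_left ?_) h3.le) le_rfl
  · filter_upwards [ae_mem_halfSphere] with y hy
    have hw := wt_pos (σ := σ) hy
    positivity
  · filter_upwards [ae_mem_halfSphere] with y hy
    have hw := wt_pos (σ := σ) hy
    rw [h.ray_sub hy ha hab hb, ← abs_of_pos hw, ← abs_mul, ← integral_const_mul, abs_of_pos hw]
    exact abs_integral_le_integral_abs

end IsPhase

/-! ### The monotonicity formula and the vanishing of its limit. -/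

/-- A pair of phases in `B_ρ⁺` whose sum of energies is stationary with respect to variations of the
domain. -/
structure IsTwoPhase (β C ρ : ℝ) (f : Rn n → ℝ) (P : Rn n → Rn n) (g : Rn n → ℝ)
    (Q : Rn n → Rn n) : Prop where
  pos : IsPhase 0 β C ρ f P
  neg : IsPhase 1 β C ρ g Q
  variation : ∀ φ : Rn n → Rn n, ContDiff ℝ 1 φ → (∃ R < ρ, ∀ x, R ≤ ‖x‖ → φ x = 0) →
    (∀ x, x 0 = 0 → φ x 0 = 0) → ∫ x in halfBall n ρ, firstVariationIntegrand P Q φ x = 0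

/-- For the field η x the divergence contributes n and the term with Dφ contributes -2, and φ₁ = η
x₁ contributes +1 for the weight x₁ and -1 for 1/x₁. This explains the coefficients n-1 and n-3. -/
lemma firstVariationIntegrand_radial (P Q : Rn n → Rn n) {η : Rn n → ℝ} (hη : ContDiff ℝ 1 η)
    {x : Rn n} (hx : 0 < x 0) {c : ℝ} (hd : ∀ v, fderiv ℝ η x v = c * (‖x‖⁻¹ * inner ℝ x v)) :
    firstVariationIntegrand P Q (fun y => η y • y) x =
      η x * ((n - 1) * gradDensity 0 P x + (n - 3) * gradDensity 1 Q x) +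
        c * (‖x‖ * (gradDensity 0 P x + gradDensity 1 Q x) -
          2 * ‖x‖⁻¹ * (radialDensity 0 P x + radialDensity 1 Q x)) := by
  have h1 : HasFDerivAt (fun y : Rn n => η y • y)
      (η x • ContinuousLinearMap.id ℝ (Rn n) + (fderiv ℝ η x).smulRight x) x :=
    (hη.differentiable one_ne_zero x).hasFDerivAt.smul (hasFDerivAt_id x)
  have h2 : ∀ v, fderiv ℝ (fun y : Rn n => η y • y) x v =
      η x • v + (c * (‖x‖⁻¹ * inner ℝ x v)) • x := by
    intro v; rw [h1.fderiv]; simp [hd]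
  have hx0 : ‖x‖ ≠ 0 := by
    rw [norm_ne_zero_iff]; rintro rfl; simp at hx
  have h3 : divergence (fun y : Rn n => η y • y) x = n * η x + c * ‖x‖ := by
    simp only [divergence, h2]
    have h4 : ∀ i : Fin n, (η x • EuclideanSpace.single i (1 : ℝ) +
        (c * (‖x‖⁻¹ * inner ℝ x (EuclideanSpace.single i (1 : ℝ)))) • x : Rn n) i =
        η x + c * ‖x‖⁻¹ * (x i) ^ 2 := by
      intro i; simp [EuclideanSpace.inner_single_right]; ring
    simp_rw [h4]
    rw [Finset.sum_add_distrib, ← Finset.mul_sum, ← EuclideanSpace.real_norm_sq_eq]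
    simp
    field_simp
  simp only [firstVariationIntegrand, h2, h3, gradDensity, radialDensity, wt_zero, wt_one,
    inner_add_right, inner_smul_right, real_inner_self_eq_norm_sq, PiLp.smul_apply, smul_eq_mul,
    real_inner_comm (P x) x, real_inner_comm (Q x) x]
  field_simp
  ring

/-- The monotone quantity. -/
def weissFun (β : ℝ) (f : Rn n → ℝ) (P : Rn n → Rn n) (g : Rn n → ℝ) (Q : Rn n → Rn n)
    (r : ℝ) : ℝ :=
  r ^ (-2 * β - n + 1) * ((∫ x in halfBall n r, gradDensity 0 P x) + ∫ x in halfBall n r, gradDensity 1 Q x)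
    - β * sphereMean 0 β f r - (β + 1) * sphereMean 1 (β + 1) g r

/-- The derivative of `weissFun`. -/
def weissDeriv (β : ℝ) (f : Rn n → ℝ) (P : Rn n → Rn n) (g : Rn n → ℝ) (Q : Rn n → Rn n)
    (s : ℝ) : ℝ :=
  2 * s ^ (-2 * β - n - 1) * (sphInt (eulerDensity 0 β f P) s + sphInt (eulerDensity 1 (β + 1) g Q) s)

namespace IsTwoPhase

variable {β C ρ : ℝ} {f g : Rn n → ℝ} {P Q : Rn n → Rn n}

/-- The Pohozaev identity on almost every sphere: stationarity along radial fields, read through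
`ae_eq_primitive_of_integral`. The two phases appear only in sum, as the variation couples them. -/
lemma radial_variation (h : IsTwoPhase β C ρ f P g Q) (hβ : 0 < β) (hρ : 0 < ρ) :
    ∀ᵐ s ∂(volume.restrict (Set.Ioo 0 ρ)),
      s * (sphInt (gradDensity 0 P) s + sphInt (gradDensity 1 Q) s) -
        2 * s⁻¹ * (sphInt (radialDensity 0 P) s + sphInt (radialDensity 1 Q) s) =
      (n - 1) * (∫ t in (0 : ℝ)..s, sphInt (gradDensity 0 P) t) +
        (n - 3) * ∫ t in (0 : ℝ)..s, sphInt (gradDensity 1 Q) t := by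
  have d1 := h.pos.integrableOn_gradDensity hβ
  have d2 := h.neg.integrableOn_gradDensity hβ
  have d3 := h.pos.integrableOn_radialDensity hβ
  have d4 := h.neg.integrableOn_radialDensity hβ
  have s1 := integrableOn_sphInt d1
  have s2 := integrableOn_sphInt d2
  have s3 := integrableOn_sphInt d3
  have s4 := integrableOn_sphInt d4
  have hinv : ContinuousOn (fun s : ℝ => 2 * s⁻¹) (Set.Ioo 0 ρ) :=
    continuousOn_const.mul (continuousOn_inv₀.mono fun s hs => hs.1.ne')
  have hA : IntegrableOn (fun s => ((n : ℝ) - 1) * sphInt (gradDensity 0 P) s +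
      ((n : ℝ) - 3) * sphInt (gradDensity 1 Q) s) (Set.Ioo 0 ρ) :=
    (s1.const_mul _).add (s2.const_mul _)
  have hB : LocallyIntegrableOn (fun s => s * (sphInt (gradDensity 0 P) s + sphInt (gradDensity 1 Q) s) -
        2 * s⁻¹ * (sphInt (radialDensity 0 P) s + sphInt (radialDensity 1 Q) s)) (Set.Ioo 0 ρ) :=
    ((s1.add s2).locallyIntegrableOn.continuousOn_smul isOpen_Ioo.isLocallyClosed
      continuousOn_id).sub ((s3.add s4).locallyIntegrableOn.continuousOn_smul
        isOpen_Ioo.isLocallyClosed hinv)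
  have key := ae_eq_primitive_of_integral hρ hA hB fun ψ hψ hc hs => by
    obtain ⟨h1, ⟨R, hR, h2⟩, h3⟩ := exists_radial_test (n := n) hρ hψ hc hs
    obtain ⟨A, hA0, hA, hA'⟩ := exists_bound_test h1 h2
    obtain ⟨δ, R', hδ, -, hz⟩ := exists_bounds_tsupport hρ hc hs
    obtain ⟨B, hB⟩ := hc.exists_bound_of_continuous hψ.continuous
    have hB0 : 0 ≤ B := (norm_nonneg _).trans (hB 0)
    -- The field Ψ(|x|) x is tangent to {x₁ = 0}, hence admissible.
    have hv := h.variation (fun x => (∫ s in ρ..‖x‖, ψ s) • x) (h1.smul contDiff_id)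
      ⟨R, hR, fun x hx => by rw [h2 x hx, zero_smul]⟩ (fun x hx => by simp [hx])
    rw [setIntegral_congr_fun (isOpen_halfBall ρ).measurableSet fun x hx =>
      firstVariationIntegrand_radial P Q h1 hx.1 (h3 x)] at hv
    set η : Rn n → ℝ := fun x => ∫ s in ρ..‖x‖, ψ s with hη
    have ig : ∀ {F : Rn n → ℝ}, IntegrableOn F (halfBall n ρ) →
        IntegrableOn (fun x => η x * F x) (halfBall n ρ) := fun hF =>
      hF.bdd_mul (c := A) h1.continuous.aestronglyMeasurable (ae_of_all _ hA)
    have ig1 : ∀ {F : Rn n → ℝ}, IntegrableOn F (halfBall n ρ) →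
        IntegrableOn (fun x => (ψ ‖x‖ * ‖x‖) * F x) (halfBall n ρ) := fun hF => by
      refine Integrable.bdd_mul (c := B * ρ) hF
        ((hψ.continuous.comp continuous_norm).mul continuous_norm).aestronglyMeasurable ?_
      filter_upwards [ae_restrict_mem (isOpen_halfBall ρ).measurableSet] with x hx
      rw [norm_mul, norm_norm]
      gcongr
      · exact hB _
      · exact hx.2.le
    have ig2 : ∀ {F : Rn n → ℝ}, IntegrableOn F (halfBall n ρ) →
        IntegrableOn (fun x => (ψ ‖x‖ * (2 * ‖x‖⁻¹)) * F x) (halfBall n ρ) := fun hF => by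
      refine Integrable.bdd_mul (c := B * (2 * δ⁻¹)) hF
        (((hψ.continuous.comp continuous_norm).measurable.mul
          (measurable_norm.inv.const_mul 2)).aestronglyMeasurable) (ae_of_all _ fun x => ?_)
      by_cases hx : ‖x‖ ∈ Set.Ioo δ R'
      · rw [norm_mul, norm_mul, norm_inv, norm_norm, Real.norm_ofNat]
        gcongr
        · exact hB _
        · exact hx.1.le
      · rw [hz _ hx, zero_mul, norm_zero]; positivity
    have e1 : ∀ x, η x * (((n : ℝ) - 1) * gradDensity 0 P x + (n - 3) * gradDensity 1 Q x) +
        ψ ‖x‖ * (‖x‖ * (gradDensity 0 P x + gradDensity 1 Q x) -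
          2 * ‖x‖⁻¹ * (radialDensity 0 P x + radialDensity 1 Q x)) =
        (((n : ℝ) - 1) * (η x * gradDensity 0 P x) + ((n : ℝ) - 3) * (η x * gradDensity 1 Q x)) +
        (((ψ ‖x‖ * ‖x‖) * gradDensity 0 P x + (ψ ‖x‖ * ‖x‖) * gradDensity 1 Q x) -
        ((ψ ‖x‖ * (2 * ‖x‖⁻¹)) * radialDensity 0 P x + (ψ ‖x‖ * (2 * ‖x‖⁻¹)) * radialDensity 1 Q x)) := by
      intro x; ring
    rw [setIntegral_congr_fun (isOpen_halfBall ρ).measurableSet fun x _ => e1 x] at hv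
    have j1 := (ig d1).const_mul ((n : ℝ) - 1)
    have j2 := (ig d2).const_mul ((n : ℝ) - 3)
    have j12 : IntegrableOn (fun x => ((n : ℝ) - 1) * (η x * gradDensity 0 P x) +
      ((n : ℝ) - 3) * (η x * gradDensity 1 Q x)) (halfBall n ρ) := j1.add j2
    have j34 : IntegrableOn (fun x => (ψ ‖x‖ * ‖x‖) * gradDensity 0 P x +
      (ψ ‖x‖ * ‖x‖) * gradDensity 1 Q x) (halfBall n ρ) := (ig1 d1).add (ig1 d2)
    have j56 : IntegrableOn (fun x => (ψ ‖x‖ * (2 * ‖x‖⁻¹)) * radialDensity 0 P x +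
      (ψ ‖x‖ * (2 * ‖x‖⁻¹)) * radialDensity 1 Q x) (halfBall n ρ) := (ig2 d3).add (ig2 d4)
    have j36 : IntegrableOn (fun x => ((ψ ‖x‖ * ‖x‖) * gradDensity 0 P x +
      (ψ ‖x‖ * ‖x‖) * gradDensity 1 Q x) - ((ψ ‖x‖ * (2 * ‖x‖⁻¹)) * radialDensity 0 P x +
      (ψ ‖x‖ * (2 * ‖x‖⁻¹)) * radialDensity 1 Q x)) (halfBall n ρ) := j34.sub j56
    rw [integral_add j12 j36, integral_add j1 j2, integral_sub j34 j56,
      integral_add (ig1 d1) (ig1 d2), integral_add (ig2 d3) (ig2 d4), integral_const_mul,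
      integral_const_mul,
      integral_halfBall_radial (fun t => ∫ s in ρ..t, ψ s) (ig d1),
      integral_halfBall_radial (fun t => ∫ s in ρ..t, ψ s) (ig d2),
      integral_halfBall_radial (fun t => ψ t * t) (ig1 d1),
      integral_halfBall_radial (fun t => ψ t * t) (ig1 d2),
      integral_halfBall_radial (fun t => ψ t * (2 * t⁻¹)) (ig2 d3),
      integral_halfBall_radial (fun t => ψ t * (2 * t⁻¹)) (ig2 d4)] at hv
    have k : ∀ {F : Rn n → ℝ} (ξ : ℝ → ℝ), IntegrableOn (fun x => ξ ‖x‖ * F x) (halfBall n ρ) →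
        IntegrableOn (fun s => ξ s * sphInt F s) (Set.Ioo 0 ρ) := by
      intro F ξ hF
      refine (integrableOn_sphInt hF).congr_fun (fun s hs => ?_) measurableSet_Ioo
      simp only [sphInt, norm_smul_sphere _ hs.1.le, integral_const_mul]; ring
    have k1 := k (fun t => ∫ s in ρ..t, ψ s) (ig d1)
    have k2 := k (fun t => ∫ s in ρ..t, ψ s) (ig d2)
    have k3 := k (fun t => ψ t * t) (ig1 d1)
    have k4 := k (fun t => ψ t * t) (ig1 d2)
    have k5 := k (fun t => ψ t * (2 * t⁻¹)) (ig2 d3)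
    have k6 := k (fun t => ψ t * (2 * t⁻¹)) (ig2 d4)
    have l1 : ∫ t in Set.Ioo 0 ρ, (∫ s in ρ..t, ψ s) * (((n : ℝ) - 1) * sphInt (gradDensity 0 P) t +
        ((n : ℝ) - 3) * sphInt (gradDensity 1 Q) t) =
        ((n : ℝ) - 1) * (∫ t in Set.Ioo 0 ρ, (∫ s in ρ..t, ψ s) * sphInt (gradDensity 0 P) t) +
        ((n : ℝ) - 3) * ∫ t in Set.Ioo 0 ρ, (∫ s in ρ..t, ψ s) * sphInt (gradDensity 1 Q) t := by
      rw [← integral_const_mul, ← integral_const_mul, ← integral_add (k1.const_mul _) (k2.const_mul _)]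
      refine integral_congr_ae (ae_of_all _ fun t => ?_)
      ring
    have l2 : ∫ t in Set.Ioo 0 ρ, ψ t * (t * (sphInt (gradDensity 0 P) t + sphInt (gradDensity 1 Q) t) -
        2 * t⁻¹ * (sphInt (radialDensity 0 P) t + sphInt (radialDensity 1 Q) t)) =
        ((∫ t in Set.Ioo 0 ρ, (ψ t * t) * sphInt (gradDensity 0 P) t) +
          ∫ t in Set.Ioo 0 ρ, (ψ t * t) * sphInt (gradDensity 1 Q) t) -
        ((∫ t in Set.Ioo 0 ρ, (ψ t * (2 * t⁻¹)) * sphInt (radialDensity 0 P) t) +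
          ∫ t in Set.Ioo 0 ρ, (ψ t * (2 * t⁻¹)) * sphInt (radialDensity 1 Q) t) := by
      rw [← integral_add k3 k4, ← integral_add k5 k6]
      have k34 : IntegrableOn (fun t => ψ t * t * sphInt (gradDensity 0 P) t +
        ψ t * t * sphInt (gradDensity 1 Q) t) (Set.Ioo 0 ρ) := k3.add k4
      have k56 : IntegrableOn (fun t => ψ t * (2 * t⁻¹) * sphInt (radialDensity 0 P) t +
        ψ t * (2 * t⁻¹) * sphInt (radialDensity 1 Q) t) (Set.Ioo 0 ρ) := k5.add k6
      rw [← integral_sub k34 k56]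
      refine integral_congr_ae (ae_of_all _ fun t => ?_)
      ring
    rw [l1, l2]
    linarith
  filter_upwards [key, ae_restrict_mem measurableSet_Ioo] with s hs hsm
  have i1 : IntervalIntegrable (sphInt (gradDensity 0 P)) volume 0 s :=
    (intervalIntegrable_iff_integrableOn_Ioo_of_le hsm.1.le).2
      (s1.mono_set (Set.Ioo_subset_Ioo_right hsm.2.le))
  have i2 : IntervalIntegrable (sphInt (gradDensity 1 Q)) volume 0 s :=
    (intervalIntegrable_iff_integrableOn_Ioo_of_le hsm.1.le).2
      (s2.mono_set (Set.Ioo_subset_Ioo_right hsm.2.le))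
  rw [hs, intervalIntegral.integral_add (i1.const_mul _) (i2.const_mul _),
    intervalIntegral.integral_const_mul, intervalIntegral.integral_const_mul]

end IsTwoPhase

lemma integrableOn_rpow_mul_Ioo {F : ℝ → ℝ} {a b ρ : ℝ} (hF : IntegrableOn F (Set.Ioo 0 ρ))
    (ha : 0 < a) (hb : b ≤ ρ) (c : ℝ) : IntegrableOn (fun s => s ^ c * F s) (Set.Ioo a b) := by
  obtain ⟨B, hB⟩ : ∃ B, ∀ s ∈ Set.Icc a b, ‖s ^ c‖ ≤ B :=
    isCompact_Icc.exists_bound_of_continuousOn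
      (continuousOn_id.rpow_const fun s hs => Or.inl (ha.trans_le hs.1).ne')
  refine Integrable.bdd_mul (c := B) (hF.mono_set fun s hs => ⟨ha.trans hs.1, hs.2.trans_le hb⟩)
    (by fun_prop : Measurable fun s : ℝ => s ^ c).aestronglyMeasurable ?_
  filter_upwards [ae_restrict_mem measurableSet_Ioo] with s hs using hB s ⟨hs.1.le, hs.2.le⟩

namespace IsPhase

variable {σ β C ρ : ℝ} {f : Rn n → ℝ} {P : Rn n → Rn n}

lemma sphInt_eulerDensity_nonneg (σ a : ℝ) (f : Rn n → ℝ) (P : Rn n → Rn n) {s : ℝ} (hs : 0 < s) :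
    0 ≤ sphInt (eulerDensity (n := n) σ a f P) s :=
  sphInt_nonneg (R := s + 1) ⟨hs, by linarith⟩ fun x hx => by
    have := wt_pos (σ := σ) hx.1
    simp only [eulerDensity]; positivity

/-- In the second term the bound on the spherical means has been used. Its factor (b-a)/a is
invariant under scaling, so it does not change when a and b are multiplied by r_m. -/
lemma integral_abs_ray_sub_le_euler (h : IsPhase σ β C ρ f P) (hβ : 0 < β) (hn : 1 ≤ n)
    {a b t : ℝ} (ha : 0 < a) (hab : a ≤ b) (hb : b < ρ) (ht : 0 < t) :
    ∫ y, wt σ (y : Rn n) * |b ^ (-2 * (β + σ)) * f (b • (y : Rn n)) ^ 2 -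
        a ^ (-2 * (β + σ)) * f (a • (y : Rn n)) ^ 2| ∂sphereMeasure n ≤
      t⁻¹ * (∫ s in Set.Ioo a b, 2 * s ^ (-2 * β - n - 1) *
        sphInt (eulerDensity σ (β + σ) f P) s) +
        t * (C ^ 2 * (sphereMeasure n).real Set.univ) * ((b - a) / a) := by
  refine (h.integral_abs_ray_sub_le hβ hn ha hab hb).trans ?_
  have i1 : IntegrableOn (fun s => 2 * s ^ (-2 * β - n - 1) *
      sphInt (fun x => |crossDensity σ (β + σ) f P x|) s) (Set.Ioo a b) := by
    simp_rw [mul_assoc]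
    exact (integrableOn_rpow_mul_Ioo (integrableOn_sphInt (h.integrableOn_crossDensity hβ (β + σ)).abs)
      ha hb.le _).const_mul 2
  have i2 : IntegrableOn (fun s => 2 * s ^ (-2 * β - n - 1) *
      sphInt (eulerDensity σ (β + σ) f P) s) (Set.Ioo a b) := by
    simp_rw [mul_assoc]
    exact (integrableOn_rpow_mul_Ioo (integrableOn_sphInt (h.integrableOn_eulerDensity hβ (β + σ)))
      ha hb.le _).const_mul 2
  set K := C ^ 2 * (sphereMeasure n).real Set.univ
  have hK : 0 ≤ K := by positivity
  have hsub : Set.Ioo a b ⊆ Set.Ioo 0 ρ := fun s hs => ⟨ha.trans hs.1, hs.2.trans hb⟩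
  have i3 : IntegrableOn (fun _ : ℝ => t * K / a) (Set.Ioo a b) := by simp
  calc _ ≤ ∫ s in Set.Ioo a b, (t⁻¹ * (2 * s ^ (-2 * β - n - 1) *
        sphInt (eulerDensity σ (β + σ) f P) s) + t * K / a) := by
        refine integral_mono_ae i1 ((i2.const_mul _).add i3) ?_
        filter_upwards [ae_restrict_of_ae_restrict_of_subset hsub
          (h.sphInt_abs_crossDensity_le hβ (β + σ) ht), ae_restrict_mem measurableSet_Ioo] with s hs hm
        have hs0 : 0 < s := ha.trans hm.1
        have hE := sphInt_eulerDensity_nonneg σ (β + σ) f P hs0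
        have h1 := h.sphereMean_le (hsub hm)
        rw [sphereMean_eq hn hs0] at h1
        have hq := Real.rpow_pos_of_pos hs0 (-2 * β - n - 1)
        have h2 : s ^ (-2 * β - n) = s ^ (-2 * β - n - 1) * s := by
          rw [← Real.rpow_add_one hs0.ne']; congr 1; ring
        rw [h2] at h1
        have h3 : s ^ (-2 * β - n - 1) * sphInt (sqDensity σ f) s ≤ K / a := by
          rw [le_div_iff₀ ha]
          have hS : 0 ≤ sphInt (sqDensity (n := n) σ f) s :=
            sphInt_nonneg (R := ρ) (hsub hm) fun x hx => by
              have := wt_pos (σ := σ) hx.1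
              simp only [sqDensity]; positivity
          calc _ ≤ s ^ (-2 * β - n - 1) * sphInt (sqDensity σ f) s * s := by
                gcongr; exact hm.1.le
            _ ≤ K := by linarith
        calc _ ≤ 2 * s ^ (-2 * β - n - 1) * ((t⁻¹ * sphInt (eulerDensity σ (β + σ) f P) s +
              t * sphInt (sqDensity σ f) s) / 2) := by gcongr
          _ = t⁻¹ * (s ^ (-2 * β - n - 1) * sphInt (eulerDensity σ (β + σ) f P) s) +
              t * (s ^ (-2 * β - n - 1) * sphInt (sqDensity σ f) s) := by ring
          _ ≤ t⁻¹ * (2 * (s ^ (-2 * β - n - 1) * sphInt (eulerDensity σ (β + σ) f P) s)) +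
              t * (K / a) := by
            have : 0 ≤ s ^ (-2 * β - n - 1) * sphInt (eulerDensity σ (β + σ) f P) s := by positivity
            exact add_le_add (mul_le_mul_of_nonneg_left (by linarith) (by positivity)) (by gcongr)
          _ = _ := by ring
    _ = _ := by
        rw [integral_add (i2.const_mul _) i3, integral_const_mul, setIntegral_const]
        simp [Real.volume_real_Ioo_of_le hab]
        ring

end IsPhase

namespace IsTwoPhase

variable {β C ρ : ℝ} {f g : Rn n → ℝ} {P Q : Rn n → Rn n}

lemma integrableOn_weissDeriv (h : IsTwoPhase β C ρ f P g Q) (hβ : 0 < β) {a b : ℝ} (ha : 0 < a)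
    (hb : b ≤ ρ) : IntegrableOn (weissDeriv β f P g Q) (Set.Ioo a b) := by
  have h1 := integrableOn_rpow_mul_Ioo ((integrableOn_sphInt (h.pos.integrableOn_eulerDensity hβ β)).add
    (integrableOn_sphInt (h.neg.integrableOn_eulerDensity hβ (β + 1)))) ha hb (-2 * β - n - 1)
  refine (h1.const_mul 2).congr (ae_of_all _ fun s => ?_)
  simp only [weissDeriv, Pi.add_apply]; ring

lemma weissDeriv_nonneg (β : ℝ) (f g : Rn n → ℝ) (P Q : Rn n → Rn n) {s : ℝ} (hs : 0 < s) :
    0 ≤ weissDeriv β f P g Q s := by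
  have h1 := IsPhase.sphInt_eulerDensity_nonneg 0 β f P hs
  have h2 := IsPhase.sphInt_eulerDensity_nonneg 1 (β + 1) g Q hs
  have := Real.rpow_pos_of_pos hs (-2 * β - n - 1)
  simp only [weissDeriv]; positivity

/-- Pohozaev's identity gives the derivative of the energy and Green's formula the energy itself.
After cancellation the coefficients n-1 and n-3 leave -2β and -2(β+1), that is, -2 times the degree
of the phase. With the derivatives of the spherical means these complete the square (x·P - af)² in
each phase. -/
lemma weissFun_sub (h : IsTwoPhase β C ρ f P g Q) (hβ : 0 < β) (hn : 1 ≤ n) {a b : ℝ} (ha : 0 < a)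
    (hab : a ≤ b) (hb : b < ρ) :
    weissFun β f P g Q b - weissFun β f P g Q a = ∫ s in Set.Ioo a b, weissDeriv β f P g Q s := by
  have hρ : 0 < ρ := ha.trans_le (hab.trans hb.le)
  have hb0 : 0 < b := ha.trans_le hab
  have hsub : Set.Ioo a b ⊆ Set.Ioo 0 ρ := fun s hs => ⟨ha.trans hs.1, hs.2.trans hb⟩
  have s1 := integrableOn_sphInt (h.pos.integrableOn_gradDensity hβ)
  have s2 := integrableOn_sphInt (h.neg.integrableOn_gradDensity hβ)
  have m1 := h.pos.sphereMean_sub hβ hn ha hab hb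
  have m2 := h.neg.sphereMean_sub hβ hn ha hab hb
  rw [add_zero] at m1
  have hI : ∀ r ∈ Set.Ioo 0 ρ, (∫ x in halfBall n r, gradDensity 0 P x) +
      ∫ x in halfBall n r, gradDensity 1 Q x =
      ∫ s in (0 : ℝ)..r, (sphInt (gradDensity 0 P) s + sphInt (gradDensity 1 Q) s) := by
    intro r hr
    rw [h.pos.integral_gradDensity hβ hr.1.le hr.2.le, h.neg.integral_gradDensity hβ hr.1.le hr.2.le,
      intervalIntegral.integral_add]
    · exact (intervalIntegrable_iff_integrableOn_Ioo_of_le hr.1.le).2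
        (s1.mono_set (Set.Ioo_subset_Ioo_right hr.2.le))
    · exact (intervalIntegrable_iff_integrableOn_Ioo_of_le hr.1.le).2
        (s2.mono_set (Set.Ioo_subset_Ioo_right hr.2.le))
  have hprim := integral_primitive_mul (g := fun t => t ^ (-2 * β - n + 1))
    (g' := fun t => (-2 * β - n + 1) * t ^ (-2 * β - n + 1 - 1))
    (e := fun s => sphInt (gradDensity 0 P) s + sphInt (gradDensity 1 Q) s) ha.le hab
    (fun t ht => Real.hasDerivAt_rpow_const (Or.inl (ha.trans_le ht.1).ne'))
    (fun t ht => (Real.contDiffAt_rpow_const_of_ne (ha.trans_le ht.1).ne').contDiffWithinAt)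
    ((s1.add s2).mono_set (Set.Ioo_subset_Ioo_right hb.le))
  simp only [weissFun]
  rw [hI b ⟨hb0, hb⟩, hI a ⟨ha, hab.trans_lt hb⟩]
  have c1 := integrableOn_rpow_mul_Ioo (integrableOn_sphInt (h.pos.integrableOn_crossDensity hβ β)) ha hb.le
    (-2 * β - n - 1)
  have c2 := integrableOn_rpow_mul_Ioo (integrableOn_sphInt (h.neg.integrableOn_crossDensity hβ (β + 1))) ha hb.le
    (-2 * β - n - 1)
  have c1' := (c1.const_mul 2).const_mul β
  have c2' := (c2.const_mul 2).const_mul (β + 1)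
  have c12 : IntegrableOn (fun s => β * (2 * s ^ (-2 * β - n - 1) * sphInt (crossDensity 0 β f P) s) +
      (β + 1) * (2 * s ^ (-2 * β - n - 1) * sphInt (crossDensity 1 (β + 1) g Q) s)) (Set.Ioo a b) :=
    (c1'.add c2').congr (ae_of_all _ fun s => by simp only [Pi.add_apply]; ring)
  have heq : ∫ t in a..b, ((-2 * β - n + 1) * t ^ (-2 * β - n + 1 - 1) *
      (∫ s in (0 : ℝ)..t, (sphInt (gradDensity 0 P) s + sphInt (gradDensity 1 Q) s)) +
      t ^ (-2 * β - n + 1) * (sphInt (gradDensity 0 P) t + sphInt (gradDensity 1 Q) t)) =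
      ∫ s in Set.Ioo a b, (weissDeriv β f P g Q s +
        (β * (2 * s ^ (-2 * β - n - 1) * sphInt (crossDensity 0 β f P) s) +
      (β + 1) * (2 * s ^ (-2 * β - n - 1) * sphInt (crossDensity 1 (β + 1) g Q) s))) := by
    rw [intervalIntegral.integral_of_le hab, integral_Ioc_eq_integral_Ioo]
    refine integral_congr_ae ?_
    filter_upwards [ae_restrict_of_ae_restrict_of_subset hsub (h.radial_variation hβ hρ),
      ae_restrict_of_ae_restrict_of_subset hsub (h.pos.sphInt_mixedDensity hβ hρ),
      ae_restrict_of_ae_restrict_of_subset hsub (h.neg.sphInt_mixedDensity hβ hρ),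
      ae_restrict_of_ae_restrict_of_subset hsub (h.pos.sphInt_crossDensity hβ β),
      ae_restrict_of_ae_restrict_of_subset hsub (h.neg.sphInt_crossDensity hβ (β + 1)),
      ae_restrict_of_ae_restrict_of_subset hsub (h.pos.sphInt_eulerDensity hβ β),
      ae_restrict_of_ae_restrict_of_subset hsub (h.neg.sphInt_eulerDensity hβ (β + 1)),
      ae_restrict_mem measurableSet_Ioo] with s e1 e2 e3 e4 e5 e6 e7 hs
    have hs0 : 0 < s := ha.trans hs.1
    have hsρ := hsub hs
    rw [← hI s hsρ, h.pos.integral_gradDensity hβ hsρ.1.le hsρ.2.le,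
      h.neg.integral_gradDensity hβ hsρ.1.le hsρ.2.le, weissDeriv, e4, e5, e6, e7]
    rw [← e2, ← e3] at e1 ⊢
    have p1 : s ^ (-2 * β - n + 1 - 1) = s ^ (-2 * β - n - 1) * s := by
      rw [← Real.rpow_add_one hs0.ne']; congr 1; ring
    have p2 : s ^ (-2 * β - n + 1) = s ^ (-2 * β - n - 1) * s * s := by
      rw [← Real.rpow_add_one hs0.ne', ← Real.rpow_add_one hs0.ne']; congr 1; ring
    -- Pohozaev's identity solved for the derivative of the energy, with the energies already
    -- replaced by Green's formula.
    have e8 : sphInt (gradDensity 0 P) s + sphInt (gradDensity 1 Q) s =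
        s⁻¹ * (2 * s⁻¹ * (sphInt (radialDensity 0 P) s + sphInt (radialDensity 1 Q) s) +
        (n - 1) * (s⁻¹ * sphInt (mixedDensity 0 f P) s) +
        (n - 3) * (s⁻¹ * sphInt (mixedDensity 1 g Q) s)) := by
      rw [eq_inv_mul_iff_mul_eq₀ hs0.ne']; linarith
    rw [p1, p2, e8]
    field_simp
    ring
  have hfin := hprim.symm.trans heq
  rw [integral_add (h.integrableOn_weissDeriv hβ ha hb.le) c12, integral_add
    (c1'.congr (ae_of_all _ fun s => by simp only []; ring))
    (c2'.congr (ae_of_all _ fun s => by simp only []; ring)), integral_const_mul, integral_const_mul,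
    ← m1, ← m2] at hfin
  linarith

lemma monotoneOn_weissFun (h : IsTwoPhase β C ρ f P g Q) (hβ : 0 < β) (hn : 1 ≤ n) :
    MonotoneOn (weissFun β f P g Q) (Set.Ioo 0 ρ) := by
  intro a ha b hb hab
  rw [← sub_nonneg, h.weissFun_sub hβ hn ha.1 hab hb.2]
  exact setIntegral_nonneg measurableSet_Ioo fun s hs => weissDeriv_nonneg β f g P Q (ha.1.trans hs.1)

/-- The energy is nonnegative and the spherical means are bounded. This lower bound and monotonicity
give the limit. -/
lemma neg_le_weissFun (h : IsTwoPhase β C ρ f P g Q) (hβ : 0 < β) {r : ℝ} (hr : r ∈ Set.Ioo 0 ρ) :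
    -((2 * β + 1) * (C ^ 2 * (sphereMeasure n).real Set.univ)) ≤ weissFun β f P g Q r := by
  have h1 := h.pos.sphereMean_le hr
  have h2 := h.neg.sphereMean_le hr
  rw [add_zero] at h1
  have hg : ∀ (σ : ℝ) (P : Rn n → Rn n), 0 ≤ ∫ x in halfBall n r, gradDensity σ P x := fun σ P =>
    setIntegral_nonneg (isOpen_halfBall r).measurableSet fun x hx => by
      have := wt_pos (σ := σ) hx.1
      simp only [gradDensity]; positivity
  have h3 := mul_nonneg (Real.rpow_nonneg hr.1.le (-2 * β - n + 1)) (add_nonneg (hg 0 P) (hg 1 Q))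
  have h4 := mul_le_mul_of_nonneg_left h1 hβ.le
  have h5 := mul_le_mul_of_nonneg_left h2 (by linarith : 0 ≤ β + 1)
  rw [weissFun]
  linarith

lemma exists_tendsto_weissFun (h : IsTwoPhase β C ρ f P g Q) (hβ : 0 < β) (hn : 1 ≤ n) (hρ : 0 < ρ) :
    ∃ L, Tendsto (weissFun β f P g Q) (𝓝[>] 0) (𝓝 L) :=
  ⟨_, (h.monotoneOn_weissFun hβ hn).tendsto_nhdsWithin_Ioo_right (Set.nonempty_Ioo.2 hρ)
    ⟨_, by rintro _ ⟨r, hr, rfl⟩; exact h.neg_le_weissFun hβ hr⟩⟩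

/-- Green's formula turns the energies in M into boundary integrals of w f (x·P), so M(s) is
s^(-2β-n) times the integrals of w f (x·P - af). Young's inequality then bounds M by its own
derivative up to a small error: if M is not small, it grows at a definite rate in log s. -/
lemma abs_weissFun_le (h : IsTwoPhase β C ρ f P g Q) (hβ : 0 < β) (hn : 1 ≤ n) (hρ : 0 < ρ)
    {t : ℝ} (ht : 0 < t) : ∀ᵐ s ∂(volume.restrict (Set.Ioo 0 ρ)),
      |weissFun β f P g Q s| ≤ t⁻¹ * (s * weissDeriv β f P g Q s) +
        t * (C ^ 2 * (sphereMeasure n).real Set.univ) := by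
  filter_upwards [h.pos.sphInt_mixedDensity hβ hρ, h.neg.sphInt_mixedDensity hβ hρ,
    h.pos.sphInt_crossDensity hβ β, h.neg.sphInt_crossDensity hβ (β + 1),
    h.pos.sphInt_abs_crossDensity_le hβ β ht, h.neg.sphInt_abs_crossDensity_le hβ (β + 1) ht,
    ae_restrict_mem measurableSet_Ioo] with s e1 e2 e3 e4 e5 e6 hs
  have hs0 : 0 < s := hs.1
  have m1 := h.pos.sphereMean_le hs
  have m2 := h.neg.sphereMean_le hs
  rw [IsPhase.sphereMean_eq hn hs0] at m1 m2
  have n1 := IsPhase.sphereMean_eq (n := n) (σ := 0) (β := β) (f := f) hn hs0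
  have n2 := IsPhase.sphereMean_eq (n := n) (σ := 1) (β := β) (f := g) hn hs0
  rw [add_zero] at n1
  have hE1 := IsPhase.sphInt_eulerDensity_nonneg 0 β f P hs0
  have hE2 := IsPhase.sphInt_eulerDensity_nonneg 1 (β + 1) g Q hs0
  have hq := Real.rpow_pos_of_pos hs0 (-2 * β - n)
  have p1 : s ^ (-2 * β - n + 1) = s ^ (-2 * β - n) * s := by
    rw [← Real.rpow_add_one hs0.ne']
  have p2 : s * s ^ (-2 * β - n - 1) = s ^ (-2 * β - n) := by
    rw [mul_comm, ← Real.rpow_add_one hs0.ne']; congr 1; ring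
  have a1 := (IsPhase.abs_sphInt_le hs0.le).trans e5
  have a2 := (IsPhase.abs_sphInt_le hs0.le).trans e6
  have e7 : weissFun β f P g Q s =
      s ^ (-2 * β - n) * (sphInt (crossDensity 0 β f P) s + sphInt (crossDensity 1 (β + 1) g Q) s) := by
    rw [weissFun, h.pos.integral_gradDensity hβ hs.1.le hs.2.le,
      h.neg.integral_gradDensity hβ hs.1.le hs.2.le, ← e1, ← e2, e3, e4, n1, n2, p1]
    field_simp
    ring
  set E := sphInt (eulerDensity 0 β f P) s + sphInt (eulerDensity 1 (β + 1) g Q) s with hE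
  have e8 : s * weissDeriv β f P g Q s = 2 * (s ^ (-2 * β - n) * E) := by
    rw [weissDeriv, ← p2]; ring
  have hqE : 0 ≤ t⁻¹ * (s ^ (-2 * β - n) * E) := by positivity
  rw [e7, e8, abs_mul, abs_of_pos hq]
  set K := C ^ 2 * (sphereMeasure n).real Set.univ
  calc _ ≤ s ^ (-2 * β - n) * ((t⁻¹ * sphInt (eulerDensity 0 β f P) s + t * sphInt (sqDensity 0 f) s) / 2
        + (t⁻¹ * sphInt (eulerDensity 1 (β + 1) g Q) s + t * sphInt (sqDensity 1 g) s) / 2) := by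
        gcongr
        exact (abs_add_le _ _).trans (add_le_add a1 a2)
    _ = t⁻¹ * (s ^ (-2 * β - n) * E) / 2 + t * (s ^ (-2 * β - n) * sphInt (sqDensity 0 f) s +
        s ^ (-2 * β - n) * sphInt (sqDensity 1 g) s) / 2 := by rw [hE]; ring
    _ ≤ t⁻¹ * (s ^ (-2 * β - n) * E) / 2 + t * (K + K) / 2 := by gcongr
    _ ≤ _ := by linarith

/-- Suppose that the limit L is not 0, and let tK ≤ |L|/4. For small s the previous bound gives s
M'(s) ≥ t|L|/4, hence M' ≥ t|L|/(8r) on (r, 2r) and M(2r) - M(r) ≥ t|L|/8. This contradicts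
convergence. -/
lemma tendsto_weissFun (h : IsTwoPhase β C ρ f P g Q) (hβ : 0 < β) (hn : 1 ≤ n) (hρ : 0 < ρ) :
    Tendsto (weissFun β f P g Q) (𝓝[>] 0) (𝓝 0) := by
  obtain ⟨L, hL⟩ := h.exists_tendsto_weissFun hβ hn hρ
  suffices L = 0 by rwa [this] at hL
  by_contra hL0
  have hLp : 0 < |L| := abs_pos.2 hL0
  set K := C ^ 2 * (sphereMeasure n).real Set.univ with hK
  have hK0 : 0 ≤ K := by positivity
  obtain ⟨t, ht, htK⟩ : ∃ t > 0, t * K ≤ |L| / 4 := by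
    -- K may be 0, hence K + 1 in the denominator.
    refine ⟨|L| / 4 / (K + 1), by positivity, ?_⟩
    rw [div_mul_eq_mul_div, div_le_iff₀ (by positivity)]
    gcongr; linarith
  have hd : Tendsto (fun r : ℝ => 2 * r) (𝓝[>] 0) (𝓝[>] 0) := by
    refine tendsto_nhdsWithin_iff.2 ⟨?_, ?_⟩
    · have : Tendsto (fun r : ℝ => 2 * r) (𝓝 0) (𝓝 (2 * 0)) := tendsto_id.const_mul 2
      rw [mul_zero] at this
      exact this.mono_left nhdsWithin_le_nhds
    · filter_upwards [self_mem_nhdsWithin] with r hr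
      exact mul_pos two_pos (Set.mem_Ioi.1 hr)
  have hdiff : Tendsto (fun r => weissFun β f P g Q (2 * r) - weissFun β f P g Q r) (𝓝[>] 0) (𝓝 0) := by
    simpa using (hL.comp hd).sub hL
  have hev : ∀ᶠ s in 𝓝[>] (0 : ℝ), |L| / 2 < |weissFun β f P g Q s| :=
    hL.abs.eventually_const_lt (by linarith)
  obtain ⟨r₁, hr₁, hr₁'⟩ := mem_nhdsGT_iff_exists_Ioo_subset.1 hev
  have hsm : ∀ᶠ r in 𝓝[>] (0 : ℝ), r ∈ Set.Ioo 0 (min ρ r₁ / 2) :=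
    Ioo_mem_nhdsGT (half_pos (lt_min hρ hr₁))
  obtain ⟨r, h1, h2⟩ := ((hdiff.eventually_lt_const
    (by positivity : 0 < |L| * t / 8)).and hsm).exists
  have hr0 : 0 < r := h2.1
  have hrρ : 2 * r < ρ := by have := h2.2; have := min_le_left ρ r₁; linarith
  have hrr : 2 * r < r₁ := by have := h2.2; have := min_le_right ρ r₁; linarith
  rw [h.weissFun_sub hβ hn hr0 (by linarith) hrρ] at h1
  have hsub : Set.Ioo r (2 * r) ⊆ Set.Ioo 0 ρ := fun s hs => ⟨hr0.trans hs.1, hs.2.trans hrρ⟩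
  have hle : ∫ _ in Set.Ioo r (2 * r), |L| * t / (8 * r) ≤
      ∫ s in Set.Ioo r (2 * r), weissDeriv β f P g Q s := by
    refine integral_mono_ae (by simp) (h.integrableOn_weissDeriv hβ hr0 hrρ.le) ?_
    filter_upwards [ae_restrict_of_ae_restrict_of_subset hsub (h.abs_weissFun_le hβ hn hρ ht),
      ae_restrict_mem measurableSet_Ioo] with s hs hm
    have h3 : |L| / 2 < |weissFun β f P g Q s| := hr₁' ⟨hr0.trans hm.1, hm.2.trans hrr⟩
    have h4 := weissDeriv_nonneg β f g P Q (hr0.trans hm.1)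
    have h5 : |L| / 4 ≤ t⁻¹ * (2 * r * weissDeriv β f P g Q s) := by
      have : t⁻¹ * (s * weissDeriv β f P g Q s) ≤ t⁻¹ * (2 * r * weissDeriv β f P g Q s) := by
        gcongr; exact hm.2.le
      linarith
    rw [inv_mul_eq_div, le_div_iff₀ ht] at h5
    rw [div_le_iff₀ (by positivity)]
    linarith
  rw [setIntegral_const, Real.volume_real_Ioo_of_le (by linarith), smul_eq_mul] at hle
  have : (2 * r - r) * (|L| * t / (8 * r)) = |L| * t / 8 := by field_simp; ring
  linarith

end IsTwoPhase

/-! ### Blow-up sequences: from weak to locally uniform convergence. -/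

/-- The measure `x₁^(1-2σ) dx` on `U`. -/
def wtMeasure (σ : ℝ) (U : Set (Rn n)) : Measure (Rn n) :=
  (volume.restrict U).withDensity fun x => ENNReal.ofReal (wt σ x)

lemma muPos_eq (U : Set (Rn n)) : muPos U = wtMeasure 0 U := by
  simp only [muPos, wtMeasure, wt_zero]

lemma muNeg_eq (U : Set (Rn n)) : muNeg U = wtMeasure 1 U := by
  simp only [muNeg, wtMeasure, wt_one]

lemma measurable_ofReal_wt (σ : ℝ) : Measurable fun x : Rn n => ENNReal.ofReal (wt σ x) :=
  (measurable_wt σ).ennreal_ofReal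

lemma ae_mem_halfBall (R : ℝ) : ∀ᵐ x ∂(volume.restrict (halfBall n R)), x ∈ halfBall n R :=
  ae_restrict_mem (isOpen_halfBall R).measurableSet

lemma wtMeasure_ac (σ R : ℝ) : wtMeasure σ (halfBall n R) ≪ volume.restrict (halfBall n R) :=
  withDensity_absolutelyContinuous _ _

lemma integral_wtMeasure (σ R : ℝ) (F : Rn n → ℝ) :
    ∫ x, F x ∂wtMeasure σ (halfBall n R) = ∫ x in halfBall n R, wt σ x * F x := by
  rw [wtMeasure, integral_withDensity_eq_integral_toReal_smul (measurable_ofReal_wt σ)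
    (ae_of_all _ fun x => ENNReal.ofReal_lt_top)]
  refine integral_congr_ae ?_
  filter_upwards [ae_mem_halfBall R] with x hx
  rw [ENNReal.toReal_ofReal (wt_pos hx.1).le, smul_eq_mul]

lemma integrable_wtMeasure_iff {σ R : ℝ} {F : Rn n → ℝ} :
    Integrable F (wtMeasure σ (halfBall n R)) ↔
      IntegrableOn (fun x => wt σ x * F x) (halfBall n R) := by
  rw [wtMeasure, integrable_withDensity_iff_integrable_smul' (measurable_ofReal_wt σ)
    (ae_of_all _ fun x => ENNReal.ofReal_lt_top)]
  refine integrable_congr ?_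
  filter_upwards [ae_mem_halfBall R] with x hx
  rw [ENNReal.toReal_ofReal (wt_pos hx.1).le, smul_eq_mul]

lemma volume_halfBall_lt_top (R : ℝ) : volume (halfBall n R) < ⊤ :=
  (measure_mono fun x hx => by simpa using hx.2).trans_lt (measure_ball_lt_top (x := (0 : Rn n)) (r := R))

lemma memLp_div_wt {σ R A : ℝ} {φ : Rn n → ℝ} (hφ : Measurable φ) (hA : ∀ x, |φ x| ≤ A)
    {B : Set (Rn n)} (hB : IsCompact B) (hBR : B ⊆ halfBall n R) (h0 : ∀ x, x ∉ B → φ x = 0) :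
    MemLp (fun x => φ x / wt σ x) 2 (wtMeasure σ (halfBall n R)) := by
  have hm : Measurable fun x => φ x / wt σ x := hφ.div (measurable_wt σ)
  rw [memLp_two_iff_integrable_sq hm.aestronglyMeasurable, integrable_wtMeasure_iff]
  have hc : ContinuousOn (fun x : Rn n => (wt σ x)⁻¹) B :=
    ((continuousOn_wt σ).mono fun x hx => (hBR hx).1).inv₀ fun x hx => (wt_pos (hBR hx).1).ne'
  obtain ⟨K, hK⟩ := hB.exists_bound_of_continuousOn hc
  refine Measure.integrableOn_of_bounded (M := A ^ 2 * |K|) (volume_halfBall_lt_top R).ne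
    (((measurable_wt σ).mul (hm.pow_const 2)).aestronglyMeasurable) ?_
  filter_upwards [ae_mem_halfBall R] with x hx
  have hw := wt_pos (σ := σ) hx.1
  by_cases hxB : x ∈ B
  · have h1 := (hK x hxB).trans (le_abs_self K)
    rw [Real.norm_eq_abs, abs_of_pos (by positivity)] at h1
    rw [Real.norm_eq_abs, abs_of_nonneg (by positivity)]
    have h2 : wt σ x * (φ x / wt σ x) ^ 2 = |φ x| ^ 2 * (wt σ x)⁻¹ := by
      rw [sq_abs]; field_simp
    rw [h2]
    have := hA x
    gcongr
  · rw [h0 x hxB]; simp; positivity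

/-- Dividing the test function by the weight turns weak convergence in the weighted space into
convergence of unweighted integrals. This is allowed since φ is supported away from the axis, where
the weight is bounded below. -/
lemma tendsto_integral_of_weakL2 {σ R A : ℝ} {F : ℕ → Rn n → ℝ} {v : Rn n → ℝ}
    (hw : WeakL2 (wtMeasure σ (halfBall n R)) F v) {φ : Rn n → ℝ} (hφ : Measurable φ)
    (hA : ∀ x, |φ x| ≤ A) {B : Set (Rn n)} (hB : IsCompact B) (hBR : B ⊆ halfBall n R)
    (h0 : ∀ x, x ∉ B → φ x = 0) :
    Tendsto (fun m => ∫ x in halfBall n R, φ x * F m x) atTop (𝓝 (∫ x in halfBall n R, φ x * v x)) := by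
  have h1 : ∀ f : Rn n → ℝ, ∫ x, inner ℝ (f x) (φ x / wt σ x) ∂wtMeasure σ (halfBall n R) =
      ∫ x in halfBall n R, φ x * f x := by
    intro f
    rw [integral_wtMeasure]
    refine integral_congr_ae ?_
    filter_upwards [ae_mem_halfBall R] with x hx
    have := (wt_pos (σ := σ) hx.1).ne'
    simp only [RCLike.inner_apply, conj_trivial]
    field_simp
  have h2 := hw _ (memLp_div_wt hφ hA hB hBR h0)
  simpa only [h1] using h2

lemma exists_tendsto_of_approx {s : ℕ → ℝ} (h : ∀ ε > 0, ∃ (b : ℕ → ℝ) (L : ℝ),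
    Tendsto b atTop (𝓝 L) ∧ ∀ᶠ m in atTop, |s m - b m| ≤ ε) : ∃ L, Tendsto s atTop (𝓝 L) := by
  refine cauchySeq_tendsto_of_complete (Metric.cauchySeq_iff.2 fun ε hε => ?_)
  obtain ⟨b, L, hb, hs⟩ := h (ε / 4) (by positivity)
  obtain ⟨N, hN⟩ := Metric.cauchySeq_iff.1 hb.cauchySeq (ε / 4) (by positivity)
  obtain ⟨N', hN'⟩ := eventually_atTop.1 hs
  refine ⟨max N N', fun m hm k hk => ?_⟩
  have h1 := hN m ((le_max_left _ _).trans hm) k ((le_max_left _ _).trans hk)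
  have h2 := abs_le.1 (hN' m ((le_max_right _ _).trans hm))
  have h3 := abs_le.1 (hN' k ((le_max_right _ _).trans hk))
  rw [Real.dist_eq, abs_lt] at *
  constructor <;> linarith

/-- For σ > 0 the gradient bound has the additional factor x₁^σ, which is at most (3R)^σ. So both
phases are Hölder continuous of exponent β, with a constant that depends only on C, β, σ and R and
hence serves all members of a blow-up sequence. -/
lemma IsPhase.abs_sub_le {σ β C ρ : ℝ} {f : Rn n → ℝ} {P : Rn n → Rn n} (h : IsPhase σ β C ρ f P)
    (hσ : 0 ≤ σ) (hβ : 0 < β) (hβ1 : β ≤ 1) {R : ℝ} (hR : 0 < R) (hRρ : 3 * R ≤ ρ) {x y : Rn n}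
    (hx : x ∈ halfBall n R) (hy : y ∈ halfBall n R) :
    |f x - f y| ≤ (2 / β + 1) * (C * (3 * R) ^ σ) * ‖x - y‖ ^ β := by
  have h' := h.mono hRρ
  have e : 3 * R / 3 = R := by ring
  refine h'.toIsTruncC1.holder hβ hβ1 (mul_nonneg h.C_nonneg (by positivity)) (fun z hz => ?_)
    (by rwa [e]) (by rwa [e])
  refine (h'.grad_le z hz).trans ?_
  have hz0 := hz.1
  have e2 : z 0 ^ (β + σ - 1) = z 0 ^ σ * z 0 ^ (β - 1) := by
    rw [← Real.rpow_add hz0]; congr 1; ring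
  rw [e2, ← mul_assoc]
  have := h.C_nonneg
  gcongr
  exact (coord_le_norm z 0).trans hz.2.le

/-- A sequence of phases in `B_{ρ m}⁺`, where `ρ m → ∞`. -/
structure IsPhaseSeq (σ β C : ℝ) (ρ : ℕ → ℝ) (F : ℕ → Rn n → ℝ) (P : ℕ → Rn n → Rn n) : Prop where
  phase : ∀ m, IsPhase σ β C (ρ m) (F m) (P m)
  tendsto : Tendsto ρ atTop atTop
  sigma_nonneg : 0 ≤ σ
  beta_pos : 0 < β
  beta_le : β ≤ 1

namespace IsPhaseSeq

variable {σ β C : ℝ} {ρ : ℕ → ℝ} {F : ℕ → Rn n → ℝ} {P : ℕ → Rn n → Rn n} {v v₀ : Rn n → ℝ}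

lemma C_nonneg (h : IsPhaseSeq σ β C ρ F P) : 0 ≤ C := (h.phase 0).C_nonneg

lemma exists_equicont (h : IsPhaseSeq σ β C ρ F P) {R : ℝ} (hR : 0 < R) :
    ∃ K, 0 ≤ K ∧ ∀ᶠ m in atTop, R ≤ ρ m ∧
      ∀ x ∈ halfBall n R, ∀ y ∈ halfBall n R, |F m x - F m y| ≤ K * ‖x - y‖ ^ β := by
  have hβ := h.beta_pos
  have hC := h.C_nonneg
  refine ⟨(2 / β + 1) * (C * (3 * R) ^ σ), by positivity, ?_⟩
  filter_upwards [h.tendsto.eventually_ge_atTop (3 * R)] with m hm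
  exact ⟨by linarith, fun x hx y hy =>
    (h.phase m).abs_sub_le h.sigma_nonneg hβ h.beta_le hR hm hx hy⟩

/-- The value at x differs from the average over a small ball by a uniformly small amount, and
averages converge by weak convergence. So the whole sequence converges at every point, without
passing to a subsequence. -/
lemma exists_pointwise_limit (h : IsPhaseSeq σ β C ρ F P)
    (hw : ∀ R : ℝ, 0 < R → WeakL2 (wtMeasure σ (halfBall n R)) F v₀) :
    ∃ v : Rn n → ℝ, ∀ x ∈ halfSpace n, Tendsto (fun m => F m x) atTop (𝓝 (v x)) := by
  suffices ∀ x ∈ halfSpace n, ∃ L, Tendsto (fun m => F m x) atTop (𝓝 L) by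
    choose! v hv using this
    exact ⟨v, hv⟩
  intro x hx
  have hx0 : 0 < x 0 := hx
  refine exists_tendsto_of_approx fun ε hε => ?_
  have hR : 0 < ‖x‖ + x 0 := by positivity
  obtain ⟨K, hK0, hK⟩ := h.exists_equicont (R := ‖x‖ + x 0) hR
  -- The ball of radius δ stays off the axis, and the oscillation over it is at most ε.
  obtain ⟨δ, hδ, hδx, hδK⟩ : ∃ δ > 0, δ < x 0 ∧ K * δ ^ β ≤ ε := by
    have ht : Tendsto (fun δ : ℝ => K * δ ^ β) (𝓝[>] 0) (𝓝 (K * 0 ^ β)) :=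
      ((Real.continuousAt_rpow_const 0 β (Or.inr h.beta_pos.le)).tendsto.const_mul K).mono_left
        nhdsWithin_le_nhds
    rw [Real.zero_rpow h.beta_pos.ne', mul_zero] at ht
    obtain ⟨δ, h1, h2⟩ := ((ht.eventually_le_const hε).and (Ioo_mem_nhdsGT hx0)).exists
    exact ⟨δ, h2.1, h2.2, h1⟩
  set B := closedBall x δ
  have hBR : B ⊆ halfBall n (‖x‖ + x 0) := fun y hy => by
    have h1 : ‖y - x‖ ≤ δ := mem_closedBall_iff_norm.1 hy
    have h2 := abs_le.1 ((abs_coord_le_norm (y - x) 0).trans h1)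
    simp only [PiLp.sub_apply] at h2
    refine ⟨by linarith, ?_⟩
    have := norm_le_norm_add_norm_sub x y
    rw [norm_sub_rev] at h1
    linarith
  have hB : IsCompact B := isCompact_closedBall x δ
  have ht := tendsto_integral_of_weakL2 (hw _ hR) (φ := B.indicator 1)
    (measurable_one.indicator hB.measurableSet) (A := 1)
    (fun y => by by_cases hy : y ∈ B <;> simp [hy]) hB hBR (fun y hy => by simp [hy])
  have e : ∀ f : Rn n → ℝ, ∫ y in halfBall n (‖x‖ + x 0), B.indicator 1 y * f y = ∫ y in B, f y := by
    intro f
    have : ∀ y, B.indicator 1 y * f y = B.indicator f y := fun y => by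
      by_cases hy : y ∈ B <;> simp [hy]
    simp_rw [this]
    rw [setIntegral_indicator hB.measurableSet, Set.inter_eq_right.2 hBR]
  simp only [e] at ht
  have hV : 0 < volume.real B :=
    ENNReal.toReal_pos (measure_closedBall_pos _ _ hδ).ne' hB.measure_lt_top.ne
  refine ⟨fun m => (volume.real B)⁻¹ * ∫ y in B, F m y, _, ht.const_mul _, ?_⟩
  filter_upwards [hK] with m hm
  have hxR : x ∈ halfBall n (‖x‖ + x 0) := hBR (mem_closedBall_self hδ.le)
  have hint : IntegrableOn (F m) B := ((h.phase m).cont.mono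
    (hBR.trans (halfBall_mono hm.1))).integrableOn_compact hB
  have h3 : volume.real B * (F m x - (volume.real B)⁻¹ * ∫ y in B, F m y) =
      ∫ y in B, (F m x - F m y) := by
    have hcst : IntegrableOn (fun _ => F m x) B := integrableOn_const hB.measure_lt_top.ne
    rw [integral_sub hcst hint, setIntegral_const, smul_eq_mul]
    field_simp
  have h4 : ‖∫ y in B, (F m x - F m y)‖ ≤ ε * volume.real B := by
    refine norm_setIntegral_le_of_norm_le_const hB.measure_lt_top fun y hy => ?_
    refine (hm.2 x hxR y (hBR hy)).trans (le_trans ?_ hδK)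
    have : ‖x - y‖ ≤ δ := norm_sub_rev x y ▸ mem_closedBall_iff_norm.1 hy
    have := h.beta_pos
    gcongr
  rw [← h3, norm_mul, Real.norm_eq_abs, Real.norm_eq_abs, abs_of_pos hV, mul_comm] at h4
  exact le_of_mul_le_mul_right h4 hV

lemma exists_limit_equicont (h : IsPhaseSeq σ β C ρ F P)
    (hv : ∀ x ∈ halfSpace n, Tendsto (fun m => F m x) atTop (𝓝 (v x))) {R : ℝ} (hR : 0 < R) :
    ∃ K, 0 ≤ K ∧ ∀ x ∈ halfBall n R, ∀ y ∈ halfBall n R, |v x - v y| ≤ K * ‖x - y‖ ^ β := by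
  obtain ⟨K, hK0, hK⟩ := h.exists_equicont hR
  refine ⟨K, hK0, fun x hx y hy => le_of_tendsto ((hv x hx.1).sub (hv y hy.1)).abs ?_⟩
  filter_upwards [hK] with m hm using hm.2 x hx y hy

lemma continuousOn_limit (h : IsPhaseSeq σ β C ρ F P)
    (hv : ∀ x ∈ halfSpace n, Tendsto (fun m => F m x) atTop (𝓝 (v x))) :
    ContinuousOn v (halfSpace n) := by
  intro x hx
  have hR : 0 < ‖x‖ + 1 := by positivity
  obtain ⟨K, hK0, hK⟩ := h.exists_limit_equicont hv hR
  have hxR : x ∈ halfBall n (‖x‖ + 1) := ⟨hx, by linarith⟩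
  refine ContinuousAt.continuousWithinAt ?_
  have hb : Tendsto (fun y => K * ‖y - x‖ ^ β) (𝓝 x) (𝓝 (K * ‖x - x‖ ^ β)) :=
    ((((continuous_id.sub continuous_const).norm).rpow_const
      fun _ => Or.inr h.beta_pos.le).const_mul K).tendsto x
  rw [sub_self, norm_zero, Real.zero_rpow h.beta_pos.ne', mul_zero] at hb
  refine tendsto_iff_dist_tendsto_zero.2 (squeeze_zero' (Eventually.of_forall fun _ => dist_nonneg)
    ?_ hb)
  filter_upwards [(isOpen_halfBall _).mem_nhds hxR] with y hy
  exact hK y hy x hxR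

lemma limit_nonneg (h : IsPhaseSeq σ β C ρ F P)
    (hv : ∀ x ∈ halfSpace n, Tendsto (fun m => F m x) atTop (𝓝 (v x))) {x : Rn n}
    (hx : x ∈ halfSpace n) : 0 ≤ v x := by
  refine ge_of_tendsto (hv x hx) ?_
  filter_upwards [h.tendsto.eventually_gt_atTop ‖x‖] with m hm
  exact (h.phase m).nonneg x ⟨hx, hm⟩

/-- The functions are uniformly bounded. -/
lemma exists_bound (h : IsPhaseSeq σ β C ρ F P) {R : ℝ} (hR : 0 < R) :
    ∃ A, 0 ≤ A ∧ ∀ᶠ m in atTop, ∀ x ∈ halfBall n R, |F m x| ≤ A := by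
  have hC := h.C_nonneg
  refine ⟨C * R ^ σ * R ^ β, by positivity, ?_⟩
  filter_upwards [h.tendsto.eventually_ge_atTop R] with m hm x hx
  have hx' := halfBall_mono hm hx
  rw [abs_of_nonneg ((h.phase m).nonneg x hx')]
  refine ((h.phase m).le x hx').trans ?_
  have hx0 := hx.1
  have := h.sigma_nonneg
  have := h.beta_pos
  gcongr
  · exact (coord_le_norm x 0).trans hx.2.le
  · exact hx.2.le

lemma eventually_aestronglyMeasurable (h : IsPhaseSeq σ β C ρ F P) (R : ℝ) :
    ∀ᶠ m in atTop, AEStronglyMeasurable (F m) (volume.restrict (halfBall n R)) := by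
  filter_upwards [h.tendsto.eventually_ge_atTop R] with m hm
  exact ((h.phase m).cont.mono (halfBall_mono hm)).aestronglyMeasurable
    (isOpen_halfBall R).measurableSet

/-- Tested with smooth compactly supported functions, the integrals converge both to the weak limit
and, by dominated convergence, to the pointwise one. -/
lemma ae_eq_limit (h : IsPhaseSeq σ β C ρ F P)
    (hv : ∀ x ∈ halfSpace n, Tendsto (fun m => F m x) atTop (𝓝 (v x)))
    (hw : ∀ R : ℝ, 0 < R → WeakL2 (wtMeasure σ (halfBall n R)) F v₀)
    (hv₀ : LocallyIntegrableOn v₀ (halfSpace n)) : v =ᵐ[volume.restrict (halfSpace n)] v₀ := by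
  have hvl : LocallyIntegrableOn v (halfSpace n) :=
    (h.continuousOn_limit hv).locallyIntegrableOn isOpen_halfSpace.measurableSet
  have key := isOpen_halfSpace.ae_eq_zero_of_integral_contDiff_smul_eq_zero (hvl.sub hv₀)
    fun φ hφ hc hs => by
      obtain ⟨R, hR⟩ := hc.isBounded.subset_ball 0
      have hR0 : 0 < max R 1 := lt_max_of_lt_right one_pos
      have hBR : tsupport φ ⊆ halfBall n (max R 1) := fun x hx =>
        ⟨hs hx, (by simpa using hR hx : ‖x‖ < R).trans_le (le_max_left _ _)⟩
      obtain ⟨A, hA⟩ := hc.exists_bound_of_continuous hφ.continuous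
      have hz : ∀ x, x ∉ tsupport φ → φ x = 0 := fun x hx => image_eq_zero_of_notMem_tsupport hx
      have h1 := tendsto_integral_of_weakL2 (hw _ hR0) hφ.continuous.measurable hA hc hBR hz
      obtain ⟨D, hD0, hD⟩ := h.exists_bound hR0
      have h2 : Tendsto (fun m => ∫ x in halfBall n (max R 1), φ x * F m x) atTop
          (𝓝 (∫ x in halfBall n (max R 1), φ x * v x)) := by
        refine tendsto_integral_filter_of_dominated_convergence (fun _ => A * D) ?_ ?_
          (integrableOn_const (volume_halfBall_lt_top _).ne) ?_
        · filter_upwards [h.eventually_aestronglyMeasurable (max R 1)] with m hm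
          exact hφ.continuous.aestronglyMeasurable.mul hm
        · filter_upwards [hD] with m hm
          filter_upwards [ae_mem_halfBall (max R 1)] with x hx
          rw [norm_mul]
          exact mul_le_mul (hA x) (hm x hx) (norm_nonneg _) ((norm_nonneg _).trans (hA x))
        · filter_upwards [ae_mem_halfBall (max R 1)] with x hx
          exact (hv x hx.1).const_mul _
      have hi : ∀ f : Rn n → ℝ, LocallyIntegrableOn f (halfSpace n) →
          Integrable (fun x => φ x * f x) := fun f hf =>
        integrable_smul_of_tsupport_subset hφ.continuous hc hs hf
      have e : ∀ f : Rn n → ℝ, ∫ x in halfBall n (max R 1), φ x * f x = ∫ x, φ x * f x := fun f =>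
        setIntegral_eq_integral_of_forall_compl_eq_zero fun x hx => by
          rw [hz x fun hx' => hx (hBR hx'), zero_mul]
      have h3 := tendsto_nhds_unique h1 h2
      rw [e, e] at h3
      simp only [Pi.sub_apply, smul_eq_mul, mul_sub]
      rw [integral_sub (hi v hvl) (hi v₀ hv₀), h3, sub_self]
  rw [EventuallyEq, ae_restrict_iff' isOpen_halfSpace.measurableSet]
  filter_upwards [key] with x hx hxU
  exact sub_eq_zero.1 (hx hxU)

/-- The Hölder bounds hold up to the axis, so a finite net of the half-ball suffices and the
convergence is uniform on all of it, not only on compact subsets of the half-space. The comparison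
of positivity sets in `eventually_inner_eq` rests on this. -/
lemma tendstoUniformlyOn (h : IsPhaseSeq σ β C ρ F P)
    (hv : ∀ x ∈ halfSpace n, Tendsto (fun m => F m x) atTop (𝓝 (v x))) {R : ℝ} (hR : 0 < R) :
    TendstoUniformlyOn F v atTop (halfBall n R) := by
  rw [Metric.tendstoUniformlyOn_iff]
  intro ε hε
  obtain ⟨K, hK0, hK⟩ := h.exists_equicont hR
  obtain ⟨K', hK0', hK'⟩ := h.exists_limit_equicont hv hR
  obtain ⟨δ, hδ, h1, h2⟩ : ∃ δ > 0, K * δ ^ β < ε / 3 ∧ K' * δ ^ β < ε / 3 := by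
    have ht : ∀ K : ℝ, ∀ᶠ δ in 𝓝[>] (0 : ℝ), K * δ ^ β < ε / 3 := fun K => by
      have ht : Tendsto (fun δ : ℝ => K * δ ^ β) (𝓝[>] 0) (𝓝 (K * 0 ^ β)) :=
        ((Real.continuousAt_rpow_const 0 β (Or.inr h.beta_pos.le)).tendsto.const_mul K).mono_left
          nhdsWithin_le_nhds
      rw [Real.zero_rpow h.beta_pos.ne', mul_zero] at ht
      exact ht.eventually_lt_const (by positivity)
    obtain ⟨δ, h1, h2⟩ := (((ht K).and (ht K')).and self_mem_nhdsWithin).exists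
    exact ⟨δ, h2, h1.1, h1.2⟩
  have htb : TotallyBounded (halfBall n R) :=
    (isCompact_closedBall (0 : Rn n) R).totallyBounded.subset fun x hx => by simpa using hx.2.le
  obtain ⟨t, htR, htf, htc⟩ := Metric.finite_approx_of_totallyBounded htb δ hδ
  have hfin : ∀ᶠ m in atTop, ∀ y ∈ t, dist (F m y) (v y) < ε / 3 :=
    (Filter.eventually_all_finite htf).2 fun y hy =>
      Metric.tendsto_nhds.1 (hv y (htR hy).1) _ (by positivity)
  filter_upwards [hK, hfin] with m hm hf x hx
  obtain ⟨y, hy, hxy⟩ := Set.mem_iUnion₂.1 (htc hx)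
  have hxy' : ‖x - y‖ ^ β ≤ δ ^ β :=
    Real.rpow_le_rpow (norm_nonneg _) (mem_ball_iff_norm.1 hxy).le h.beta_pos.le
  have e1 := (hm.2 x hx y (htR hy)).trans (mul_le_mul_of_nonneg_left hxy' hK0)
  have e2 := (hK' x hx y (htR hy)).trans (mul_le_mul_of_nonneg_left hxy' hK0')
  have e3 := hf y hy
  rw [Real.dist_eq, abs_lt] at *
  rw [abs_le] at e1 e2
  constructor <;> linarith

end IsPhaseSeq

/-! ### Homogeneity of the blow-up limit. -/

namespace IsPhase

variable {σ β C ρ : ℝ} {f v : Rn n → ℝ} {P : Rn n → Rn n}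

/-- The squares of the blow-up on the spheres of radii a and b, normalised by the degree, differ in
L¹ of the half-sphere by at most t⁻¹ times the Euler defect over (r_m a, r_m b) plus t times a
constant. So the difference tends to 0 in L¹, while its pointwise limit is the difference for v. -/
lemma ray_eq_of_tendsto (h : IsPhase σ β C ρ f P) (hβ : 0 < β) (hn : 1 ≤ n) (hρ : 0 < ρ)
    {r : ℕ → ℝ} (hr : ∀ m, 0 < r m) (hr0 : Tendsto r atTop (𝓝 0)) {a b : ℝ} (ha : 0 < a) (hab : a ≤ b)
    (hE : Tendsto (fun m => ∫ s in Set.Ioo (r m * a) (r m * b), 2 * s ^ (-2 * β - n - 1) *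
      sphInt (eulerDensity σ (β + σ) f P) s) atTop (𝓝 0))
    (hv : ∀ x ∈ halfSpace n, Tendsto (fun m => f (r m • x) / r m ^ (β + σ)) atTop (𝓝 (v x)))
    (hvc : ContinuousOn v (halfSpace n)) {y : sphere (0 : Rn n) 1} (hy : y ∈ halfSphere n) :
    b ^ (-2 * (β + σ)) * v (b • (y : Rn n)) ^ 2 = a ^ (-2 * (β + σ)) * v (a • (y : Rn n)) ^ 2 := by
  have hb : 0 < b := ha.trans_le hab
  set K := C ^ 2 * (sphereMeasure n).real Set.univ
  have hK : 0 ≤ K := by positivity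
  set G : ℝ → sphere (0 : Rn n) 1 → ℝ := fun s y => s ^ (-2 * (β + σ)) * f (s • (y : Rn n)) ^ 2 with hG
  have hsmall : ∀ᶠ m in atTop, r m * b < ρ := by
    have : Tendsto (fun m => r m * b) atTop (𝓝 (0 * b)) := hr0.mul_const b
    rw [zero_mul] at this
    exact this.eventually_lt_const hρ
  have hI : Tendsto (fun m => ∫ y, wt σ (y : Rn n) * |G (r m * b) y - G (r m * a) y| ∂sphereMeasure n)
      atTop (𝓝 0) := by
    refine tendsto_order.2 ⟨fun c hc => Eventually.of_forall fun m => hc.trans_le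
      (integral_nonneg_of_ae ?_), fun c hc => ?_⟩
    · filter_upwards [ae_mem_halfSphere] with y hy
      have := wt_pos (σ := σ) hy
      positivity
    -- First t is chosen to make the error term smaller than c; then m is taken so large that the
    -- defect, although divided by t, fits into the rest.
    · obtain ⟨t, ht, htc⟩ : ∃ t > 0, t * K * ((b - a) / a) < c := by
        have h0 : 0 ≤ K * ((b - a) / a) := mul_nonneg hK (div_nonneg (sub_nonneg.2 hab) ha.le)
        refine ⟨c / (K * ((b - a) / a) + 1), by positivity, ?_⟩
        rw [mul_assoc, div_mul_eq_mul_div, div_lt_iff₀ (by positivity)]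
        gcongr; linarith
      have ht' := hE.const_mul t⁻¹
      rw [mul_zero] at ht'
      filter_upwards [ht'.eventually_lt_const (sub_pos.2 htc), hsmall] with m h1 h2
      have h3 := h.integral_abs_ray_sub_le_euler hβ hn (mul_pos (hr m) ha)
        (mul_le_mul_of_nonneg_left hab (hr m).le) h2 ht
      have h4 : (r m * b - r m * a) / (r m * a) = (b - a) / a := by
        have := (hr m).ne'
        field_simp
      rw [h4] at h3
      exact h3.trans_lt (by linarith)
  have hGv : ∀ s, 0 < s → ∀ y ∈ halfSphere n, Tendsto (fun m => G (r m * s) y) atTop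
      (𝓝 (s ^ (-2 * (β + σ)) * v (s • (y : Rn n)) ^ 2)) := by
    intro s hs y hy
    have hx : s • (y : Rn n) ∈ halfSpace n := by
      change 0 < (s • (y : Rn n)) 0
      simpa using mul_pos hs hy
    refine (((hv _ hx).pow 2).const_mul (s ^ (-2 * (β + σ)))).congr fun m => ?_
    simp only [hG]
    rw [Real.mul_rpow (hr m).le hs.le, smul_smul, div_pow, ← Real.rpow_natCast (r m ^ (β + σ)),
      ← Real.rpow_mul (hr m).le, show -2 * (β + σ) = -((β + σ) * (2 : ℕ)) by push_cast; ring,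
      Real.rpow_neg (hr m).le]
    ring
  have hc : ∀ s, 0 < s → ContinuousOn (fun y : sphere (0 : Rn n) 1 =>
      s ^ (-2 * (β + σ)) * v (s • (y : Rn n)) ^ 2) (halfSphere n) := fun s hs =>
    continuousOn_const.mul ((hvc.comp (by fun_prop) fun y hy => by
      change 0 < (s • (y : Rn n)) 0
      simpa using mul_pos hs hy).pow 2)
  have hi : ∀ᶠ m in atTop, Integrable (fun y : sphere (0 : Rn n) 1 =>
      wt σ (y : Rn n) * |G (r m * b) y - G (r m * a) y|) (sphereMeasure n) := by
    filter_upwards [hsmall] with m hm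
    have h1 := (h.integrable_sphere_sq ⟨mul_pos (hr m) hb, hm⟩).const_mul
      ((r m * b) ^ (-2 * (β + σ)))
    have h2 := (h.integrable_sphere_sq ⟨mul_pos (hr m) ha,
      (mul_le_mul_of_nonneg_left hab (hr m).le).trans_lt hm⟩).const_mul ((r m * a) ^ (-2 * (β + σ)))
    refine (h1.sub h2).abs.congr ?_
    filter_upwards [ae_mem_halfSphere] with y hy
    have hw := wt_pos (σ := σ) hy
    simp only [Pi.sub_apply, hG]
    rw [← abs_of_pos hw, ← abs_mul, abs_of_pos hw]
    congr 1; ring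
  have hae : (fun y : sphere (0 : Rn n) 1 => b ^ (-2 * (β + σ)) * v (b • (y : Rn n)) ^ 2)
      =ᵐ[(volume : Measure (Rn n)).toSphere.restrict (halfSphere n)]
      fun y : sphere (0 : Rn n) 1 => a ^ (-2 * (β + σ)) * v (a • (y : Rn n)) ^ 2 := by
    have h1 : Tendsto (fun m => eLpNorm (fun y : sphere (0 : Rn n) 1 =>
        wt σ (y : Rn n) * |G (r m * b) y - G (r m * a) y| - 0) 1 (sphereMeasure n)) atTop (𝓝 0) := by
      have h2 := (ENNReal.continuous_ofReal.tendsto 0).comp hI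
      rw [ENNReal.ofReal_zero] at h2
      refine h2.congr' ?_
      filter_upwards [hi] with m hm
      rw [Function.comp_apply, ofReal_integral_eq_lintegral_ofReal hm, eLpNorm_one_eq_lintegral_enorm]
      · refine lintegral_congr_ae ?_
        filter_upwards [ae_mem_halfSphere] with y hy
        have hw := wt_pos (σ := σ) hy
        rw [sub_zero, Real.enorm_of_nonneg (by positivity)]
      · filter_upwards [ae_mem_halfSphere] with y hy
        have hw := wt_pos (σ := σ) hy
        positivity
    -- Integrability is known only from some index on; the shift by N provides it for all indices.
    obtain ⟨N, hN⟩ := eventually_atTop.1 hi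
    have h3 : TendstoInMeasure (sphereMeasure n) (fun m (y : sphere (0 : Rn n) 1) =>
        wt σ (y : Rn n) * |G (r (m + N) * b) y - G (r (m + N) * a) y|) atTop 0 :=
      tendstoInMeasure_of_tendsto_eLpNorm one_ne_zero
        (fun m => (hN (m + N) (Nat.le_add_left _ _)).aestronglyMeasurable) aestronglyMeasurable_const
        ((tendsto_add_atTop_iff_nat N).2 h1)
    obtain ⟨ns, hns, hlim⟩ := h3.exists_seq_tendsto_ae
    change ∀ᵐ y ∂sphereMeasure n, _
    filter_upwards [hlim, ae_mem_halfSphere] with y h4 hy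
    have hw := wt_pos (σ := σ) hy
    have h5 : Tendsto (fun m => wt σ (y : Rn n) * |G (r m * b) y - G (r m * a) y|) atTop
        (𝓝 (wt σ (y : Rn n) * |b ^ (-2 * (β + σ)) * v (b • (y : Rn n)) ^ 2 -
          a ^ (-2 * (β + σ)) * v (a • (y : Rn n)) ^ 2|)) :=
      ((hGv b hb y hy).sub (hGv a ha y hy)).abs.const_mul _
    have h6 := tendsto_nhds_unique h4
      ((h5.comp (tendsto_add_atTop_nat N)).comp hns.tendsto_atTop)
    have h7 := (mul_eq_zero.1 h6.symm).resolve_left hw.ne'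
    exact sub_eq_zero.1 (abs_eq_zero.1 h7)
  -- Both sides are continuous in y, so equality almost everywhere on the open half-sphere is
  -- equality everywhere.
  exact Measure.eqOn_open_of_ae_eq hae isOpen_halfSphere (hc b hb) (hc a ha) hy

lemma homogeneous_of_ray_eq {α : ℝ} (hvn : ∀ x ∈ halfSpace n, 0 ≤ v x)
    (hray : ∀ a b : ℝ, 0 < a → a ≤ b → ∀ y : sphere (0 : Rn n) 1, y ∈ halfSphere n →
      b ^ (-2 * α) * v (b • (y : Rn n)) ^ 2 = a ^ (-2 * α) * v (a • (y : Rn n)) ^ 2)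
    {l : ℝ} (hl : 0 < l) {x : Rn n} (hx : x ∈ halfSpace n) : v (l • x) = l ^ α * v x := by
  have hx0 : 0 < x 0 := hx
  have hxn : 0 < ‖x‖ := norm_pos_iff.2 (by rintro rfl; simp at hx0)
  set y : sphere (0 : Rn n) 1 := ⟨‖x‖⁻¹ • x, by simp [norm_smul, hxn.ne']⟩ with hy
  have hyx : ‖x‖ • (y : Rn n) = x := by
    rw [hy, smul_smul, mul_inv_cancel₀ hxn.ne', one_smul]
  have hyS : y ∈ halfSphere n := by
    change 0 < (‖x‖⁻¹ • x) 0
    simpa using mul_pos (inv_pos.2 hxn) hx0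
  have hray' : ∀ a b : ℝ, 0 < a → 0 < b →
      b ^ (-2 * α) * v (b • (y : Rn n)) ^ 2 = a ^ (-2 * α) * v (a • (y : Rn n)) ^ 2 := by
    intro a b ha hb
    rcases le_total a b with hab | hab
    · exact hray a b ha hab y hyS
    · exact (hray b a hb hab y hyS).symm
  have h1 := hray' ‖x‖ (l * ‖x‖) hxn (mul_pos hl hxn)
  rw [mul_smul, hyx, Real.mul_rpow hl.le hxn.le] at h1
  have hxp := Real.rpow_pos_of_pos hxn (-2 * α)
  have hlp := Real.rpow_pos_of_pos hl α
  have hl2 : l ^ (-2 * α) = (l ^ α * l ^ α)⁻¹ := by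
    rw [← Real.rpow_add hl, ← Real.rpow_neg hl.le]; congr 1; ring
  have hlx : 0 ≤ v (l • x) := hvn _ (by
    change 0 < (l • x) 0
    simpa using mul_pos hl hx0)
  have h2 : v (l • x) ^ 2 = (l ^ α * v x) ^ 2 := by
    rw [hl2] at h1
    field_simp at h1
    linarith
  exact (sq_eq_sq₀ hlx (mul_nonneg hlp.le (hvn x hx))).1 h2

end IsPhase

namespace IsTwoPhase

variable {β C ρ : ℝ} {f g v : Rn n → ℝ} {P Q : Rn n → Rn n}

/-- The integral is M(r_m b) - M(r_m a), and both terms have the same limit. -/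
lemma tendsto_integral_weissDeriv (h : IsTwoPhase β C ρ f P g Q) (hβ : 0 < β) (hn : 1 ≤ n)
    (hρ : 0 < ρ) {r : ℕ → ℝ} (hr : ∀ m, 0 < r m) (hr0 : Tendsto r atTop (𝓝 0)) {a b : ℝ} (ha : 0 < a)
    (hab : a ≤ b) :
    Tendsto (fun m => ∫ s in Set.Ioo (r m * a) (r m * b), weissDeriv β f P g Q s) atTop (𝓝 0) := by
  have hM := h.tendsto_weissFun hβ hn hρ
  have ht : ∀ c, 0 < c → Tendsto (fun m => r m * c) atTop (𝓝[>] 0) := fun c hc =>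
    tendsto_nhdsWithin_iff.2 ⟨by simpa using hr0.mul_const c,
      Eventually.of_forall fun m => mul_pos (hr m) hc⟩
  have h1 := (hM.comp (ht b (ha.trans_le hab))).sub (hM.comp (ht a ha))
  rw [sub_zero] at h1
  refine h1.congr' ?_
  filter_upwards [((ht b (ha.trans_le hab)).mono_right nhdsWithin_le_nhds).eventually_lt_const hρ]
    with m hm
  exact h.weissFun_sub hβ hn (mul_pos (hr m) ha) (mul_le_mul_of_nonneg_left hab (hr m).le) hm

/-- The derivative of M is a sum of two nonnegative defects, so each phase can be treated on its
own. E stands for the defect of either. -/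
lemma tendsto_integral_euler (h : IsTwoPhase β C ρ f P g Q) (hβ : 0 < β) (hn : 1 ≤ n)
    (hρ : 0 < ρ) {r : ℕ → ℝ} (hr : ∀ m, 0 < r m) (hr0 : Tendsto r atTop (𝓝 0)) {a b : ℝ} (ha : 0 < a)
    (hab : a ≤ b) {E : ℝ → ℝ} (hE0 : ∀ s, 0 < s → 0 ≤ E s)
    (hE : ∀ s, 0 < s → 2 * s ^ (-2 * β - n - 1) * E s ≤ weissDeriv β f P g Q s) :
    Tendsto (fun m => ∫ s in Set.Ioo (r m * a) (r m * b), 2 * s ^ (-2 * β - n - 1) * E s)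
      atTop (𝓝 0) := by
  have hpos : ∀ m, ∀ᵐ s ∂(volume.restrict (Set.Ioo (r m * a) (r m * b))), 0 < s := fun m => by
    filter_upwards [ae_restrict_mem measurableSet_Ioo] with s hs
    exact (mul_pos (hr m) ha).trans hs.1
  have hn0 : ∀ m, ∀ᵐ s ∂(volume.restrict (Set.Ioo (r m * a) (r m * b))),
      0 ≤ 2 * s ^ (-2 * β - n - 1) * E s := fun m => by
    filter_upwards [hpos m] with s hs
    have := hE0 s hs
    positivity
  refine squeeze_zero' (Eventually.of_forall fun m => integral_nonneg_of_ae (hn0 m)) ?_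
    (h.tendsto_integral_weissDeriv hβ hn hρ hr hr0 ha hab)
  have ht : Tendsto (fun m => r m * b) atTop (𝓝 0) := by simpa using hr0.mul_const b
  filter_upwards [ht.eventually_lt_const hρ] with m hm
  refine integral_mono_of_nonneg (hn0 m) (h.integrableOn_weissDeriv hβ (mul_pos (hr m) ha) hm.le) ?_
  filter_upwards [hpos m] with s hs using hE s hs

lemma homogeneous_pos (h : IsTwoPhase β C ρ f P g Q) (hβ : 0 < β) (hn : 1 ≤ n)
    (hρ : 0 < ρ) {r : ℕ → ℝ} (hr : ∀ m, 0 < r m) (hr0 : Tendsto r atTop (𝓝 0))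
    (hv : ∀ x ∈ halfSpace n, Tendsto (fun m => f (r m • x) / r m ^ (β + 0)) atTop (𝓝 (v x)))
    (hvc : ContinuousOn v (halfSpace n)) (hvn : ∀ x ∈ halfSpace n, 0 ≤ v x) {l : ℝ} (hl : 0 < l)
    {x : Rn n} (hx : x ∈ halfSpace n) : v (l • x) = l ^ (β + 0) * v x := by
  refine IsPhase.homogeneous_of_ray_eq hvn (fun a b ha hab y hy =>
    h.pos.ray_eq_of_tendsto hβ hn hρ hr hr0 ha hab (h.tendsto_integral_euler hβ hn hρ hr hr0 ha hab
      (fun s hs => IsPhase.sphInt_eulerDensity_nonneg 0 _ f P hs) fun s hs => ?_) hv hvc hy) hl hx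
  have := IsPhase.sphInt_eulerDensity_nonneg 1 (β + 1) g Q hs
  rw [weissDeriv, add_zero]
  gcongr
  linarith

lemma homogeneous_neg (h : IsTwoPhase β C ρ f P g Q) (hβ : 0 < β) (hn : 1 ≤ n)
    (hρ : 0 < ρ) {r : ℕ → ℝ} (hr : ∀ m, 0 < r m) (hr0 : Tendsto r atTop (𝓝 0))
    (hv : ∀ x ∈ halfSpace n, Tendsto (fun m => g (r m • x) / r m ^ (β + 1)) atTop (𝓝 (v x)))
    (hvc : ContinuousOn v (halfSpace n)) (hvn : ∀ x ∈ halfSpace n, 0 ≤ v x) {l : ℝ} (hl : 0 < l)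
    {x : Rn n} (hx : x ∈ halfSpace n) : v (l • x) = l ^ (β + 1) * v x := by
  refine IsPhase.homogeneous_of_ray_eq hvn (fun a b ha hab y hy =>
    h.neg.ray_eq_of_tendsto hβ hn hρ hr hr0 ha hab (h.tendsto_integral_euler hβ hn hρ hr hr0 ha hab
      (fun s hs => IsPhase.sphInt_eulerDensity_nonneg 1 _ g Q hs) fun s hs => ?_) hv hvc hy) hl hx
  have := IsPhase.sphInt_eulerDensity_nonneg 0 β f P hs
  rw [weissDeriv]
  gcongr
  linarith

end IsTwoPhase

/-! ### Strong convergence of the gradients. -/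

lemma memLp_rpow_coord (σ : ℝ) {c : ℝ} (hc : -1 < 1 - 2 * σ + 2 * c) (K R : ℝ) :
    MemLp (fun x : Rn n => K * x 0 ^ c) 2 (wtMeasure σ (halfBall n R)) := by
  have hm : Measurable fun x : Rn n => K * x 0 ^ c :=
    ((by fun_prop : Measurable fun t : ℝ => K * t ^ c)).comp (continuous_coord 0).measurable
  rw [memLp_two_iff_integrable_sq hm.aestronglyMeasurable, integrable_wtMeasure_iff]
  refine integrableOn_of_le_rpow (K := K ^ 2) hc
    ((measurable_wt σ).mul (hm.pow_const 2)).aestronglyMeasurable fun x hx => ?_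
  have hw := wt_pos (σ := σ) hx.1
  rw [abs_of_nonneg (by positivity), wt, mul_pow, ← Real.rpow_natCast (x 0 ^ c),
    ← Real.rpow_mul hx.1.le, mul_left_comm, ← Real.rpow_add hx.1]
  refine le_of_eq ?_
  congr 2; push_cast; ring

/-- A weakly convergent factor times one that converges pointwise under an L² majorant. Writing D_m
= D₀ + (D_m - D₀), the first part is weak convergence, and the second is dominated convergence with
the common majorant b of the P_m. -/
lemma tendsto_integral_inner {μ : Measure (Rn n)} {P D : ℕ → Rn n → Rn n} {G D₀ : Rn n → Rn n}
    {b Θ : Rn n → ℝ} (hb : MemLp b 2 μ) (hΘ : MemLp Θ 2 μ)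
    (hP : ∀ᶠ m in atTop, AEStronglyMeasurable (P m) μ) (hPb : ∀ᶠ m in atTop, ∀ᵐ x ∂μ, ‖P m x‖ ≤ b x)
    (hD : ∀ᶠ m in atTop, AEStronglyMeasurable (D m) μ) (hDΘ : ∀ᶠ m in atTop, ∀ᵐ x ∂μ, ‖D m x‖ ≤ Θ x)
    (hD₀ : AEStronglyMeasurable D₀ μ) (hD₀Θ : ∀ᵐ x ∂μ, ‖D₀ x‖ ≤ Θ x)
    (hlim : ∀ᵐ x ∂μ, Tendsto (fun m => D m x) atTop (𝓝 (D₀ x))) (hG : WeakL2 μ P G) :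
    Tendsto (fun m => ∫ x, inner ℝ (P m x) (D m x) ∂μ) atTop (𝓝 (∫ x, inner ℝ (G x) (D₀ x) ∂μ)) := by
  have hbΘ : Integrable (fun x => b x * (2 * Θ x)) μ := hb.integrable_mul (hΘ.const_mul 2)
  have h1 := hG D₀ (hΘ.mono' hD₀ hD₀Θ)
  have h2 : Tendsto (fun m => ∫ x, inner ℝ (P m x) (D m x - D₀ x) ∂μ) atTop (𝓝 (∫ _, (0 : ℝ) ∂μ)) := by
    refine tendsto_integral_filter_of_dominated_convergence _ ?_ ?_ hbΘ ?_
    · filter_upwards [hP, hD] with m h3 h4 using h3.inner (h4.sub hD₀)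
    · filter_upwards [hPb, hDΘ] with m h3 h4
      filter_upwards [h3, h4, hD₀Θ] with x h5 h6 h7
      refine (norm_inner_le_norm _ _).trans (mul_le_mul h5 ?_ (norm_nonneg _) ((norm_nonneg _).trans h5))
      exact (norm_sub_le _ _).trans (by linarith)
    · have h3 : ∀ᵐ x ∂μ, ∀ᶠ m in atTop, ‖P m x‖ ≤ b x := by
        obtain ⟨N, hN⟩ := eventually_atTop.1 hPb
        filter_upwards [ae_all_iff.2 fun m : ℕ => hN (m + N) (Nat.le_add_left _ _)] with x hx
        refine eventually_atTop.2 ⟨N, fun m hm => ?_⟩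
        have := hx (m - N)
        rwa [Nat.sub_add_cancel hm] at this
      filter_upwards [hlim, h3] with x h4 h5
      have h6 : Tendsto (fun m => b x * ‖D m x - D₀ x‖) atTop (𝓝 (b x * ‖D₀ x - D₀ x‖)) :=
        ((h4.sub_const _).norm).const_mul _
      rw [sub_self, norm_zero, mul_zero] at h6
      refine squeeze_zero_norm' ?_ h6
      filter_upwards [h5] with m hm
      exact (norm_inner_le_norm _ _).trans (by gcongr)
  rw [integral_zero] at h2
  have h3 := h2.add h1
  rw [zero_add] at h3
  refine h3.congr' ?_
  filter_upwards [hP, hPb, hD, hDΘ] with m e1 e2 e3 e4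
  have i1 : ∀ D' : Rn n → Rn n, AEStronglyMeasurable D' μ → (∀ᵐ x ∂μ, ‖D' x‖ ≤ 2 * Θ x) →
      Integrable (fun x => inner ℝ (P m x) (D' x)) μ := fun D' h5 h6 => by
    refine hbΘ.mono' (e1.inner h5) ?_
    filter_upwards [e2, h6] with x h7 h8
    exact (norm_inner_le_norm _ _).trans (mul_le_mul h7 h8 (norm_nonneg _) ((norm_nonneg _).trans h7))
  rw [← integral_add]
  · refine integral_congr_ae (ae_of_all _ fun x => ?_)
    simp only [inner_sub_right]; ring
  · refine i1 _ (e3.sub hD₀) ?_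
    filter_upwards [e4, hD₀Θ] with x h6 h7
    exact (norm_sub_le _ _).trans (by linarith)
  · refine i1 _ hD₀ ?_
    filter_upwards [hD₀Θ] with x h7
    have := (norm_nonneg _).trans h7
    linarith

lemma weakL2_const {μ : Measure (Rn n)} (G : Rn n → Rn n) : WeakL2 μ (fun _ : ℕ => G) G :=
  fun _ _ => tendsto_const_nhds

lemma strongL2_of_tendsto_integral {F : Type*} [NormedAddCommGroup F] [InnerProductSpace ℝ F]
    {μ : Measure (Rn n)} {f : ℕ → Rn n → F} {f₀ : Rn n → F}
    (hm : ∀ᶠ m in atTop, MemLp (fun x => f m x - f₀ x) 2 μ)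
    (h : Tendsto (fun m => ∫ x, ‖f m x - f₀ x‖ ^ 2 ∂μ) atTop (𝓝 0)) : StrongL2 μ f f₀ := by
  have h1 : Tendsto (fun m => ENNReal.ofReal ((∫ x, ‖f m x - f₀ x‖ ^ 2 ∂μ) ^ ((2 : ℝ)⁻¹))) atTop
      (𝓝 (ENNReal.ofReal (0 ^ ((2 : ℝ)⁻¹)))) :=
    (ENNReal.continuous_ofReal.tendsto _).comp
      ((Real.continuousAt_rpow_const 0 _ (Or.inr (by norm_num))).tendsto.comp h)
  rw [Real.zero_rpow (by norm_num), ENNReal.ofReal_zero] at h1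
  refine h1.congr' ?_
  filter_upwards [hm] with m hm
  rw [hm.eLpNorm_eq_integral_rpow_norm two_ne_zero ENNReal.ofNat_ne_top]
  simp

/-- The gradient of a test function. -/
def testGrad (η : Rn n → ℝ) (x : Rn n) : Rn n := (InnerProductSpace.toDual ℝ (Rn n)).symm (fderiv ℝ η x)

lemma inner_testGrad (η : Rn n → ℝ) (x v : Rn n) : inner ℝ v (testGrad η x) = fderiv ℝ η x v := by
  rw [testGrad, real_inner_comm, InnerProductSpace.toDual_symm_apply]

lemma norm_testGrad (η : Rn n → ℝ) (x : Rn n) : ‖testGrad η x‖ = ‖fderiv ℝ η x‖ := by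
  rw [testGrad, LinearIsometryEquiv.norm_map]

lemma continuous_testGrad {η : Rn n → ℝ} (hη : ContDiff ℝ 1 η) : Continuous (testGrad η) :=
  (InnerProductSpace.toDual ℝ (Rn n)).symm.continuous.comp (hη.continuous_fderiv one_ne_zero)

namespace IsPhaseSeq

variable {σ β C : ℝ} {ρ : ℕ → ℝ} {F : ℕ → Rn n → ℝ} {P : ℕ → Rn n → Rn n} {v : Rn n → ℝ}
  {G : Rn n → Rn n}

lemma memLp_grad_bound (h : IsPhaseSeq σ β C ρ F P) (R : ℝ) :
    MemLp (fun x : Rn n => C * x 0 ^ (β + σ - 1)) 2 (wtMeasure σ (halfBall n R)) :=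
  memLp_rpow_coord σ (by linarith [h.beta_pos]) C R

lemma memLp_bound (K R : ℝ) :
    MemLp (fun x : Rn n => K * x 0 ^ σ) 2 (wtMeasure σ (halfBall n R)) :=
  memLp_rpow_coord σ (by linarith) K R

lemma ae_mem (σ R : ℝ) : ∀ᵐ x ∂(wtMeasure σ (halfBall n R)), x ∈ halfBall n R :=
  (wtMeasure_ac σ R).ae_le (ae_mem_halfBall R)

lemma eventually_phase (h : IsPhaseSeq σ β C ρ F P) (R : ℝ) :
    ∀ᶠ m in atTop, IsPhase σ β C R (F m) (P m) := by
  filter_upwards [h.tendsto.eventually_ge_atTop R] with m hm using (h.phase m).mono hm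

lemma phase_le {f : Rn n → ℝ} {P : Rn n → Rn n} {R : ℝ} (h : IsPhase σ β C R f P) (hβ : 0 < β) {x : Rn n}
    (hx : x ∈ halfBall n R) : f x ≤ C * R ^ β * x 0 ^ σ := by
  have hC := h.C_nonneg
  have hx0 := hx.1
  refine (h.le x hx).trans ?_
  rw [mul_right_comm]
  gcongr
  exact hx.2.le

lemma limit_le (h : IsPhaseSeq σ β C ρ F P)
    (hv : ∀ x ∈ halfSpace n, Tendsto (fun m => F m x) atTop (𝓝 (v x))) {R : ℝ} {x : Rn n}
    (hx : x ∈ halfBall n R) : v x ≤ C * R ^ β * x 0 ^ σ := by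
  refine le_of_tendsto (hv x hx.1) ?_
  filter_upwards [h.eventually_phase R] with m hm using phase_le hm h.beta_pos hx

lemma strongL2 (h : IsPhaseSeq σ β C ρ F P)
    (hv : ∀ x ∈ halfSpace n, Tendsto (fun m => F m x) atTop (𝓝 (v x))) (R : ℝ) :
    StrongL2 (wtMeasure σ (halfBall n R)) F v := by
  have hvm : AEStronglyMeasurable v (wtMeasure σ (halfBall n R)) :=
    (((h.continuousOn_limit hv).mono (halfBall_subset_halfSpace R)).aestronglyMeasurable
      (isOpen_halfBall R).measurableSet).mono_ac (wtMeasure_ac σ R)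
  have hFm : ∀ᶠ m in atTop, AEStronglyMeasurable (F m) (wtMeasure σ (halfBall n R)) := by
    filter_upwards [h.eventually_phase R] with m hm
    exact (hm.aestronglyMeasurable (isOpen_halfBall R)).mono_ac (wtMeasure_ac σ R)
  have hL := memLp_bound (n := n) (σ := σ) (C * R ^ β) R
  have hle : ∀ᶠ m in atTop, ∀ᵐ x ∂(wtMeasure σ (halfBall n R)), ‖F m x - v x‖ ≤ C * R ^ β * x 0 ^ σ := by
    filter_upwards [h.eventually_phase R] with m hm
    filter_upwards [ae_mem σ R] with x hx
    have h1 := phase_le hm h.beta_pos hx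
    have h2 := h.limit_le hv hx
    have h3 := hm.nonneg x hx
    have h4 := h.limit_nonneg hv hx.1
    rw [Real.norm_eq_abs, abs_le]
    constructor <;> linarith
  refine strongL2_of_tendsto_integral ?_ ?_
  · filter_upwards [hFm, hle] with m h1 h2
    exact hL.mono' (h1.sub hvm) h2
  · have h0 : ∫ _, (0 : ℝ) ∂(wtMeasure σ (halfBall n R)) = 0 := integral_zero _ _
    rw [← h0]
    refine tendsto_integral_filter_of_dominated_convergence _ ?_ ?_ hL.integrable_sq ?_
    · filter_upwards [hFm] with m h1
      exact ((h1.sub hvm).norm.pow 2)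
    · filter_upwards [hle] with m h1
      filter_upwards [h1] with x hx
      rw [norm_pow, norm_norm]
      gcongr
    · filter_upwards [ae_mem σ R] with x hx
      have := ((hv x hx.1).sub_const (v x)).norm.pow 2
      simpa using this

/-- The index k is frozen and the equation of F_m is tested with η · trunc ε(F_k). This is linear in
P_m and contains no other quantity that depends on m, so weak convergence is enough to let m tend to
infinity. Testing with a truncation of F_m itself would produce a product of two weakly convergent
gradients. -/
lemma eventually_inner_eq (h : IsPhaseSeq σ β C ρ F P)
    (hv : ∀ x ∈ halfSpace n, Tendsto (fun m => F m x) atTop (𝓝 (v x))) {R R' : ℝ} (hR : 0 < R)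
    (hR' : R' < R) {η : Rn n → ℝ} (hη : ContDiff ℝ 1 η) (hηR : ∀ x, R' ≤ ‖x‖ → η x = 0)
    (hG : WeakL2 (wtMeasure σ (halfBall n R)) P G) {ε : ℝ} (hε : 0 < ε) :
    ∀ᶠ k in atTop, ∫ x, inner ℝ (P k x) ((η x * truncDeriv ε (F k x)) • G x) ∂wtMeasure σ (halfBall n R) =
      -∫ x, inner ℝ (G x) (trunc ε (F k x) • testGrad η x) ∂wtMeasure σ (halfBall n R) := by
  have hu := Metric.tendstoUniformlyOn_iff.1 (h.tendstoUniformlyOn hv hR) (ε / 4) (by positivity)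
  have hβ := h.beta_pos
  obtain ⟨A, hA0, hA, hA'⟩ := exists_bound_test hη hηR
  filter_upwards [hu, h.eventually_phase R] with k hk hkp
  have hU := isOpen_halfBall (n := n) R
  have hFm := (hkp.aestronglyMeasurable hU).mono_ac (wtMeasure_ac σ R)
  have hPm := (hkp.aestronglyMeasurable_grad hU).mono_ac (wtMeasure_ac σ R)
  have m1 : MemLp (fun x => (η x * truncDeriv ε (F k x)) • P k x) 2 (wtMeasure σ (halfBall n R)) := by
    refine ((h.memLp_grad_bound R).const_mul A).mono' ((hη.continuous.aestronglyMeasurable.mul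
      ((continuous_truncDeriv hε).comp_aestronglyMeasurable hFm)).smul hPm) ?_
    filter_upwards [ae_mem σ R] with x hx
    rw [norm_smul, norm_mul]
    have h1 := hA x
    have h2 := abs_truncDeriv_le hε (F k x)
    calc _ ≤ A * 1 * (C * x 0 ^ (β + σ - 1)) := by
          gcongr
          · exact h1
          · exact h2
          · exact hkp.grad_le x hx
      _ = _ := by ring
  have m2 : MemLp (fun x => trunc ε (F k x) • testGrad η x) 2 (wtMeasure σ (halfBall n R)) := by
    refine ((memLp_bound (n := n) (σ := σ) (C * R ^ β) R).const_mul A).mono'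
      (((continuous_trunc hε).comp_aestronglyMeasurable hFm).smul
        (continuous_testGrad hη).aestronglyMeasurable) ?_
    filter_upwards [ae_mem σ R] with x hx
    rw [norm_smul, mul_comm, norm_testGrad]
    have h1 := (abs_trunc_le hε (hkp.nonneg x hx)).trans (phase_le hkp hβ hx)
    exact mul_le_mul (hA' x) h1 (norm_nonneg _) hA0
  have t1 := hG _ m1
  have t2 := (hG _ m2).neg
  have key : ∀ᶠ m in atTop, ∫ x, inner ℝ (P m x) ((η x * truncDeriv ε (F k x)) • P k x)
      ∂wtMeasure σ (halfBall n R) =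
      -∫ x, inner ℝ (P m x) (trunc ε (F k x) • testGrad η x) ∂wtMeasure σ (halfBall n R) := by
    filter_upwards [hu, h.eventually_phase R] with m hm hmp
    -- F_k and F_m are both within ε/4 of the limit, so F_m > ε/2 where F_k > ε. This is the
    -- admissibility condition, with δ = ε/2.
    have h1 := hmp.integral_inner_eq hkp hβ hη hR' hηR hε (half_pos hε) fun x hx _ hxε => by
      have h2 := hk x hx
      have h3 := hm x hx
      rw [Real.dist_eq, abs_lt] at h2 h3
      linarith
    rw [integral_wtMeasure, integral_wtMeasure]
    convert h1 using 1
    · refine integral_congr_ae (ae_of_all _ fun x => ?_)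
      simp only [inner_smul_right]; ring
    · congr 1
      refine integral_congr_ae (ae_of_all _ fun x => ?_)
      simp only [inner_smul_right, inner_testGrad]; ring
  have h5 := tendsto_nhds_unique (t1.congr' key) t2
  rw [← h5]
  refine integral_congr_ae (ae_of_all _ fun x => ?_)
  simp only [inner_smul_right, real_inner_comm]

end IsPhaseSeq

namespace IsPhaseSeq

variable {σ β C : ℝ} {ρ : ℕ → ℝ} {F : ℕ → Rn n → ℝ} {P : ℕ → Rn n → Rn n} {v : Rn n → ℝ}
  {G : Rn n → Rn n} {R R' : ℝ} {η : Rn n → ℝ}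

lemma aestronglyMeasurable_limit (h : IsPhaseSeq σ β C ρ F P)
    (hv : ∀ x ∈ halfSpace n, Tendsto (fun m => F m x) atTop (𝓝 (v x))) (R : ℝ) :
    AEStronglyMeasurable v (wtMeasure σ (halfBall n R)) :=
  (((h.continuousOn_limit hv).mono (halfBall_subset_halfSpace R)).aestronglyMeasurable
    (isOpen_halfBall R).measurableSet).mono_ac (wtMeasure_ac σ R)

lemma eventually_aesm (h : IsPhaseSeq σ β C ρ F P) (R : ℝ) :
    ∀ᶠ m in atTop, AEStronglyMeasurable (F m) (wtMeasure σ (halfBall n R)) := by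
  filter_upwards [h.eventually_phase R] with m hm
  exact (hm.aestronglyMeasurable (isOpen_halfBall R)).mono_ac (wtMeasure_ac σ R)

lemma eventually_aesm_grad (h : IsPhaseSeq σ β C ρ F P) (R : ℝ) :
    ∀ᶠ m in atTop, AEStronglyMeasurable (P m) (wtMeasure σ (halfBall n R)) := by
  filter_upwards [h.eventually_phase R] with m hm
  exact (hm.aestronglyMeasurable_grad (isOpen_halfBall R)).mono_ac (wtMeasure_ac σ R)

lemma eventually_grad_le (h : IsPhaseSeq σ β C ρ F P) (R : ℝ) :
    ∀ᶠ m in atTop, ∀ᵐ x ∂wtMeasure σ (halfBall n R), ‖P m x‖ ≤ C * x 0 ^ (β + σ - 1) := by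
  filter_upwards [h.eventually_phase R] with m hm
  filter_upwards [ae_mem σ R] with x hx using hm.grad_le x hx

/-- Now k tends to infinity. One factor G is already the limit, so P_k is the only gradient that
still converges merely weakly. -/
lemma limit_inner_eq_trunc (h : IsPhaseSeq σ β C ρ F P)
    (hv : ∀ x ∈ halfSpace n, Tendsto (fun m => F m x) atTop (𝓝 (v x))) (hR : 0 < R)
    (hR' : R' < R) (hη : ContDiff ℝ 1 η) (hηR : ∀ x, R' ≤ ‖x‖ → η x = 0)
    (hG2 : MemLp G 2 (wtMeasure σ (halfBall n R)))
    (hG : WeakL2 (wtMeasure σ (halfBall n R)) P G) {ε : ℝ} (hε : 0 < ε) :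
    ∫ x, inner ℝ (G x) ((η x * truncDeriv ε (v x)) • G x) ∂wtMeasure σ (halfBall n R) =
      -∫ x, inner ℝ (G x) (trunc ε (v x) • testGrad η x) ∂wtMeasure σ (halfBall n R) := by
  obtain ⟨A, hA0, hA, hA'⟩ := exists_bound_test hη hηR
  have hβ := h.beta_pos
  have hvm := h.aestronglyMeasurable_limit hv R
  have hGm := hG2.aestronglyMeasurable
  have b1 : ∀ t x, ‖(η x * truncDeriv ε t) • G x‖ ≤ A * ‖G x‖ := fun t x => by
    rw [norm_smul, norm_mul]
    calc _ ≤ A * 1 * ‖G x‖ := by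
          gcongr
          · exact hA x
          · exact abs_truncDeriv_le hε t
      _ = _ := by ring
  have b2 : ∀ t x, 0 ≤ t → t ≤ C * R ^ β * x 0 ^ σ →
      ‖trunc ε t • testGrad η x‖ ≤ A * (C * R ^ β * x 0 ^ σ) := fun t x h0 ht => by
    rw [norm_smul, mul_comm, norm_testGrad]
    exact mul_le_mul (hA' x) ((abs_trunc_le hε h0).trans ht) (norm_nonneg _) hA0
  have t1 := tendsto_integral_inner (h.memLp_grad_bound R) (hG2.norm.const_mul A)
    (h.eventually_aesm_grad R) (h.eventually_grad_le R)
    (D := fun k x => (η x * truncDeriv ε (F k x)) • G x)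
    (D₀ := fun x => (η x * truncDeriv ε (v x)) • G x)
    (by
      filter_upwards [h.eventually_aesm R] with k hk
      exact (hη.continuous.aestronglyMeasurable.mul
        ((continuous_truncDeriv hε).comp_aestronglyMeasurable hk)).smul hGm)
    (Eventually.of_forall fun k => ae_of_all _ fun x => b1 _ x)
    ((hη.continuous.aestronglyMeasurable.mul
      ((continuous_truncDeriv hε).comp_aestronglyMeasurable hvm)).smul hGm)
    (ae_of_all _ fun x => b1 _ x)
    (by
      filter_upwards [ae_mem σ R] with x hx
      exact ((((continuous_truncDeriv hε).tendsto _).comp (hv x hx.1)).const_mul _).smul_const _) hG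
  have t2 := tendsto_integral_inner (P := fun _ => G) hG2.norm
    ((memLp_bound (n := n) (σ := σ) (C * R ^ β) R).const_mul A)
    (Eventually.of_forall fun _ => hGm) (Eventually.of_forall fun _ => ae_of_all _ fun _ => le_rfl)
    (D := fun k x => trunc ε (F k x) • testGrad η x)
    (D₀ := fun x => trunc ε (v x) • testGrad η x)
    (by
      filter_upwards [h.eventually_aesm R] with k hk
      exact ((continuous_trunc hε).comp_aestronglyMeasurable hk).smul
        (continuous_testGrad hη).aestronglyMeasurable)
    (by
      filter_upwards [h.eventually_phase R] with k hk
      filter_upwards [ae_mem σ R] with x hx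
      exact b2 _ x (hk.nonneg x hx) (phase_le hk hβ hx))
    (((continuous_trunc hε).comp_aestronglyMeasurable hvm).smul
        (continuous_testGrad hη).aestronglyMeasurable)
    (by
      filter_upwards [ae_mem σ R] with x hx
      exact b2 _ x (h.limit_nonneg hv hx.1) (h.limit_le hv hx))
    (by
      filter_upwards [ae_mem σ R] with x hx
      exact (((continuous_trunc hε).tendsto _).comp (hv x hx.1)).smul_const _) (weakL2_const G)
  exact tendsto_nhds_unique (t1.congr' (h.eventually_inner_eq hv hR hR' hη hηR hG hε)) t2.neg

/-- The truncation level tends to 0 and its derivative becomes the indicator of {v > 0}. That G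
vanishes on {v = 0} is neither claimed nor needed. -/
lemma limit_inner_eq (h : IsPhaseSeq σ β C ρ F P)
    (hv : ∀ x ∈ halfSpace n, Tendsto (fun m => F m x) atTop (𝓝 (v x))) (hR : 0 < R)
    (hR' : R' < R) (hη : ContDiff ℝ 1 η) (hηR : ∀ x, R' ≤ ‖x‖ → η x = 0)
    (hG2 : MemLp G 2 (wtMeasure σ (halfBall n R)))
    (hG : WeakL2 (wtMeasure σ (halfBall n R)) P G) :
    ∫ x, inner ℝ (G x) ((η x * (Set.Ioi (0 : ℝ)).indicator 1 (v x)) • G x) ∂wtMeasure σ (halfBall n R) =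
      -∫ x, inner ℝ (G x) (v x • testGrad η x) ∂wtMeasure σ (halfBall n R) := by
  obtain ⟨A, hA0, hA, hA'⟩ := exists_bound_test hη hηR
  have hk : ∀ k : ℕ, (0 : ℝ) < 1 / (k + 1) := fun k => by positivity
  have hvm := h.aestronglyMeasurable_limit hv R
  have hGm := hG2.aestronglyMeasurable
  have hone : ∀ t : ℝ, |(Set.Ioi (0 : ℝ)).indicator (1 : ℝ → ℝ) t| ≤ 1 := fun t => by
    by_cases ht : t ∈ Set.Ioi (0 : ℝ) <;> simp [ht]
  have b1 : ∀ s x, |s| ≤ 1 → ‖(η x * s) • G x‖ ≤ A * ‖G x‖ := fun s x hs => by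
    rw [norm_smul, norm_mul]
    calc _ ≤ A * 1 * ‖G x‖ := by
          gcongr
          · exact hA x
          · exact hs
      _ = _ := by ring
  have b2 : ∀ s x, |s| ≤ C * R ^ β * x 0 ^ σ → ‖s • testGrad η x‖ ≤ A * (C * R ^ β * x 0 ^ σ) :=
    fun s x hs => by
      rw [norm_smul, mul_comm, norm_testGrad]
      exact mul_le_mul (hA' x) hs (norm_nonneg _) hA0
  have t1 := tendsto_integral_inner (P := fun _ => G) hG2.norm (hG2.norm.const_mul A)
    (Eventually.of_forall fun _ => hGm) (Eventually.of_forall fun _ => ae_of_all _ fun _ => le_rfl)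
    (D := fun k x => (η x * truncDeriv (1 / (k + 1)) (v x)) • G x)
    (D₀ := fun x => (η x * (Set.Ioi (0 : ℝ)).indicator 1 (v x)) • G x)
    (Eventually.of_forall fun k => (hη.continuous.aestronglyMeasurable.mul
        ((continuous_truncDeriv (hk k)).comp_aestronglyMeasurable hvm)).smul hGm)
    (Eventually.of_forall fun k => ae_of_all _ fun x => b1 _ x (abs_truncDeriv_le (hk k) _))
    ((hη.continuous.aestronglyMeasurable.mul
      ((measurable_one.indicator measurableSet_Ioi).comp_aemeasurable
        hvm.aemeasurable).aestronglyMeasurable).smul hGm)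
    (ae_of_all _ fun x => b1 _ x (hone _))
    (by
      filter_upwards [ae_mem σ R] with x hx
      refine (Tendsto.const_mul _ ?_).smul_const _
      rcases (h.limit_nonneg hv hx.1).eq_or_lt with h0 | h0
      · rw [← h0, Set.indicator_of_notMem (by simp)]
        exact tendsto_const_nhds.congr fun k => (truncDeriv_of_le (hk k) (hk k).le).symm
      · rw [Set.indicator_of_mem (Set.mem_Ioi.2 h0)]
        exact tendsto_truncDeriv h0) (weakL2_const G)
  have t2 := tendsto_integral_inner (P := fun _ => G) hG2.norm
    ((memLp_bound (n := n) (σ := σ) (C * R ^ β) R).const_mul A)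
    (Eventually.of_forall fun _ => hGm) (Eventually.of_forall fun _ => ae_of_all _ fun _ => le_rfl)
    (D := fun k x => trunc (1 / (k + 1)) (v x) • testGrad η x)
    (D₀ := fun x => v x • testGrad η x)
    (Eventually.of_forall fun k => ((continuous_trunc (hk k)).comp_aestronglyMeasurable hvm).smul
        (continuous_testGrad hη).aestronglyMeasurable)
    (Eventually.of_forall fun k => by
      filter_upwards [ae_mem σ R] with x hx
      exact b2 _ x ((abs_trunc_le (hk k) (h.limit_nonneg hv hx.1)).trans (h.limit_le hv hx)))
    (hvm.smul (continuous_testGrad hη).aestronglyMeasurable)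
    (by
      filter_upwards [ae_mem σ R] with x hx
      refine b2 _ x ?_
      rw [abs_of_nonneg (h.limit_nonneg hv hx.1)]
      exact h.limit_le hv hx)
    (by
      filter_upwards [ae_mem σ R] with x hx
      exact (tendsto_trunc (h.limit_nonneg hv hx.1)).smul_const _) (weakL2_const G)
  exact tendsto_nhds_unique (t1.congr fun k => h.limit_inner_eq_trunc hv hR hR' hη hηR hG2 hG (hk k))
    t2.neg

/-- By `integral_energy_eq` the energy of F_m is an integral with a single gradient factor, and it
converges to the right-hand side of `limit_inner_eq`. -/
lemma tendsto_energy (h : IsPhaseSeq σ β C ρ F P)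
    (hv : ∀ x ∈ halfSpace n, Tendsto (fun m => F m x) atTop (𝓝 (v x)))
    (hR' : R' < R) (hη : ContDiff ℝ 1 η) (hηR : ∀ x, R' ≤ ‖x‖ → η x = 0)
    (hG : WeakL2 (wtMeasure σ (halfBall n R)) P G) :
    Tendsto (fun m => ∫ x, η x * ‖P m x‖ ^ 2 ∂wtMeasure σ (halfBall n R)) atTop
      (𝓝 (-∫ x, inner ℝ (G x) (v x • testGrad η x) ∂wtMeasure σ (halfBall n R))) := by
  obtain ⟨A, hA0, hA, hA'⟩ := exists_bound_test hη hηR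
  have hβ := h.beta_pos
  have b2 : ∀ s x, |s| ≤ C * R ^ β * x 0 ^ σ → ‖s • testGrad η x‖ ≤ A * (C * R ^ β * x 0 ^ σ) :=
    fun s x hs => by
      rw [norm_smul, mul_comm, norm_testGrad]
      exact mul_le_mul (hA' x) hs (norm_nonneg _) hA0
  have t2 := tendsto_integral_inner (h.memLp_grad_bound R)
    ((memLp_bound (n := n) (σ := σ) (C * R ^ β) R).const_mul A)
    (h.eventually_aesm_grad R) (h.eventually_grad_le R)
    (D := fun k x => F k x • testGrad η x)
    (D₀ := fun x => v x • testGrad η x)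
    (by
      filter_upwards [h.eventually_aesm R] with k hk
      exact hk.smul (continuous_testGrad hη).aestronglyMeasurable)
    (by
      filter_upwards [h.eventually_phase R] with k hk
      filter_upwards [ae_mem σ R] with x hx
      refine b2 _ x ?_
      rw [abs_of_nonneg (hk.nonneg x hx)]
      exact phase_le hk hβ hx)
    ((h.aestronglyMeasurable_limit hv R).smul (continuous_testGrad hη).aestronglyMeasurable)
    (by
      filter_upwards [ae_mem σ R] with x hx
      refine b2 _ x ?_
      rw [abs_of_nonneg (h.limit_nonneg hv hx.1)]
      exact h.limit_le hv hx)
    (by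
      filter_upwards [ae_mem σ R] with x hx
      exact (hv x hx.1).smul_const _) hG
  refine t2.neg.congr' ?_
  filter_upwards [h.eventually_phase R] with m hm
  rw [integral_wtMeasure, integral_wtMeasure]
  have h1 := hm.integral_energy_eq hβ hη hR' hηR
  convert h1.symm using 1
  · congr 1
    refine integral_congr_ae (ae_of_all _ fun x => ?_)
    simp only [inner_smul_right, inner_testGrad]; ring
  · refine integral_congr_ae (ae_of_all _ fun x => ?_)
    ring

/-- The cut-off energies converge to the energy of G on {v > 0}, which is at most the full energy S
of G. Expanding the square, ∫ b|P_m - G|² tends to this limit minus S. It is nonnegative, so the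
limit is 0. The radii R, 2R, 3R leave room for the cutoff b. -/
lemma strongL2_grad (h : IsPhaseSeq σ β C ρ F P)
    (hv : ∀ x ∈ halfSpace n, Tendsto (fun m => F m x) atTop (𝓝 (v x))) (hR : 0 < R)
    (hG2 : MemLp G 2 (wtMeasure σ (halfBall n (3 * R))))
    (hG : WeakL2 (wtMeasure σ (halfBall n (3 * R))) P G) :
    StrongL2 (wtMeasure σ (halfBall n R)) P G := by
  set μ := wtMeasure σ (halfBall n (3 * R)) with hμ
  let b : ContDiffBump (0 : Rn n) := ⟨R, 2 * R, hR, by linarith⟩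
  have hη : ContDiff ℝ 1 b := b.contDiff
  have hηR : ∀ x : Rn n, 2 * R ≤ ‖x‖ → b x = 0 := fun x hx =>
    b.zero_of_le_dist (by simpa [b] using hx)
  have h23 : 2 * R < 3 * R := by linarith
  have hle : wtMeasure σ (halfBall n R) ≤ μ :=
    Measure.le_iff.2 fun s hs => by
      rw [hμ, wtMeasure, wtMeasure, withDensity_apply _ hs, withDensity_apply _ hs]
      exact lintegral_mono' (Measure.restrict_mono_measure
        (Measure.restrict_mono (halfBall_mono (by linarith)) le_rfl) s) le_rfl
  have hb1 : ∀ᵐ x ∂wtMeasure σ (halfBall n R), b x = 1 := by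
    filter_upwards [ae_mem σ R] with x hx
    exact b.one_of_mem_closedBall (by simpa [b] using hx.2.le)
  have hbb : ∀ x, |b x| ≤ 1 := fun x => abs_le.2 ⟨by linarith [b.nonneg (x := x)], b.le_one⟩
  have hP2 : ∀ᶠ m in atTop, MemLp (P m) 2 μ := by
    filter_upwards [h.eventually_aesm_grad (3 * R), h.eventually_grad_le (3 * R)] with m h1 h2
    exact (h.memLp_grad_bound (3 * R)).mono' h1 h2
  have hbG : MemLp (fun x => b x • G x) 2 μ := by
    refine hG2.norm.mono' (hη.continuous.aestronglyMeasurable.smul hG2.aestronglyMeasurable)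
      (ae_of_all _ fun x => ?_)
    rw [norm_smul]
    exact mul_le_of_le_one_left (norm_nonneg _) (hbb x)
  have t1 := h.tendsto_energy hv h23 hη hηR hG
  rw [← h.limit_inner_eq hv (by positivity) h23 hη hηR hG2 hG] at t1
  have t2 := hG _ hbG
  set S := ∫ x, b x * ‖G x‖ ^ 2 ∂μ with hS
  have hGi : Integrable (fun x => b x * ‖G x‖ ^ 2) μ :=
    hG2.norm.integrable_sq.bdd_mul (c := 1) hη.continuous.aestronglyMeasurable (ae_of_all _ hbb)
  have e2 : ∫ x, inner ℝ (G x) (b x • G x) ∂μ = S := by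
    refine integral_congr_ae (ae_of_all _ fun x => ?_)
    simp only [inner_smul_right, real_inner_self_eq_norm_sq]
  -- An upper bound suffices; the opposite inequality follows from the nonnegativity of the expanded
  -- square.
  have e1 : ∫ x, inner ℝ (G x) ((b x * (Set.Ioi (0 : ℝ)).indicator 1 (v x)) • G x) ∂μ ≤ S := by
    refine integral_mono_of_nonneg (ae_of_all _ fun x => ?_) hGi (ae_of_all _ fun x => ?_)
    · simp only [inner_smul_right, real_inner_self_eq_norm_sq]
      have := b.nonneg (x := x)
      have : 0 ≤ (Set.Ioi (0 : ℝ)).indicator (1 : ℝ → ℝ) (v x) := Set.indicator_nonneg (by simp) _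
      simp only [Pi.zero_apply]
      positivity
    · simp only [inner_smul_right, real_inner_self_eq_norm_sq]
      have := b.nonneg (x := x)
      gcongr
      refine mul_le_of_le_one_right this ?_
      exact Set.indicator_le_self' (by simp) _ |>.trans (by simp)
  rw [e2] at t2
  have t3 := (t1.sub (t2.const_mul 2)).add_const S
  have t4 : ∀ᶠ m in atTop, (∫ x, b x * ‖P m x‖ ^ 2 ∂μ) - 2 * (∫ x, inner ℝ (P m x) (b x • G x) ∂μ) + S =
      ∫ x, b x * ‖P m x - G x‖ ^ 2 ∂μ := by
    filter_upwards [hP2] with m hm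
    have i1 : Integrable (fun x => b x * ‖P m x‖ ^ 2) μ :=
      hm.norm.integrable_sq.bdd_mul (c := 1) hη.continuous.aestronglyMeasurable (ae_of_all _ hbb)
    have i2 : Integrable (fun x => inner ℝ (P m x) (b x • G x)) μ := by
      refine (hm.norm.integrable_mul hbG.norm).mono'
        (hm.aestronglyMeasurable.inner hbG.aestronglyMeasurable) (ae_of_all _ fun x => ?_)
      exact norm_inner_le_norm _ _
    have i12 : Integrable (fun x => b x * ‖P m x‖ ^ 2 - 2 * inner ℝ (P m x) (b x • G x)) μ :=
      i1.sub (i2.const_mul 2)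
    rw [hS, ← integral_const_mul, ← integral_sub i1 (i2.const_mul 2), ← integral_add i12 hGi]
    refine integral_congr_ae (ae_of_all _ fun x => ?_)
    simp only [inner_smul_right, norm_sub_sq_real]
    ring
  have t5 := t3.congr' t4
  have hnn : ∀ m, 0 ≤ ∫ x, b x * ‖P m x - G x‖ ^ 2 ∂μ := fun m =>
    integral_nonneg fun x => mul_nonneg b.nonneg (sq_nonneg _)
  have hL := ge_of_tendsto' t5 hnn
  have t6 : Tendsto (fun m => ∫ x, b x * ‖P m x - G x‖ ^ 2 ∂μ) atTop (𝓝 0) := by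
    convert t5 using 2
    linarith
  have hd : ∀ᶠ m in atTop, MemLp (fun x => P m x - G x) 2 μ := by
    filter_upwards [hP2] with m hm using hm.sub hG2
  refine strongL2_of_tendsto_integral ?_ ?_
  · filter_upwards [hd] with m hm using hm.mono_measure hle
  · refine squeeze_zero' (Eventually.of_forall fun m => integral_nonneg fun x => sq_nonneg _) ?_ t6
    filter_upwards [hd] with m hm
    have i1 : Integrable (fun x => b x * ‖P m x - G x‖ ^ 2) μ :=
      hm.norm.integrable_sq.bdd_mul (c := 1) hη.continuous.aestronglyMeasurable (ae_of_all _ hbb)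
    refine le_trans (le_of_eq ?_) (integral_mono_measure hle (ae_of_all _ fun x =>
      mul_nonneg b.nonneg (sq_nonneg _)) i1)
    refine integral_congr_ae ?_
    filter_upwards [hb1] with x hx
    rw [hx, one_mul]

end IsPhaseSeq

/-! ### Assembling the two phases of the blow-up. -/

lemma HasWeakGrad.neg {U : Set (Rn n)} {v : Rn n → ℝ} {G : Rn n → Rn n} (h : HasWeakGrad U v G) :
    HasWeakGrad U (fun x => -v x) (fun x => -G x) where
  locallyIntegrable := h.locallyIntegrable.neg
  locallyIntegrable_grad := h.locallyIntegrable_grad.neg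
  integral_eq φ h1 h2 h3 e := by
    simp only [neg_mul, inner_neg_left, integral_neg, h.integral_eq φ h1 h2 h3 e]

lemma weakGrad_neg_ae_eq {U : Set (Rn n)} (hU : IsOpen U) {v : Rn n → ℝ} {G : Rn n → Rn n}
    (h : HasWeakGrad U v G) :
    weakGrad U (fun x => -v x) =ᵐ[volume.restrict U] fun x => -weakGrad U v x :=
  (hasWeakGrad_weakGrad ⟨G, h⟩).neg.weakGrad_ae_eq hU

section Conv

variable {F : Type*} [NormedAddCommGroup F] [InnerProductSpace ℝ F] {μ : Measure (Rn n)}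
  {f f' : ℕ → Rn n → F} {f₀ f₀' : Rn n → F}

lemma WeakL2.congr (h : WeakL2 μ f f₀) (h1 : ∀ᶠ m in atTop, f m =ᵐ[μ] f' m) (h2 : f₀ =ᵐ[μ] f₀') :
    WeakL2 μ f' f₀' := fun g hg => by
  have e : ∫ x, inner ℝ (f₀ x) (g x) ∂μ = ∫ x, inner ℝ (f₀' x) (g x) ∂μ := by
    refine integral_congr_ae ?_
    filter_upwards [h2] with x hx
    rw [hx]
  rw [← e]
  refine (h g hg).congr' ?_
  filter_upwards [h1] with m hm
  refine integral_congr_ae ?_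
  filter_upwards [hm] with x hx
  rw [hx]

lemma WeakL2.neg (h : WeakL2 μ f f₀) : WeakL2 μ (fun m x => -f m x) fun x => -f₀ x := fun g hg => by
  simpa only [inner_neg_left, integral_neg] using (h g hg).neg

lemma StrongL2.congr (h : StrongL2 μ f f₀) (h1 : ∀ᶠ m in atTop, f m =ᵐ[μ] f' m) (h2 : f₀ =ᵐ[μ] f₀') :
    StrongL2 μ f' f₀' := by
  refine Tendsto.congr' ?_ h
  filter_upwards [h1] with m hm
  refine eLpNorm_congr_ae ?_
  filter_upwards [hm, h2] with x hx hx'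
  rw [hx, hx']

lemma StrongL2.neg (h : StrongL2 μ f f₀) : StrongL2 μ (fun m x => -f m x) fun x => -f₀ x := by
  refine Tendsto.congr (fun m => ?_) h
  rw [← eLpNorm_neg]
  congr 1
  funext x
  simp only [Pi.neg_apply]; abel

end Conv

lemma IsPhase.locallyIntegrableOn_grad {σ β C ρ : ℝ} {f : Rn n → ℝ} {P : Rn n → Rn n}
    (h : IsPhase σ β C ρ f P) : LocallyIntegrableOn P (halfBall n ρ) := by
  have hc : LocallyIntegrableOn (fun x : Rn n => C * x 0 ^ (β + σ - 1)) (halfBall n ρ) :=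
    ContinuousOn.locallyIntegrableOn (fun x hx => (continuousAt_const.mul
      ((continuous_coord 0).continuousAt.rpow_const (Or.inl (ne_of_gt hx.1)))).continuousWithinAt)
      (isOpen_halfBall ρ).measurableSet
  refine ((locallyIntegrableOn_iff (isOpen_halfBall ρ).isLocallyClosed).2 fun K hK hKc => ?_)
  refine Integrable.mono' (hc.integrableOn_compact_subset hK hKc)
    ((h.aestronglyMeasurable_grad (isOpen_halfBall ρ)).mono_measure (Measure.restrict_mono hK le_rfl)) ?_
  filter_upwards [ae_restrict_mem hKc.measurableSet] with x hx using h.grad_le x (hK hx)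

lemma IsPhase.hasWeakGrad {σ β C ρ : ℝ} {f : Rn n → ℝ} {P : Rn n → Rn n}
    (h : IsPhase σ β C ρ f P) : HasWeakGrad (halfBall n ρ) f P :=
  h.toIsTruncC1.hasWeakGrad (isOpen_halfBall ρ) h.locallyIntegrableOn_grad

namespace IsPhaseSeq

variable {σ β C : ℝ} {ρ : ℕ → ℝ} {F : ℕ → Rn n → ℝ} {P : ℕ → Rn n → Rn n} {v₀ : Rn n → ℝ}

/-- Three gradients have to be reconciled: the pointwise one P_m, the weak gradient on each
half-ball in which convergence is stated, and the weak gradient on the half-space in which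
integrability is given. Uniqueness identifies them almost everywhere. -/
lemma exists_strong_limit (h : IsPhaseSeq σ β C ρ F P) (hv₀ : ∃ G, HasWeakGrad (halfSpace n) v₀ G)
    (hL2 : ∀ R : ℝ, 0 < R → MemLp (weakGrad (halfSpace n) v₀) 2 (wtMeasure σ (halfBall n R)))
    (hw : ∀ R : ℝ, 0 < R → WeakL2 (wtMeasure σ (halfBall n R)) F v₀)
    (hwg : ∀ R : ℝ, 0 < R → WeakL2 (wtMeasure σ (halfBall n R))
      (fun m => weakGrad (halfBall n R) (F m)) (weakGrad (halfBall n R) v₀)) :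
    ∃ v : Rn n → ℝ, (∀ x ∈ halfSpace n, Tendsto (fun m => F m x) atTop (𝓝 (v x))) ∧
      v =ᵐ[volume.restrict (halfSpace n)] v₀ ∧
      (∀ R : ℝ, 0 < R → StrongL2 (wtMeasure σ (halfBall n R)) F v₀) ∧
      ∀ R : ℝ, 0 < R → StrongL2 (wtMeasure σ (halfBall n R))
        (fun m => weakGrad (halfBall n R) (F m)) (weakGrad (halfBall n R) v₀) := by
  have hG := hasWeakGrad_weakGrad hv₀
  obtain ⟨v, hv⟩ := h.exists_pointwise_limit hw
  have hvae := h.ae_eq_limit hv hw hG.locallyIntegrable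
  refine ⟨v, hv, hvae, fun R hR => ?_, fun R hR => ?_⟩
  · exact (h.strongL2 hv R).congr (Eventually.of_forall fun _ => EventuallyEq.rfl)
      ((wtMeasure_ac σ R).ae_le (ae_restrict_of_ae_restrict_of_subset
        (halfBall_subset_halfSpace R) hvae))
  · have e : ∀ R, ∀ᶠ m in atTop,
        weakGrad (halfBall n R) (F m) =ᵐ[wtMeasure σ (halfBall n R)] P m := fun R => by
      filter_upwards [h.eventually_phase R] with m hm
      exact (wtMeasure_ac σ R).ae_le (hm.hasWeakGrad.weakGrad_ae_eq (isOpen_halfBall R))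
    have e₀ : ∀ R, weakGrad (halfBall n R) v₀ =ᵐ[wtMeasure σ (halfBall n R)]
        weakGrad (halfSpace n) v₀ := fun R =>
      (wtMeasure_ac σ R).ae_le ((hG.mono (halfBall_subset_halfSpace R)).weakGrad_ae_eq
        (isOpen_halfBall R))
    have h3 : 0 < 3 * R := by positivity
    have hs := h.strongL2_grad hv hR (hL2 _ h3) ((hwg _ h3).congr (e _) (e₀ _))
    refine hs.congr ?_ (e₀ R).symm
    filter_upwards [e R] with m hm using hm.symm

end IsPhaseSeq

lemma pos_blowUp (u : Rn n → ℝ) (β : ℝ) {r : ℝ} (hr : 0 < r) (x : Rn n) :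
    pos (blowUp u β r) x = pos u (r • x) / r ^ β := by
  have h1 := Real.rpow_pos_of_pos hr β
  have h2 := Real.rpow_pos_of_pos hr (β + 1)
  rcases le_total 0 (u (r • x)) with h | h
  · simp only [pos, neg, blowUp, max_eq_left h, min_eq_right h, zero_div, add_zero]
    exact max_eq_left (div_nonneg h h1.le)
  · simp only [pos, neg, blowUp, max_eq_right h, min_eq_left h, zero_div, zero_add]
    exact max_eq_right (div_nonpos_of_nonpos_of_nonneg h h2.le)

lemma neg_blowUp (u : Rn n → ℝ) (β : ℝ) {r : ℝ} (hr : 0 < r) (x : Rn n) :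
    neg (blowUp u β r) x = neg u (r • x) / r ^ (β + 1) := by
  have h1 := Real.rpow_pos_of_pos hr β
  have h2 := Real.rpow_pos_of_pos hr (β + 1)
  rcases le_total 0 (u (r • x)) with h | h
  · simp only [pos, neg, blowUp, max_eq_left h, min_eq_right h, zero_div, add_zero]
    exact min_eq_right (div_nonneg h h1.le)
  · simp only [pos, neg, blowUp, max_eq_right h, min_eq_left h, zero_div, zero_add]
    exact min_eq_left (div_nonpos_of_nonpos_of_nonneg h h2.le)

lemma IsPhase.isPhaseSeq_scale {σ β C ρ : ℝ} {f : Rn n → ℝ} {P : Rn n → Rn n}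
    (h : IsPhase σ β C ρ f P) (hσ : 0 ≤ σ) (hβ : 0 < β) (hβ1 : β ≤ 1) (hρ : 0 < ρ) {r : ℕ → ℝ}
    (hr : ∀ m, 0 < r m) (hr0 : Tendsto r atTop (𝓝 0)) :
    IsPhaseSeq σ β C (fun m => ρ / r m) (fun m x => f (r m • x) / r m ^ (β + σ))
      (fun m x => r m ^ (1 - (β + σ)) • P (r m • x)) where
  phase m := h.scale (hr m)
  tendsto := by
    simp only [div_eq_mul_inv]
    exact (tendsto_inv_nhdsGT_zero.comp (tendsto_nhdsWithin_iff.2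
      ⟨hr0, Eventually.of_forall hr⟩)).const_mul_atTop hρ
  sigma_nonneg := hσ
  beta_pos := hβ
  beta_le := hβ1

/-- The phases are treated separately, with limits v₁ and v₂. The representative of u₀ is v₁ - v₂,
and the point is that these are its positive and negative parts. -/
lemma IsTwoPhase.blowUp_limit {β C ρ : ℝ} {u u₀ : Rn n → ℝ} {P Q : Rn n → Rn n}
    (h : IsTwoPhase β C ρ (TwoPhase.pos u) P (fun x => -TwoPhase.neg u x) Q) (hβ : 0 < β) (hβ1 : β ≤ 1)
    (hn : 1 ≤ n) (hρ : 0 < ρ) {r : ℕ → ℝ} (hr : ∀ m, 0 < r m) (hr0 : Tendsto r atTop (𝓝 0))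
    (hu₀ : MemVLoc u₀) (hw : WeakConvV (fun m => blowUp u β (r m)) u₀) :
    TwoPhaseHomogeneous u₀ β (β + 1) ∧ StrongConvV (fun m => blowUp u β (r m)) u₀ := by
  have s1 := h.pos.isPhaseSeq_scale le_rfl hβ hβ1 hρ hr hr0
  have s2 := h.neg.isPhaseSeq_scale zero_le_one hβ hβ1 hρ hr hr0
  have e1 : (fun m x => TwoPhase.pos u (r m • x) / r m ^ (β + 0)) =
      fun m => TwoPhase.pos (blowUp u β (r m)) := by
    funext m x; rw [pos_blowUp u β (hr m), add_zero]
  have e2 : (fun m x => -TwoPhase.neg u (r m • x) / r m ^ (β + 1)) =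
      fun m x => -TwoPhase.neg (blowUp u β (r m)) x := by
    funext m x; rw [neg_blowUp u β (hr m), neg_div]
  have hgn := hasWeakGrad_weakGrad hu₀.exists_grad_neg
  have c0 : ∀ R, (fun x => -weakGrad (halfBall n R) (TwoPhase.neg u₀) x) =ᵐ[wtMeasure 1 (halfBall n R)]
      weakGrad (halfBall n R) (fun x => -TwoPhase.neg u₀ x) := fun R =>
    (wtMeasure_ac 1 R).ae_le (weakGrad_neg_ae_eq (isOpen_halfBall R)
      (hgn.mono (halfBall_subset_halfSpace R))).symm
  have c1 : ∀ R, ∀ᶠ m in atTop, (fun x => -weakGrad (halfBall n R) (TwoPhase.neg (blowUp u β (r m))) x)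
      =ᵐ[wtMeasure 1 (halfBall n R)]
      weakGrad (halfBall n R) (fun x => -TwoPhase.neg (blowUp u β (r m)) x) := fun R => by
    filter_upwards [s2.eventually_phase R] with m hm
    have h1 := hm.hasWeakGrad.neg
    have h2 : (fun x => -(-TwoPhase.neg u (r m • x) / r m ^ (β + 1))) =
        TwoPhase.neg (blowUp u β (r m)) := by
      funext x; rw [neg_blowUp u β (hr m), neg_div, neg_neg]
    rw [h2] at h1
    exact (wtMeasure_ac 1 R).ae_le (weakGrad_neg_ae_eq (isOpen_halfBall R) h1).symm
  obtain ⟨v₁, l1, a1, S1, T1⟩ := s1.exists_strong_limit (v₀ := TwoPhase.pos u₀) hu₀.exists_grad_pos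
    (fun R hR => by simpa only [muPos_eq] using hu₀.weighted_grad_pos R hR)
    (fun R hR => by simpa only [e1, muPos_eq] using hw.weighted_pos R hR)
    (fun R hR => by
      have := hw.weighted_grad_pos R hR
      rw [muPos_eq] at this
      exact this.congr (Eventually.of_forall fun m => by rw [← congrFun e1 m]) EventuallyEq.rfl)
  obtain ⟨v₂, l2, a2, S2, T2⟩ := s2.exists_strong_limit (v₀ := fun x => -TwoPhase.neg u₀ x)
    ⟨_, hgn.neg⟩
    (fun R hR => by
      have h1 := (hu₀.weighted_grad_neg R hR).neg
      rw [muNeg_eq] at h1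
      refine (memLp_congr_ae ?_).1 h1
      exact (wtMeasure_ac 1 R).ae_le (ae_restrict_of_ae_restrict_of_subset
        (halfBall_subset_halfSpace R) (weakGrad_neg_ae_eq isOpen_halfSpace hgn).symm))
    (fun R hR => by
      have := hw.weighted_neg R hR
      rw [muNeg_eq] at this
      rw [e2]
      exact this.neg)
    (fun R hR => by
      have := hw.weighted_grad_neg R hR
      rw [muNeg_eq] at this
      refine this.neg.congr ?_ (c0 R)
      filter_upwards [c1 R] with m hm
      rw [congrFun e2 m]
      exact hm)
  have n1 : ∀ x ∈ halfSpace n, 0 ≤ v₁ x := fun x hx => s1.limit_nonneg l1 hx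
  have n2 : ∀ x ∈ halfSpace n, 0 ≤ v₂ x := fun x hx => s2.limit_nonneg l2 hx
  -- At each point one of the two phases of u vanishes, and the zero product passes to the pointwise
  -- limits.
  have hprod : ∀ x ∈ halfSpace n, v₁ x = 0 ∨ v₂ x = 0 := fun x hx => by
    rw [← mul_eq_zero]
    refine tendsto_nhds_unique ((l1 x hx).mul (l2 x hx)) (tendsto_const_nhds.congr fun m => ?_)
    rcases le_total 0 (u (r m • x)) with h0 | h0
    · simp [TwoPhase.neg, min_eq_right h0]
    · simp [TwoPhase.pos, max_eq_right h0]
  have p1 : ∀ x ∈ halfSpace n, TwoPhase.pos (fun x => v₁ x - v₂ x) x = v₁ x := fun x hx => by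
    have := n2 x hx
    simp only [TwoPhase.pos]
    rcases hprod x hx with h0 | h0 <;> rw [h0]
    · exact max_eq_right (by linarith)
    · rw [sub_zero]; exact max_eq_left (n1 x hx)
  have p2 : ∀ x ∈ halfSpace n, TwoPhase.neg (fun x => v₁ x - v₂ x) x = -v₂ x := fun x hx => by
    have := n2 x hx
    simp only [TwoPhase.neg]
    rcases hprod x hx with h0 | h0 <;> rw [h0]
    · rw [zero_sub]; exact min_eq_left (by linarith)
    · rw [sub_zero, neg_zero]; exact min_eq_right (n1 x hx)
  refine ⟨⟨fun x => v₁ x - v₂ x, ?_, fun l hl x hx => ?_⟩, ?_, ?_, ?_, ?_⟩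
  · filter_upwards [a1, a2] with x h1 h2
    rw [h1, h2, sub_neg_eq_add]
    simp only [TwoPhase.pos, TwoPhase.neg, max_add_min, add_zero]
  · have hlx : l • x ∈ halfSpace n := by
      change 0 < (l • x) 0
      simpa using mul_pos hl hx
    rw [p1 x hx, p1 _ hlx, p2 x hx, p2 _ hlx]
    have h1 := h.homogeneous_pos hβ hn hρ hr hr0 l1 (s1.continuousOn_limit l1) n1 hl hx
    have h2 := h.homogeneous_neg hβ hn hρ hr hr0 l2 (s2.continuousOn_limit l2) n2 hl hx
    rw [add_zero] at h1
    exact ⟨h1, by rw [h2]; ring⟩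
  · intro R hR
    have := S1 R hR
    rwa [e1, ← muPos_eq] at this
  · intro R hR
    have := (S2 R hR).neg
    rw [muNeg_eq]
    refine this.congr (Eventually.of_forall fun m => ae_of_all _ fun x => ?_) (by simp)
    simp only [neg_blowUp u β (hr m), neg_div, neg_neg]
  · intro R hR
    have := T1 R hR
    rw [muPos_eq]
    exact this.congr (Eventually.of_forall fun m => by rw [← congrFun e1 m]) EventuallyEq.rfl
  · intro R hR
    have := (T2 R hR).neg
    rw [muNeg_eq]
    refine this.congr ?_ ?_
    · filter_upwards [c1 R] with m hm
      rw [congrFun e2 m]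
      filter_upwards [hm] with x hx
      rw [← hx, neg_neg]
    · filter_upwards [c0 R] with x hx
      rw [← hx, neg_neg]

/-! ### The equation in {u ≠ 0} from stationarity. -/

lemma integrableOn_of_continuousOn_of_isCompact {V K : Set (Rn n)} {h : Rn n → ℝ}
    (hh : ContinuousOn h V) (hK : IsCompact K) (hKV : K ⊆ V) (h0 : ∀ x, x ∉ K → h x = 0) :
    IntegrableOn h V :=
  ((integrableOn_iff_integrable_of_support_subset fun x hx => by
    by_contra hxK; exact hx (h0 x hxK)).1 ((hh.mono hKV).integrableOn_compact hK)).integrableOn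

lemma integral_mul_fderiv_eq_neg_fderiv_mul {V : Set (Rn n)} (hV : IsOpen V) {f ζ : Rn n → ℝ}
    (hf : ContDiffOn ℝ 1 f V) (hζ : ContDiff ℝ 1 ζ) (hc : HasCompactSupport ζ) (hs : tsupport ζ ⊆ V)
    (e : Rn n) : ∫ x in V, f x * fderiv ℝ ζ x e = -∫ x in V, fderiv ℝ f x e * ζ x := by
  have h := integral_mul_fderiv_eq_neg hV (f := f) (P := testGrad f)
    (fun x hx => by
      rw [hasGradientAt_iff_hasFDerivAt, testGrad, LinearIsometryEquiv.apply_symm_apply]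
      exact ((hf.contDiffAt (hV.mem_nhds hx)).differentiableAt one_ne_zero).hasFDerivAt)
    ((InnerProductSpace.toDual ℝ (Rn n)).symm.continuous.comp_continuousOn
      (hf.continuousOn_fderiv_of_isOpen hV le_rfl)) hζ hc hs e
  simpa only [real_inner_comm, inner_testGrad] using h

lemma integral_fderiv_apply_eq_neg_divergence {V : Set (Rn n)} (hV : IsOpen V) {X : Rn n → Rn n}
    {ζ : Rn n → ℝ} (hX : ContDiffOn ℝ 1 X V) (hζ : ContDiff ℝ 1 ζ) (hc : HasCompactSupport ζ)
    (hs : tsupport ζ ⊆ V) :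
    ∫ x in V, fderiv ℝ ζ x (X x) = -∫ x in V, divergence X x * ζ x := by
  have hXi : ∀ i : Fin n, ContDiffOn ℝ 1 (fun x => X x i) V := fun i =>
    (EuclideanSpace.proj (𝕜 := ℝ) i).contDiff.comp_contDiffOn hX
  have hz : ∀ x, x ∉ tsupport ζ → fderiv ℝ ζ x = 0 := fun x hx => fderiv_of_notMem_tsupport ℝ hx
  have hz0 : ∀ x, x ∉ tsupport ζ → ζ x = 0 := fun x hx => image_eq_zero_of_notMem_tsupport hx
  have h1 : ∀ x, fderiv ℝ ζ x (X x) =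
      ∑ i, X x i * fderiv ℝ ζ x (EuclideanSpace.single i 1) := fun x => by
    have h2 : X x = ∑ i, X x i • EuclideanSpace.single i (1 : ℝ) := by
      ext j; simp [Pi.single_apply]
    conv_lhs => rw [h2]
    rw [map_sum]
    simp
  have hd : ∀ x ∈ V, ∀ i : Fin n, ∀ e, fderiv ℝ (fun x => X x i) x e = (fderiv ℝ X x e) i := by
    intro x hx i e
    have h3 := ((EuclideanSpace.proj (𝕜 := ℝ) i).hasFDerivAt (x := X x)).comp x
      ((hX.contDiffAt (hV.mem_nhds hx)).differentiableAt one_ne_zero).hasFDerivAt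
    have h4 : HasFDerivAt (fun x => X x i) ((EuclideanSpace.proj (𝕜 := ℝ) i).comp (fderiv ℝ X x)) x := h3
    rw [h4.fderiv]; rfl
  simp_rw [h1]
  rw [integral_finsetSum]
  · have h5 : ∀ x ∈ V, divergence X x * ζ x =
        ∑ i, fderiv ℝ (fun x => X x i) x (EuclideanSpace.single i 1) * ζ x := fun x hx => by
      simp only [divergence, Finset.sum_mul, hd x hx]
    rw [setIntegral_congr_fun hV.measurableSet h5, integral_finsetSum, ← Finset.sum_neg_distrib]
    · exact Finset.sum_congr rfl fun i _ =>
        integral_mul_fderiv_eq_neg_fderiv_mul hV (hXi i) hζ hc hs _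
    · intro i _
      refine integrableOn_of_continuousOn_of_isCompact ?_ hc hs fun x hx => by rw [hz0 x hx, mul_zero]
      exact (((hXi i).continuousOn_fderiv_of_isOpen hV le_rfl).clm_apply continuousOn_const).mul
        hζ.continuous.continuousOn
  · intro i _
    refine integrableOn_of_continuousOn_of_isCompact ?_ hc hs fun x hx => by simp [hz x hx]
    exact (hXi i).continuousOn.mul
      ((hζ.continuous_fderiv one_ne_zero).clm_apply continuous_const).continuousOn

lemma contDiffOn_wt (σ : ℝ) {V : Set (Rn n)} (hV : V ⊆ halfSpace n) : ContDiffOn ℝ 1 (wt σ) V :=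
  ContDiffOn.rpow_const_of_ne (EuclideanSpace.proj (𝕜 := ℝ) (0 : Fin n)).contDiff.contDiffOn
    fun _ hx => ne_of_gt (hV hx)

/-- Stationarity with respect to translations of the domain gives the Euler equation. -/
lemma integral_wt_mul_fderiv_eq_zero {V : Set (Rn n)} (hV : IsOpen V) (hVH : V ⊆ halfSpace n) {σ : ℝ}
    {u : Rn n → ℝ} (hu : ContDiffOn ℝ 2 u V)
    (h : ∀ ζ : Rn n → ℝ, ContDiff ℝ 1 ζ → HasCompactSupport ζ → tsupport ζ ⊆ V → ∀ e : Rn n,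
      ∫ x in V, (wt σ x * ‖testGrad u x‖ ^ 2 * fderiv ℝ ζ x e -
        2 * (wt σ x * fderiv ℝ u x e * fderiv ℝ ζ x (testGrad u x)) +
        fderiv ℝ (wt σ) x e * ‖testGrad u x‖ ^ 2 * ζ x) = 0)
    {ζ : Rn n → ℝ} (hζ : ContDiff ℝ 1 ζ) (hc : HasCompactSupport ζ) (hs : tsupport ζ ⊆ V) :
    ∫ x in V, wt σ x * fderiv ℝ ζ x (testGrad u x) = 0 := by
  have hu1 : ContDiffOn ℝ 1 (fderiv ℝ u) V := hu.fderiv_of_isOpen hV le_rfl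
  have hP : ContDiffOn ℝ 1 (testGrad u) V :=
    (InnerProductSpace.toDual ℝ (Rn n)).symm.contDiff.comp_contDiffOn hu1
  have hW := contDiffOn_wt σ hVH
  have hX : ContDiffOn ℝ 1 (fun x => wt σ x • testGrad u x) V := hW.smul hP
  set X := fun x => wt σ x • testGrad u x with hXdef
  have hF : ContinuousOn (divergence X) V := by
    refine continuousOn_finsetSum _ fun i _ => ?_
    exact (continuous_coord i).comp_continuousOn
      ((hX.continuousOn_fderiv_of_isOpen hV le_rfl).clm_apply continuousOn_const)
  have hA : ContinuousOn (fderiv ℝ (fderiv ℝ u)) V := hu1.continuousOn_fderiv_of_isOpen hV le_rfl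
  have hpe : ∀ e, ContDiffOn ℝ 1 (fun x => fderiv ℝ u x e) V := fun e => hu1.clm_apply contDiffOn_const
  have dpe : ∀ x ∈ V, ∀ e w, fderiv ℝ (fun x => fderiv ℝ u x e) x w =
      fderiv ℝ (fderiv ℝ u) x w e := by
    intro x hx e w
    have h1 := ((hu1.contDiffAt (hV.mem_nhds hx)).differentiableAt one_ne_zero).hasFDerivAt
    rw [(h1.clm_apply (hasFDerivAt_const e x)).fderiv]
    simp
  have dP : ∀ x ∈ V, ∀ w, fderiv ℝ (testGrad u) x w =
      (InnerProductSpace.toDual ℝ (Rn n)).symm (fderiv ℝ (fderiv ℝ u) x w) := by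
    intro x hx w
    have h1 := ((hu1.contDiffAt (hV.mem_nhds hx)).differentiableAt one_ne_zero).hasFDerivAt
    have h2 : HasFDerivAt (testGrad u) _ x :=
      ((InnerProductSpace.toDual ℝ (Rn n)).symm.toContinuousLinearEquiv.toContinuousLinearMap.hasFDerivAt).comp x h1
    rw [h2.fderiv]; rfl
  have hN : ContDiffOn ℝ 1 (fun x => ‖testGrad u x‖ ^ 2) V := hP.norm_sq ℝ
  have dN : ∀ x ∈ V, ∀ e, fderiv ℝ (fun x => ‖testGrad u x‖ ^ 2) x e =
      2 * fderiv ℝ (fderiv ℝ u) x (testGrad u x) e := by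
    intro x hx e
    have h1 := ((hP.contDiffAt (hV.mem_nhds hx)).differentiableAt one_ne_zero).hasFDerivAt
    rw [h1.norm_sq.fderiv]
    -- Since u is C² the Hessian is symmetric, so the derivative of |∇u|² in direction e and the
    -- derivative of ∂_e u in direction ∇u involve the same term.
    have hsym := (hu.contDiffAt (hV.mem_nhds hx)).isSymmSndFDerivAt (by simp)
    rw [hsym (testGrad u x) e]
    simp only [smul_apply, ContinuousLinearMap.comp_apply, innerSL_apply_apply,
      dP x hx]
    rw [real_inner_comm, InnerProductSpace.toDual_symm_apply]
    simp
  -- Integrating the stationarity identity by parts cancels the Hessian terms and the derivative of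
  -- the weight, and leaves div X times ∂_e u, where X = w∇u.
  have step : ∀ ζ : Rn n → ℝ, ContDiff ℝ 1 ζ → HasCompactSupport ζ → tsupport ζ ⊆ V → ∀ e : Rn n,
      ∫ x in V, divergence X x * (fderiv ℝ u x e * ζ x) = 0 := by
    intro ζ hζ hc hs e
    have hz : ∀ x, x ∉ tsupport ζ → fderiv ℝ ζ x = 0 := fun x hx => fderiv_of_notMem_tsupport ℝ hx
    have hz0 : ∀ x, x ∉ tsupport ζ → ζ x = 0 := fun x hx => image_eq_zero_of_notMem_tsupport hx
    have hdζ : Continuous (fderiv ℝ ζ) := hζ.continuous_fderiv one_ne_zero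
    have q1 := integral_fderiv_apply_eq_neg_divergence hV hX
      (contDiff_mul_of_tsupport_subset hV (hpe e) hζ hs) hc.mul_left
      ((closure_mono (Function.support_mul_subset_right _ ζ)).trans hs)
    have q2 := integral_mul_fderiv_eq_neg_fderiv_mul hV (hW.mul hN) hζ hc hs e
    have q3 := h ζ hζ hc hs e
    have i1 : IntegrableOn (fun x => wt σ x * ‖testGrad u x‖ ^ 2 * fderiv ℝ ζ x e) V :=
      integrableOn_of_continuousOn_of_isCompact ((hW.continuousOn.mul hN.continuousOn).mul
        (hdζ.clm_apply continuous_const).continuousOn) hc hs fun x hx => by simp [hz x hx]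
    have i2 : IntegrableOn (fun x => wt σ x * fderiv ℝ u x e * fderiv ℝ ζ x (testGrad u x)) V :=
      integrableOn_of_continuousOn_of_isCompact ((hW.continuousOn.mul (hpe e).continuousOn).mul
        (hdζ.continuousOn.clm_apply hP.continuousOn)) hc hs fun x hx => by simp [hz x hx]
    have i3 : IntegrableOn (fun x => fderiv ℝ (wt σ) x e * ‖testGrad u x‖ ^ 2 * ζ x) V :=
      integrableOn_of_continuousOn_of_isCompact ((((hW.continuousOn_fderiv_of_isOpen hV le_rfl).clm_apply
        continuousOn_const).mul hN.continuousOn).mul hζ.continuous.continuousOn) hc hs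
        fun x hx => by simp [hz0 x hx]
    have i4 : IntegrableOn (fun x => wt σ x * fderiv ℝ (fderiv ℝ u) x (testGrad u x) e * ζ x) V :=
      integrableOn_of_continuousOn_of_isCompact ((hW.continuousOn.mul
        ((hA.clm_apply hP.continuousOn).clm_apply continuousOn_const)).mul hζ.continuous.continuousOn)
        hc hs fun x hx => by simp [hz0 x hx]
    have e1 : ∀ x ∈ V, fderiv ℝ (fun x => fderiv ℝ u x e * ζ x) x (X x) =
        wt σ x * fderiv ℝ u x e * fderiv ℝ ζ x (testGrad u x) +
        wt σ x * fderiv ℝ (fderiv ℝ u) x (testGrad u x) e * ζ x := by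
      intro x hx
      have d1 := ((hpe e).contDiffAt (hV.mem_nhds hx)).differentiableAt one_ne_zero
      have d2 := hζ.differentiable one_ne_zero x
      rw [show (fun x => fderiv ℝ u x e * ζ x) = (fun x => fderiv ℝ u x e) * ζ from rfl,
        (d1.hasFDerivAt.mul d2.hasFDerivAt).fderiv]
      simp only [add_apply, smul_apply, smul_eq_mul,
        dpe x hx, hXdef, map_smul]
      ring
    have e2 : ∀ x ∈ V, fderiv ℝ (fun x => wt σ x * ‖testGrad u x‖ ^ 2) x e * ζ x =
        fderiv ℝ (wt σ) x e * ‖testGrad u x‖ ^ 2 * ζ x +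
        2 * (wt σ x * fderiv ℝ (fderiv ℝ u) x (testGrad u x) e * ζ x) := by
      intro x hx
      have d1 := (hW.contDiffAt (hV.mem_nhds hx)).differentiableAt one_ne_zero
      have d2 := (hN.contDiffAt (hV.mem_nhds hx)).differentiableAt one_ne_zero
      rw [show (fun x => wt σ x * ‖testGrad u x‖ ^ 2) = wt σ * (fun x => ‖testGrad u x‖ ^ 2) from rfl,
        (d1.hasFDerivAt.mul d2.hasFDerivAt).fderiv]
      simp only [add_apply, smul_apply, smul_eq_mul, dN x hx]
      ring
    rw [setIntegral_congr_fun hV.measurableSet e1, integral_add i2 i4] at q1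
    change ∫ x in V, wt σ x * ‖testGrad u x‖ ^ 2 * fderiv ℝ ζ x e =
      -∫ x in V, fderiv ℝ (fun x => wt σ x * ‖testGrad u x‖ ^ 2) x e * ζ x at q2
    rw [setIntegral_congr_fun hV.measurableSet e2, integral_add i3 (i4.const_mul 2),
      integral_const_mul] at q2
    have i12 : IntegrableOn (fun x => wt σ x * ‖testGrad u x‖ ^ 2 * fderiv ℝ ζ x e -
        2 * (wt σ x * fderiv ℝ u x e * fderiv ℝ ζ x (testGrad u x))) V := i1.sub (i2.const_mul 2)
    rw [integral_add i12 i3, integral_sub i1 (i2.const_mul 2), integral_const_mul] at q3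
    linarith
  have hFp : ∀ e, ∀ x ∈ V, divergence X x * fderiv ℝ u x e = 0 := by
    intro e
    have hcont : ContinuousOn (fun x => divergence X x * fderiv ℝ u x e) V :=
      hF.mul (hpe e).continuousOn
    have h1 := hV.ae_eq_zero_of_integral_contDiff_smul_eq_zero
      (hcont.locallyIntegrableOn (μ := volume) hV.measurableSet) fun g hg hgc hgs => by
        have := step g (hg.of_le (by exact_mod_cast le_top)) hgc hgs e
        rw [setIntegral_eq_integral_of_forall_compl_eq_zero fun x hx => by
          rw [image_eq_zero_of_notMem_tsupport fun h => hx (hgs h)]; simp] at this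
        rw [← this]
        refine integral_congr_ae (ae_of_all _ fun x => ?_)
        simp only [smul_eq_mul]; ring
    have h2 : (fun x => divergence X x * fderiv ℝ u x e) =ᵐ[volume.restrict V] fun _ => 0 := by
      rw [EventuallyEq, ae_restrict_iff' hV.measurableSet]; exact h1
    exact Measure.eqOn_open_of_ae_eq h2 hV hcont continuousOn_const
  -- If div X ≠ 0 at x, then div X ≠ 0 nearby, so all ∂_e u vanish nearby. But then X = 0 near x and
  -- div X = 0 at x.
  have hF0 : ∀ x ∈ V, divergence X x = 0 := by
    intro x hx
    by_contra hne
    have hev : ∀ᶠ y in 𝓝 x, X y = 0 := by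
      filter_upwards [(hF.continuousAt (hV.mem_nhds hx)).eventually_ne hne, hV.mem_nhds hx] with y h1 h2
      have h3 : fderiv ℝ u y = 0 := by
        ext e; exact (mul_eq_zero.1 (hFp e y h2)).resolve_left h1
      simp [hXdef, testGrad, h3]
    apply hne
    have h4 : fderiv ℝ X x = 0 := by
      rw [(show X =ᶠ[𝓝 x] fun _ => 0 from hev).fderiv_eq]; simp
    simp [divergence, h4]
  have q := integral_fderiv_apply_eq_neg_divergence hV hX hζ hc hs
  have q0 : ∫ x in V, divergence X x * ζ x = 0 :=
    setIntegral_eq_zero_of_forall_eq_zero fun x hx => by rw [hF0 x hx, zero_mul]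
  rw [q0, neg_zero] at q
  simpa [hXdef] using q

/-! ### Variational solutions: pointwise gradients and the equations of the phases. -/

/-- The gradient of `w` on `{w > 0}`, extended by zero. -/
def posGrad (w : Rn n → ℝ) (x : Rn n) : Rn n := if 0 < w x then testGrad w x else 0

lemma posGrad_of_pos {w : Rn n → ℝ} {x : Rn n} (h : 0 < w x) : posGrad w x = testGrad w x := if_pos h

lemma posGrad_of_nonpos {w : Rn n → ℝ} {x : Rn n} (h : w x ≤ 0) : posGrad w x = 0 := if_neg h.not_gt

lemma pos_pos_iff {w : Rn n → ℝ} {x : Rn n} : 0 < pos w x ↔ 0 < w x := by simp [pos]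

lemma isTruncC1_pos {U : Set (Rn n)} (hU : IsOpen U) {w : Rn n → ℝ} (hc : ContinuousOn w U)
    (h2 : ContDiffOn ℝ 2 w {x ∈ U | w x ≠ 0}) : IsTruncC1 U (pos w) (posGrad w) where
  nonneg x _ := le_max_right _ _
  cont := hc.sup continuousOn_const
  grad x hx hpos := by
    have hw := pos_pos_iff.1 hpos
    have hV : IsOpen {x ∈ U | w x ≠ 0} := hc.isOpen_inter_preimage hU isOpen_ne
    have hd := ((h2.contDiffAt (hV.mem_nhds ⟨hx, hw.ne'⟩)).differentiableAt two_ne_zero).hasFDerivAt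
    rw [hasGradientAt_iff_hasFDerivAt, posGrad_of_pos hw, testGrad, LinearIsometryEquiv.apply_symm_apply]
    refine hd.congr_of_eventuallyEq ?_
    filter_upwards [(hc.continuousAt (hU.mem_nhds hx)).eventually (lt_mem_nhds hw)] with y hy
    exact max_eq_left hy.le
  grad_zero x hx h0 := posGrad_of_nonpos (not_lt.1 fun h => (pos_pos_iff.2 h).ne' h0)
  cont_grad := by
    have hV : IsOpen {x ∈ U | w x ≠ 0} := hc.isOpen_inter_preimage hU isOpen_ne
    have h3 : ContinuousOn (testGrad w) {x ∈ U | w x ≠ 0} :=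
      (InnerProductSpace.toDual ℝ (Rn n)).symm.continuous.comp_continuousOn
        (h2.continuousOn_fderiv_of_isOpen hV (by norm_num))
    exact (h3.mono fun x hx => ⟨hx.1, (pos_pos_iff.1 hx.2).ne'⟩).congr fun x hx =>
      posGrad_of_pos (pos_pos_iff.1 hx.2)

namespace IsTruncC1

variable {U : Set (Rn n)} {f : Rn n → ℝ} {P G : Rn n → Rn n}

/-- On {f > 0} this is uniqueness. Therefore |P| ≤ |G| almost everywhere, P is locally integrable,
and so P is itself a weak gradient on all of U. Uniqueness once more shows that G vanishes almost
everywhere on {f = 0}. -/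
lemma ae_eq_of_hasWeakGrad (h : IsTruncC1 U f P) (hU : IsOpen U) (hG : HasWeakGrad U f G) :
    G =ᵐ[volume.restrict U] P := by
  have hV := h.isOpen_pos hU
  have hVU : {x ∈ U | 0 < f x} ⊆ U := fun x hx => hx.1
  have h1 := (hG.mono hVU).unique hV
    (hasWeakGrad_of_hasGradientAt hV (fun x hx => h.grad x hx.1 hx.2) h.cont_grad)
  have hle : ∀ᵐ x ∂(volume.restrict U), ‖P x‖ ≤ ‖G x‖ := by
    rw [EventuallyEq, ae_restrict_iff' hV.measurableSet] at h1
    rw [ae_restrict_iff' hU.measurableSet]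
    filter_upwards [h1] with x hx hxU
    rcases (h.nonneg x hxU).eq_or_lt with h0 | h0
    · rw [h.grad_zero x hxU h0.symm, norm_zero]; exact norm_nonneg _
    · rw [hx ⟨hxU, h0⟩]
  refine hG.unique hU (h.hasWeakGrad hU ?_)
  refine (locallyIntegrableOn_iff hU.isLocallyClosed).2 fun K hK hKc => ?_
  exact Integrable.mono (hG.locallyIntegrable_grad.integrableOn_compact_subset hK hKc)
    ((h.aestronglyMeasurable_grad hU).mono_measure (Measure.restrict_mono hK le_rfl))
    (ae_restrict_of_ae_restrict_of_subset hK hle)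

/-- Where f > 0 both sides are continuous, so a violation at one point would occur on an open set,
which has positive measure. -/
lemma norm_grad_le_of_ae (h : IsTruncC1 U f P) (hU : IsOpen U) {B : Rn n → ℝ} (hB : ContinuousOn B U)
    (hB0 : ∀ x ∈ U, 0 ≤ B x) (hae : ∀ᵐ x ∂(volume.restrict U), ‖P x‖ ≤ B x) :
    ∀ x ∈ U, ‖P x‖ ≤ B x := by
  intro x hx
  rcases (h.nonneg x hx).eq_or_lt with h0 | h0
  · rw [h.grad_zero x hx h0.symm, norm_zero]; exact hB0 x hx
  by_contra hlt
  have hV := h.isOpen_pos hU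
  have hS : IsOpen ({x ∈ U | 0 < f x} ∩ (fun y => ‖P y‖ - B y) ⁻¹' Set.Ioi 0) :=
    (h.cont_grad.norm.sub (hB.mono fun x hx => hx.1)).isOpen_inter_preimage hV isOpen_Ioi
  have hpos := hS.measure_pos volume ⟨x, ⟨hx, h0⟩, sub_pos.2 (not_le.1 hlt)⟩
  refine hpos.ne' (measure_mono_null ?_ (ae_iff.1 ((ae_restrict_iff' hU.measurableSet).1 hae)))
  rintro y ⟨hy, hy'⟩
  simp only [Set.mem_ofPred_eq, not_forall, not_le]
  exact ⟨hy.1, sub_pos.1 hy'⟩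

end IsTruncC1

lemma fderiv_smul_const {ζ : Rn n → ℝ} (hζ : ContDiff ℝ 1 ζ) (e x v : Rn n) :
    fderiv ℝ (fun y => ζ y • e) x v = fderiv ℝ ζ x v • e := by
  rw [((hζ.differentiable one_ne_zero x).hasFDerivAt.smul_const e).fderiv]; rfl

lemma firstVariationIntegrand_smul_const (P N : Rn n → Rn n) {ζ : Rn n → ℝ} (hζ : ContDiff ℝ 1 ζ)
    (e x : Rn n) : firstVariationIntegrand P N (fun y => ζ y • e) x =
      (x 0 * ‖P x‖ ^ 2 + 1 / x 0 * ‖N x‖ ^ 2) * fderiv ℝ ζ x e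
      - 2 * x 0 * (fderiv ℝ ζ x (P x) * inner ℝ (P x) e)
      - 2 / x 0 * (fderiv ℝ ζ x (N x) * inner ℝ (N x) e)
      + (‖P x‖ ^ 2 - 1 / (x 0) ^ 2 * ‖N x‖ ^ 2) * (ζ x * e 0) := by
  have hdiv : divergence (fun y => ζ y • e) x = fderiv ℝ ζ x e := by
    simp only [divergence, fderiv_smul_const hζ, PiLp.smul_apply, smul_eq_mul]
    have h2 : e = ∑ i, e i • EuclideanSpace.single i (1 : ℝ) := by
      ext j; simp [Pi.single_apply]
    conv_rhs => rw [h2]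
    rw [map_sum]
    simp [mul_comm]
  simp only [firstVariationIntegrand, hdiv, fderiv_smul_const hζ, inner_smul_right, PiLp.smul_apply,
    smul_eq_mul]

lemma fderiv_wt_zero (x e : Rn n) : fderiv ℝ (wt 0) x e = e 0 := by
  have : (wt 0 : Rn n → ℝ) = EuclideanSpace.proj (𝕜 := ℝ) (0 : Fin n) := by
    funext y; rw [wt_zero]; rfl
  rw [this, ContinuousLinearMap.fderiv]; rfl

lemma fderiv_wt_one {x : Rn n} (hx : 0 < x 0) (e : Rn n) :
    fderiv ℝ (wt 1) x e = -(1 / x 0 ^ 2) * e 0 := by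
  have h1 : (wt 1 : Rn n → ℝ) = fun y => (y 0)⁻¹ := by
    funext y; rw [wt_one, one_div]
  have h2 : HasFDerivAt (fun y : Rn n => y 0) (EuclideanSpace.proj (𝕜 := ℝ) (0 : Fin n)) x :=
    (EuclideanSpace.proj (𝕜 := ℝ) (0 : Fin n)).hasFDerivAt
  have h3 := (hasDerivAt_inv hx.ne').comp_hasFDerivAt x h2
  have h4 : HasFDerivAt (wt 1 : Rn n → ℝ) (-(x 0 ^ 2)⁻¹ • EuclideanSpace.proj (𝕜 := ℝ) (0 : Fin n)) x := by
    rw [h1]; exact h3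
  rw [h4.fderiv]
  simp

lemma neg_eq_neg_pos (u : Rn n → ℝ) : neg u = fun x => -pos (fun y => -u y) x := by
  funext x
  rcases le_total (u x) 0 with h | h <;> simp [neg, pos, h]

namespace IsVariationalSolution

variable {Ω : Set (Rn n)} {u : Rn n → ℝ}

lemma isOpen_openPart (hΩ : IsHalfDomain Ω) : IsOpen (openPart Ω) := by
  obtain ⟨Ω', h1, h2⟩ := hΩ.relOpen
  have : openPart Ω = Ω' ∩ halfSpace n := by
    ext x
    simp only [openPart, h2, Set.mem_inter_iff, Set.mem_ofPred_eq, halfSpace]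
    constructor
    · rintro ⟨⟨a, -⟩, b⟩; exact ⟨a, b⟩
    · rintro ⟨a, b⟩; exact ⟨⟨a, le_of_lt b⟩, b⟩
  rw [this]
  exact h1.inter isOpen_halfSpace

lemma isTruncC1_pos (hu : IsVariationalSolution Ω u) (hΩ : IsHalfDomain Ω) :
    IsTruncC1 (openPart Ω) (pos u) (posGrad u) :=
  TwoPhase.isTruncC1_pos (isOpen_openPart hΩ) hu.continuousOn hu.contDiffOn

lemma isTruncC1_neg (hu : IsVariationalSolution Ω u) (hΩ : IsHalfDomain Ω) :
    IsTruncC1 (openPart Ω) (pos fun x => -u x) (posGrad fun x => -u x) := by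
  refine TwoPhase.isTruncC1_pos (isOpen_openPart hΩ) hu.continuousOn.neg ?_
  simpa only [ne_eq, neg_eq_zero] using hu.contDiffOn.neg

lemma weakGrad_pos_ae_eq (hu : IsVariationalSolution Ω u) (hΩ : IsHalfDomain Ω) :
    weakGrad (openPart Ω) (pos u) =ᵐ[volume.restrict (openPart Ω)] posGrad u :=
  (hu.isTruncC1_pos hΩ).ae_eq_of_hasWeakGrad (isOpen_openPart hΩ)
    (hasWeakGrad_weakGrad hu.memV.exists_grad_pos)

lemma weakGrad_neg_ae_eq (hu : IsVariationalSolution Ω u) (hΩ : IsHalfDomain Ω) :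
    weakGrad (openPart Ω) (neg u) =ᵐ[volume.restrict (openPart Ω)] fun x =>
      -posGrad (fun y => -u y) x := by
  have h1 := (hasWeakGrad_weakGrad hu.memV.exists_grad_neg).neg
  have h2 : (fun x => -neg u x) = pos fun y => -u y := by
    funext x; rw [neg_eq_neg_pos, neg_neg]
  rw [h2] at h1
  filter_upwards [(hu.isTruncC1_neg hΩ).ae_eq_of_hasWeakGrad (isOpen_openPart hΩ) h1] with x hx
  rw [← hx, neg_neg]

lemma variation (hu : IsVariationalSolution Ω u) (hΩ : IsHalfDomain Ω) {φ : Rn n → Rn n}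
    (h1 : ContDiff ℝ 1 φ) (h2 : HasCompactSupport φ) (h3 : tsupport φ ∩ {x | 0 ≤ x 0} ⊆ Ω)
    (h4 : ∀ x, x 0 = 0 → φ x 0 = 0) :
    ∫ x in openPart Ω, firstVariationIntegrand (posGrad u) (posGrad fun y => -u y) φ x = 0 := by
  rw [← hu.firstVariation φ h1 h2 h3 h4]
  refine integral_congr_ae ?_
  filter_upwards [hu.weakGrad_pos_ae_eq hΩ, hu.weakGrad_neg_ae_eq hΩ] with x e1 e2
  simp only [firstVariationIntegrand, e1, e2, map_neg, inner_neg_neg, norm_neg]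

/-- Translations of the domain: the field ζ e, with ζ supported in the open half-space, trivially
satisfies the condition on the axis for every direction e. -/
lemma variation_smul_const (hu : IsVariationalSolution Ω u) (hΩ : IsHalfDomain Ω) {V : Set (Rn n)}
    (hVU : V ⊆ openPart Ω) {ζ : Rn n → ℝ} (hζ : ContDiff ℝ 1 ζ) (hc : HasCompactSupport ζ)
    (hs : tsupport ζ ⊆ V) (e : Rn n) :
    ∫ x in V, firstVariationIntegrand (posGrad u) (posGrad fun y => -u y) (fun y => ζ y • e) x = 0 := by
  have hz : ∀ x, x ∉ tsupport ζ → fderiv ℝ ζ x = 0 := fun x hx => fderiv_of_notMem_tsupport ℝ hx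
  have hz0 : ∀ x, x ∉ tsupport ζ → ζ x = 0 := fun x hx => image_eq_zero_of_notMem_tsupport hx
  have hsub : tsupport (fun y => ζ y • e) ⊆ tsupport ζ :=
    closure_mono (Function.support_smul_subset_left ζ fun _ => e)
  have h := hu.variation hΩ (φ := fun y => ζ y • e) (hζ.smul contDiff_const) hc.smul_right
    (fun x hx => (hVU (hs (hsub hx.1))).1) (fun x hx => by
      have : x ∉ tsupport ζ := fun h => by
        have h5 : 0 < x 0 := (hVU (hs h)).2
        exact h5.ne' hx
      simp [hz0 x this])
  rw [← h, setIntegral_eq_integral_of_forall_compl_eq_zero,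
    setIntegral_eq_integral_of_forall_compl_eq_zero]
  all_goals
    intro x hx
    have : x ∉ tsupport ζ := fun h => by first | exact hx (hs h) | exact hx (hVU (hs h))
    rw [firstVariationIntegrand_smul_const _ _ hζ, hz x this, hz0 x this]
    simp

/-- For fields supported in {u > 0} the negative phase drops out, and the φ₁ term of the variation
is the derivative of the weight. So `integral_wt_mul_fderiv_eq_zero` applies. -/
lemma eqn_pos (hu : IsVariationalSolution Ω u) (hΩ : IsHalfDomain Ω) {ζ : Rn n → ℝ}
    (hζ : ContDiff ℝ 1 ζ) (hc : HasCompactSupport ζ) (hs : tsupport ζ ⊆ {x ∈ openPart Ω | 0 < u x}) :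
    ∫ x in {x ∈ openPart Ω | 0 < u x}, wt 0 x * fderiv ℝ ζ x (testGrad u x) = 0 := by
  have hV : IsOpen {x ∈ openPart Ω | 0 < u x} :=
    hu.continuousOn.isOpen_inter_preimage (isOpen_openPart hΩ) isOpen_Ioi
  refine integral_wt_mul_fderiv_eq_zero hV (fun x hx => hx.1.2)
    (hu.contDiffOn.mono fun x hx => ⟨hx.1, hx.2.ne'⟩) (fun ζ hζ hc hs e => ?_) hζ hc hs
  refine Eq.trans ?_ (hu.variation_smul_const hΩ (fun x hx => hx.1) hζ hc hs e)
  refine setIntegral_congr_fun hV.measurableSet fun x hx => ?_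
  rw [firstVariationIntegrand_smul_const _ _ hζ, posGrad_of_pos hx.2,
    posGrad_of_nonpos (neg_nonpos.2 hx.2.le), fderiv_wt_zero, wt_zero,
    show (inner ℝ (testGrad u x) e : ℝ) = fderiv ℝ u x e from
      (real_inner_comm _ _).trans (inner_testGrad ..)]
  simp
  ring

lemma eqn_neg (hu : IsVariationalSolution Ω u) (hΩ : IsHalfDomain Ω) {ζ : Rn n → ℝ}
    (hζ : ContDiff ℝ 1 ζ) (hc : HasCompactSupport ζ) (hs : tsupport ζ ⊆ {x ∈ openPart Ω | 0 < -u x}) :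
    ∫ x in {x ∈ openPart Ω | 0 < -u x}, wt 1 x * fderiv ℝ ζ x (testGrad (fun y => -u y) x) = 0 := by
  have hV : IsOpen {x ∈ openPart Ω | 0 < -u x} :=
    hu.continuousOn.neg.isOpen_inter_preimage (isOpen_openPart hΩ) isOpen_Ioi
  refine integral_wt_mul_fderiv_eq_zero hV (fun x hx => hx.1.2)
    (hu.contDiffOn.neg.mono fun x hx => ⟨hx.1, by linarith [hx.2] |> fun h : u x < 0 => h.ne⟩)
    (fun ζ hζ hc hs e => ?_) hζ hc hs
  refine Eq.trans ?_ (hu.variation_smul_const hΩ (fun x hx => hx.1) hζ hc hs e)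
  refine setIntegral_congr_fun hV.measurableSet fun x hx => ?_
  have h0 : 0 < -u x := hx.2
  have hx0 : 0 < x 0 := hx.1.2
  rw [firstVariationIntegrand_smul_const _ _ hζ, posGrad_of_nonpos (by linarith : u x ≤ 0),
    posGrad_of_pos (w := fun y => -u y) h0, fderiv_wt_one hx0, wt_one,
    show (inner ℝ (testGrad (fun y => -u y) x) e : ℝ) = fderiv ℝ (fun y => -u y) x e from
      (real_inner_comm _ _).trans (inner_testGrad ..)]
  simp
  ring

end IsVariationalSolution

/-! ### Growth of the two phases at the axis and at the origin. -/

lemma norm_add_smul_e₁_le {x : Rn n} (hx : 0 ≤ x 0) {s t : ℝ} (ht : 0 ≤ t) (hts : t ≤ s) :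
    ‖x + t • e₁ n‖ ≤ ‖x + s • e₁ n‖ := by
  have key : ∀ a : ℝ, ‖x + a • e₁ n‖ ^ 2 = ‖x‖ ^ 2 + 2 * (a * x 0) + a ^ 2 := by
    intro a
    rw [norm_add_sq_real, inner_smul_right, norm_smul, norm_e₁, mul_one, Real.norm_eq_abs, sq_abs]
    simp [e₁, EuclideanSpace.inner_single_right]
  refine le_of_sq_le_sq ?_ (norm_nonneg _)
  rw [key, key]
  nlinarith [mul_le_mul_of_nonneg_right hts hx]

lemma exists_box_subset {S : Set (Rn n)} (hS : IsOpen S) {z : Rn n} (hz : z ∈ S) :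
    ∃ ε > 0, ∀ x : Rn n, (∀ i, |x i - z i| < ε) → x ∈ S := by
  have ho : IsOpen ((WithLp.toLp 2 : (Fin n → ℝ) → Rn n) ⁻¹' S) :=
    hS.preimage (PiLp.continuous_toLp 2 _)
  obtain ⟨ε, hε, hb⟩ := Metric.isOpen_iff.1 ho (WithLp.ofLp z) hz
  refine ⟨ε, hε, fun x hx => ?_⟩
  exact hb (show WithLp.ofLp x ∈ ball (WithLp.ofLp z) ε from
    mem_ball.2 ((dist_pi_lt_iff hε).2 fun i => (Real.dist_eq _ _).trans_lt (hx i)))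

/-- A function whose square is integrable against `1 / x₁` vanishes on the axis, so that a bound of
its gradient by a power of `x₁` can be integrated. -/
lemma IsTruncC1.le_of_integrableOn {r L b : ℝ} {g : Rn n → ℝ} {Q : Rn n → Rn n}
    (h : IsTruncC1 (halfBall n r) g Q) (hb : 0 < b)
    (hQ : ∀ x ∈ halfBall n r, ‖Q x‖ ≤ L * x 0 ^ (b - 1))
    (hint : IntegrableOn (fun x => wt 1 x * g x ^ 2) (halfBall n r)) {z : Rn n}
    (hz : z ∈ halfBall n r) : g z ≤ L / b * z 0 ^ b := by
  by_contra hlt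
  have hpos : 0 < g z - L / b * z 0 ^ b := sub_pos.2 (not_le.1 hlt)
  set c := (g z - L / b * z 0 ^ b) / 2 with hc
  have hc0 : 0 < c := half_pos hpos
  have hcont : ContinuousOn (fun x : Rn n => g x - L / b * x 0 ^ b) (halfBall n r) :=
    h.cont.sub (continuousOn_const.mul
      ((continuous_coord 0).continuousOn.rpow_const fun x hx => Or.inl (ne_of_gt hx.1)))
  have hS := hcont.isOpen_inter_preimage (isOpen_halfBall r) (isOpen_Ioi (a := c))
  obtain ⟨ε, hε, hbox⟩ := exists_box_subset hS (z := z) ⟨hz, half_lt_self hpos⟩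
  set a : Fin n → ℝ := fun i => if i = 0 then 0 else z i - ε with ha
  set d : Fin n → ℝ := fun i => if i = 0 then z 0 else z i + ε with hd
  -- Near z the function exceeds (L/b) x₁^b by more than c. Moving down vertically costs at most the
  -- decrease of (L/b) x₁^b, so g > c in the whole column between the axis and z.
  have hlow : ∀ x ∈ box a d, x ∈ halfBall n r ∧ c < g x := by
    intro x hx
    have h0 := hx 0
    simp only [ha, hd, if_true] at h0
    set s := z 0 - x 0 with hs
    have hs0 : 0 ≤ s := sub_nonneg.2 h0.2.le
    have hx' : x + s • e₁ n ∈ halfBall n r ∩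
        (fun x : Rn n => g x - L / b * x 0 ^ b) ⁻¹' Set.Ioi c := by
      refine hbox _ fun i => ?_
      by_cases hi : i = 0
      · subst hi; rw [add_smul_e₁_coord, hs]; simpa using hε
      · have := hx i
        simp only [ha, hd, if_neg hi] at this
        have e : (x + s • e₁ n) i = x i := by simp [e₁, hi]
        rw [e, abs_lt]; constructor <;> linarith [this.1, this.2]
    have hn : ∀ t ∈ Set.Icc 0 s, ‖x + t • e₁ n‖ < r := fun t ht =>
      (norm_add_smul_e₁_le h0.1.le ht.1 ht.2).trans_lt hx'.1.2
    have hv := (abs_le.1 (h.abs_sub_le_vertical hb hQ hs0 h0.1 hn)).2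
    have h2 : c < g (x + s • e₁ n) - L / b * (x + s • e₁ n) 0 ^ b := hx'.2
    rw [add_smul_e₁_coord] at h2
    refine ⟨⟨h0.1, by simpa using hn 0 ⟨le_rfl, hs0⟩⟩, ?_⟩
    have h3 : L / b * ((x 0 + s) ^ b - x 0 ^ b) = L / b * (x 0 + s) ^ b - L / b * x 0 ^ b := by ring
    have hL : 0 ≤ L * x 0 ^ (b - 1) :=
      (norm_nonneg _).trans (hQ x ⟨h0.1, by simpa using hn 0 ⟨le_rfl, hs0⟩⟩)
    have hL0 : 0 ≤ L := nonneg_of_mul_nonneg_left hL (Real.rpow_pos_of_pos h0.1 _)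
    have h4 : 0 ≤ L / b * x 0 ^ b :=
      mul_nonneg (div_nonneg hL0 hb.le) (Real.rpow_nonneg h0.1.le _)
    linarith
  -- On this column g²/x₁ ≥ c²/x₁, whose integral diverges at the axis.
  have htop : ∫⁻ x in box a d, ENNReal.ofReal (1 / x 0) = ⊤ := by
    refine lintegral_box_inv_eq_top (by simp [ha]) fun i => ?_
    by_cases hi : i = 0
    · subst hi; simpa [ha, hd] using hz.1
    · simp only [ha, hd, if_neg hi]; linarith
  have hfin : IntegrableOn (fun x => (c ^ 2)⁻¹ * (wt 1 x * g x ^ 2)) (box a d) :=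
    (hint.mono_set fun x hx => (hlow x hx).1).const_mul _
  refine (lt_of_le_of_lt ?_ hfin.lintegral_lt_top).ne htop
  refine setLIntegral_mono_ae' (measurableSet_box _ _) (ae_of_all _ fun x hx => ?_)
  obtain ⟨h1, h2⟩ := hlow x hx
  refine ENNReal.ofReal_le_ofReal ?_
  have hx0 := h1.1
  rw [wt_one, inv_mul_eq_div, le_div_iff₀ (by positivity)]
  gcongr

namespace IsVariationalSolution

variable {Ω : Set (Rn n)} {u : Rn n → ℝ}

lemma integrableOn_neg_sq (hu : IsVariationalSolution Ω u) {r : ℝ}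
    (hr : halfBall n r ⊆ openPart Ω) :
    IntegrableOn (fun x => wt 1 x * pos (fun y => -u y) x ^ 2) (halfBall n r) := by
  have hle : muNeg (halfBall n r) ≤ muNeg (openPart Ω) :=
    Measure.le_iff.2 fun s hs => by
      rw [muNeg, muNeg, withDensity_apply _ hs, withDensity_apply _ hs]
      exact lintegral_mono' (Measure.restrict_mono_measure (Measure.restrict_mono hr le_rfl) s) le_rfl
  have h := (hu.memV.weighted_neg.mono_measure hle).integrable_sq
  rw [muNeg_eq, integrable_wtMeasure_iff] at h
  refine h.congr (ae_of_all _ fun x => ?_)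
  simp [neg_eq_neg_pos]

end IsVariationalSolution

lemma mem_closure_openPart {Ω : Set (Rn n)} (hΩ : IsHalfDomain Ω) {y : Rn n} (hy : y ∈ Ω) :
    y ∈ closure (openPart Ω) := by
  obtain ⟨Ω', h1, h2⟩ := hΩ.relOpen
  have hy' : y ∈ Ω' ∧ 0 ≤ y 0 := by rw [h2] at hy; exact hy
  have ht : Tendsto (fun t : ℝ => y + t • e₁ n) (𝓝[>] 0) (𝓝 y) := by
    have : Continuous fun t : ℝ => y + t • e₁ n := by fun_prop
    have h3 := this.tendsto 0
    rw [zero_smul, add_zero] at h3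
    exact h3.mono_left nhdsWithin_le_nhds
  refine mem_closure_of_tendsto ht ?_
  filter_upwards [ht (h1.mem_nhds hy'.1), self_mem_nhdsWithin] with t ht1 ht2
  have h5 : 0 < (y + t • e₁ n) 0 := by
    rw [add_smul_e₁_coord]; exact add_pos_of_nonneg_of_pos hy'.2 ht2
  refine ⟨?_, h5⟩
  rw [h2]; exact ⟨ht1, h5.le⟩

/-- `extendFrom` is meaningful only where the limit exists. The Hölder bound makes the values of u
near y a Cauchy filter, and the limit inherits the lower bound c. -/
lemma axisExtend_pos {Ω : Set (Rn n)} (hΩ : IsHalfDomain Ω) {u : Rn n → ℝ} {δ c K β : ℝ} (hc : 0 < c)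
    (hβ : 0 < β) (hlow : ∀ x ∈ halfBall n δ, c ≤ u x)
    (hh : ∀ x ∈ halfBall n δ, ∀ y ∈ halfBall n δ, |u x - u y| ≤ K * ‖x - y‖ ^ β) {y : Rn n}
    (hy : y ∈ Ω) (hyδ : ‖y‖ < δ) : 0 < axisExtend Ω u y := by
  have hcl := mem_closure_openPart hΩ hy
  have hne : (𝓝[openPart Ω] y).NeBot := mem_closure_iff_nhdsWithin_neBot.1 hcl
  have hmem : ∀ᶠ x in 𝓝[openPart Ω] y, x ∈ halfBall n δ := by
    filter_upwards [self_mem_nhdsWithin,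
      nhdsWithin_le_nhds ((isOpen_lt continuous_norm continuous_const).mem_nhds hyδ)] with x h1 h2
    exact ⟨h1.2, h2⟩
  have hcau : Cauchy (map u (𝓝[openPart Ω] y)) := by
    refine Metric.cauchy_iff.2 ⟨hne.map u, fun ε hε => ?_⟩
    have ht : Tendsto (fun p : Rn n × Rn n => K * ‖p.1 - p.2‖ ^ β) (𝓝 (y, y)) (𝓝 0) := by
      have : Continuous fun p : Rn n × Rn n => K * ‖p.1 - p.2‖ ^ β :=
        continuous_const.mul ((by fun_prop : Continuous fun p : Rn n × Rn n => ‖p.1 - p.2‖).rpow_const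
          fun _ => Or.inr hβ.le)
      simpa [Real.zero_rpow hβ.ne'] using this.tendsto (y, y)
    have h1 := ht.eventually (gt_mem_nhds hε)
    rw [nhds_prod_eq] at h1
    obtain ⟨t, ht, h2⟩ := eventually_prod_self_iff (r := fun a b : Rn n => K * ‖a - b‖ ^ β < ε) |>.1 h1
    refine ⟨u '' {x | t x ∧ x ∈ halfBall n δ}, image_mem_map ?_, ?_⟩
    · filter_upwards [nhdsWithin_le_nhds ht, hmem] with x a b using ⟨a, b⟩
    · rintro _ ⟨x, hx, rfl⟩ _ ⟨x', hx', rfl⟩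
      exact (hh x hx.2 x' hx'.2).trans_lt (h2 x hx.1 x' hx'.1)
  obtain ⟨l, hl⟩ := cauchy_map_iff_exists_tendsto.1 hcau
  rw [axisExtend, extendFrom_eq hcl hl]
  exact hc.trans_le (ge_of_tendsto hl (hmem.mono hlow))

/-- At a free boundary point the positive part grows at most at the rate given by its gradient. -/
lemma pos_le_of_onFreeBoundary {Ω : Set (Rn n)} (hΩ : IsHalfDomain Ω) {u : Rn n → ℝ}
    (h0 : OnFreeBoundary Ω u 0) {K β r : ℝ} (hβ : 0 < β) (hβ1 : β ≤ 1) (hK : 0 ≤ K)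
    (hh : ∀ x ∈ halfBall n r, ∀ y ∈ halfBall n r, |pos u x - pos u y| ≤ K * ‖x - y‖ ^ β) {x : Rn n}
    (hx : x ∈ halfBall n r) : pos u x ≤ K * ‖x‖ ^ β := by
  by_contra hlt
  have hr : 0 < r := (norm_nonneg x).trans_lt hx.2
  -- If the bound failed at x, the Hölder estimate would give u ≥ c > 0 in a small half-ball at the
  -- origin. The extension would then be positive at all points of Ω near 0, against the free
  -- boundary condition.
  set c := (pos u x - K * ‖x‖ ^ β) / 2 with hc
  have hc0 : 0 < c := half_pos (sub_pos.2 (not_le.1 hlt))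
  have ht : Tendsto (fun s : ℝ => K * s ^ β) (𝓝[>] 0) (𝓝 0) := by
    have : Continuous fun s : ℝ => K * s ^ β :=
      continuous_const.mul (Real.continuous_rpow_const hβ.le)
    have h3 := this.tendsto 0
    rw [Real.zero_rpow hβ.ne', mul_zero] at h3
    exact h3.mono_left nhdsWithin_le_nhds
  obtain ⟨δ, ⟨hδc, hδ0⟩, hδr⟩ := ((ht.eventually (gt_mem_nhds hc0)).and
    (self_mem_nhdsWithin : Set.Ioi (0 : ℝ) ∈ 𝓝[>] 0) |>.and
    (nhdsWithin_le_nhds (Iic_mem_nhds hr) : Set.Iic r ∈ 𝓝[>] (0 : ℝ))).exists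
  have hδ0' : 0 < δ := hδ0
  have hsub := halfBall_mono (n := n) (show δ ≤ r from hδr)
  have hlow : ∀ y ∈ halfBall n δ, c ≤ pos u y := by
    intro y hy
    have h1 := (abs_le.1 (hh x hx y (hsub hy))).2
    have h2 : ‖x - y‖ ^ β ≤ ‖x‖ ^ β + δ ^ β :=
      (Real.rpow_le_rpow (norm_nonneg _) ((norm_sub_le x y).trans (by linarith [hy.2])) hβ.le).trans
        (Real.rpow_add_le_add_rpow (norm_nonneg _) hδ0'.le hβ.le hβ1)
    have h3 := mul_le_mul_of_nonneg_left h2 hK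
    rw [mul_add] at h3
    have h4 : pos u x - K * ‖x‖ ^ β = 2 * c := by rw [hc]; ring
    linarith
  have heq : ∀ y ∈ halfBall n δ, pos u y = u y := fun y hy =>
    max_eq_left (pos_pos_iff.1 (hc0.trans_le (hlow y hy))).le
  obtain ⟨y, hy, hyΩ, hyn⟩ := mem_closure_iff.1 h0.2.2 (ball 0 δ) isOpen_ball (mem_ball_self hδ0')
  refine hyn (axisExtend_pos hΩ hc0 hβ (fun z hz => heq z hz ▸ hlow z hz) (K := K)
    (fun z hz z' hz' => ?_) hyΩ (by simpa using hy))
  rw [← heq z hz, ← heq z' hz']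
  exact hh z (hsub hz) z' (hsub hz')

lemma integral_wt_mul_posGrad_eq_zero {U V : Set (Rn n)} (hUV : U ⊆ V) {σ : ℝ} {w ζ : Rn n → ℝ}
    (hV : MeasurableSet {x ∈ V | 0 < w x})
    (h : ∫ x in {x ∈ V | 0 < w x}, wt σ x * fderiv ℝ ζ x (testGrad w x) = 0)
    (hs : tsupport ζ ⊆ {x ∈ U | 0 < pos w x}) :
    ∫ x in U, wt σ x * fderiv ℝ ζ x (posGrad w x) = 0 := by
  have hz : ∀ x, x ∉ tsupport ζ → wt σ x * fderiv ℝ ζ x (posGrad w x) = 0 := fun x hx => by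
    simp [fderiv_of_notMem_tsupport ℝ hx]
  refine Eq.trans ?_ h
  rw [setIntegral_eq_integral_of_forall_compl_eq_zero fun x hx => hz x fun h' => hx (hs h').1,
    ← setIntegral_eq_integral_of_forall_compl_eq_zero (s := {x ∈ V | 0 < w x}) fun x hx =>
      hz x fun h' => hx ⟨hUV (hs h').1, pos_pos_iff.1 (hs h').2⟩]
  exact setIntegral_congr_fun hV fun x hx => by simp only [posGrad_of_pos hx.2]

/-! ### From the hypotheses to a pair of phases, and the quantity M. -/

/-- Since x₁ ≤ |x|, the growth bounds weaken to C x₁^(β-1) and C x₁^β. The exponents β-1 and β-1/2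
have to be nonpositive for this, which is where β ≤ 1/2 enters. -/
lemma GrowthBounds.exists_isTwoPhase {Ω : Set (Rn n)} {u : Rn n → ℝ} {β : ℝ} (h : GrowthBounds Ω u β)
    (hΩ : IsHalfDomain Ω) (hu : IsVariationalSolution Ω u) (h0 : OnFreeBoundary Ω u 0) (hβ : 0 < β)
    (hβ1 : β ≤ 1 / 2) :
    ∃ K ρ : ℝ, 0 < ρ ∧ halfBall n ρ ⊆ openPart Ω ∧
      IsTwoPhase β K ρ (pos u) (posGrad u) (fun x => -neg u x) (posGrad fun x => -u x) := by
  obtain ⟨C', r₁, hr₁, hsub, hb1, hb2⟩ := h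
  have hU := isOpen_halfBall (n := n) r₁
  have hsub' : halfBall n r₁ ⊆ openPart Ω := fun x hx => ⟨hsub hx, hx.1⟩
  obtain ⟨Ω', hΩo, hΩe⟩ := hΩ.relOpen
  have h0Ω : (0 : Rn n) ∈ Ω' := by have := h0.1; rw [hΩe] at this; exact this.1
  obtain ⟨r₂, hr₂, hball⟩ := Metric.isOpen_iff.1 hΩo 0 h0Ω
  set C := max C' 0 with hC
  have hC0 : 0 ≤ C := le_max_right _ _
  have hf := (hu.isTruncC1_pos hΩ).mono hsub'
  have hg := (hu.isTruncC1_neg hΩ).mono hsub'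
  have hnx : ∀ x ∈ halfBall n r₁, 0 < ‖x‖ := fun x hx => hx.1.trans_le (coord_le_norm x 0)
  have hP : ∀ x ∈ halfBall n r₁, ‖posGrad u x‖ ≤ C * x 0 ^ (β - 1) := by
    intro x hx
    refine (hf.norm_grad_le_of_ae hU (B := fun x => C * ‖x‖ ^ (β - 1))
      (continuousOn_const.mul (continuous_norm.continuousOn.rpow_const fun y hy =>
        Or.inl (hnx y hy).ne')) (fun y _ => by positivity) ?_ x hx).trans ?_
    · filter_upwards [hb1, ae_restrict_of_ae_restrict_of_subset hsub' (hu.weakGrad_pos_ae_eq hΩ)]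
        with y e1 e2
      rw [← e2]
      exact e1.trans (by gcongr; exact le_max_left _ _)
    · exact mul_le_mul_of_nonneg_left
        (Real.rpow_le_rpow_of_nonpos hx.1 (coord_le_norm x 0) (by linarith)) hC0
  have hQ : ∀ x ∈ halfBall n r₁, ‖posGrad (fun y => -u y) x‖ ≤ C * x 0 ^ (β + 1 - 1) := by
    intro x hx
    refine (hg.norm_grad_le_of_ae hU (B := fun x => C * √(x 0) * ‖x‖ ^ (β - 1 / 2))
      ((continuousOn_const.mul (Real.continuous_sqrt.comp (continuous_coord 0)).continuousOn).mul
        (continuous_norm.continuousOn.rpow_const fun y hy =>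
        Or.inl (hnx y hy).ne')) (fun y _ => by positivity) ?_ x hx).trans ?_
    · filter_upwards [hb2, ae_restrict_of_ae_restrict_of_subset hsub' (hu.weakGrad_neg_ae_eq hΩ)]
        with y e1 e2
      rw [e2, norm_neg] at e1
      exact e1.trans (by gcongr; exact le_max_left _ _)
    · rw [mul_assoc, show β + 1 - 1 = 1 / 2 + (β - 1 / 2) by ring, Real.rpow_add hx.1,
        ← Real.sqrt_eq_rpow]
      have := Real.rpow_le_rpow_of_nonpos hx.1 (coord_le_norm x 0) (show β - 1 / 2 ≤ 0 by linarith)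
      gcongr
  -- The constant of `IsTruncC1.holder`, which dominates all other constants that are needed.
  set K := (2 / β + 1) * C with hK
  have hCK : C ≤ K := by
    have : 0 ≤ 2 / β * C := by positivity
    rw [hK]; linarith
  have hK0 : 0 ≤ K := hC0.trans hCK
  -- The factor 1/3 is lost in `IsTruncC1.holder`; the bound by r₂ keeps the points of {x₁ ≥ 0} with
  -- |x| < ρ in Ω, including those on the axis.
  set ρ := min (r₁ / 3) r₂ with hρ
  have hρ0 : 0 < ρ := lt_min (by positivity) hr₂
  have hρ1 : halfBall n ρ ⊆ halfBall n (r₁ / 3) := halfBall_mono (min_le_left _ _)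
  have hρ2 : halfBall n ρ ⊆ halfBall n r₁ := hρ1.trans (halfBall_mono (by linarith))
  have hρΩ : halfBall n ρ ⊆ openPart Ω := hρ2.trans hsub'
  have hng : (fun x => -neg u x) = pos fun x => -u x := by
    funext x; rw [neg_eq_neg_pos, neg_neg]
  have hUo := IsVariationalSolution.isOpen_openPart hΩ
  refine ⟨K, ρ, hρ0, hρΩ, ?_⟩
  rw [hng]
  refine ⟨⟨hf.mono hρ2, hK0, ?_, ?_, ?_⟩, ⟨hg.mono hρ2, hK0, ?_, ?_, ?_⟩, fun φ hφ ⟨R, hR, hφR⟩ hφ0 => ?_⟩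
  · intro x hx
    rw [add_zero]
    exact (hP x (hρ2 hx)).trans
      (mul_le_mul_of_nonneg_right hCK (Real.rpow_nonneg hx.1.le _))
  · intro x hx
    rw [Real.rpow_zero, mul_one]
    exact pos_le_of_onFreeBoundary hΩ h0 hβ (by linarith) hK0
      (fun y hy z hz => hf.holder hβ (by linarith) hC0 hP hy hz) (hρ1 hx)
  · intro ζ hζ hc hs
    refine integral_wt_mul_posGrad_eq_zero hρΩ
      (hu.continuousOn.isOpen_inter_preimage hUo isOpen_Ioi).measurableSet
      (hu.eqn_pos hΩ hζ hc (hs.trans fun x hx => ⟨hρΩ hx.1, pos_pos_iff.1 hx.2⟩)) hs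
  · intro x hx
    exact (hQ x (hρ2 hx)).trans
      (mul_le_mul_of_nonneg_right hCK (Real.rpow_nonneg hx.1.le _))
  · intro x hx
    have h1 := hg.le_of_integrableOn (by linarith : 0 < β + 1) hQ (hu.integrableOn_neg_sq hsub') (hρ2 hx)
    have hx0 := hx.1
    have h2 : C / (β + 1) ≤ K := (div_le_self hC0 (by linarith)).trans hCK
    calc pos (fun y => -u y) x ≤ C / (β + 1) * x 0 ^ (β + 1) := h1
      _ = C / (β + 1) * x 0 ^ (1 : ℝ) * x 0 ^ β := by
          rw [add_comm β 1, Real.rpow_add hx.1]; ring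
      _ ≤ K * x 0 ^ (1 : ℝ) * ‖x‖ ^ β := by
          gcongr
          exact coord_le_norm x 0
  · intro ζ hζ hc hs
    refine integral_wt_mul_posGrad_eq_zero hρΩ
      (hu.continuousOn.neg.isOpen_inter_preimage hUo isOpen_Ioi).measurableSet
      (hu.eqn_neg hΩ hζ hc (hs.trans fun x hx => ⟨hρΩ hx.1, pos_pos_iff.1 hx.2⟩)) hs
  -- The field may be nonzero for x₁ < 0; only the part of its support in {x₁ ≥ 0} has to lie in Ω.
  · have hsupp : Function.support φ ⊆ closedBall 0 R := fun x hx =>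
      mem_closedBall_zero_iff.2 (not_lt.1 fun h' => hx (hφR x h'.le))
    have hts : tsupport φ ⊆ closedBall 0 R := closure_minimal hsupp isClosed_closedBall
    have hz : ∀ x, x ∉ tsupport φ →
        firstVariationIntegrand (posGrad u) (posGrad fun y => -u y) φ x = 0 := fun x hx => by
      simp [firstVariationIntegrand, divergence, fderiv_of_notMem_tsupport ℝ hx,
        image_eq_zero_of_notMem_tsupport hx]
    have hin : ∀ x ∈ tsupport φ, ‖x‖ < ρ := fun x hx =>
      (mem_closedBall_zero_iff.1 (hts hx)).trans_lt hR
    have hv := hu.variation hΩ hφ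
      (HasCompactSupport.of_support_subset_isCompact (isCompact_closedBall 0 R) hsupp)
      (fun x hx => by
        rw [hΩe]
        exact ⟨hball (mem_ball_zero_iff.2 ((hin x hx.1).trans_le (min_le_right _ _))), hx.2⟩) hφ0
    refine Eq.trans ?_ hv
    exact (setIntegral_eq_of_subset_of_forall_sdiff_eq_zero hUo.measurableSet hρΩ fun x hx =>
      hz x fun h' => hx.2 ⟨hx.1.2, hin x h'⟩).symm

lemma energyJPos_eq (u : Rn n → ℝ) (r : ℝ) : energyJPos u r = sphInt (sqDensity 0 (pos u)) r := by
  simp only [energyJPos, sphInt, densityJPos, sqDensity, wt_zero, sphereMeasure]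

lemma energyJNeg_eq (u : Rn n → ℝ) (r : ℝ) :
    energyJNeg u r = sphInt (sqDensity 1 fun x => -neg u x) r := by
  simp only [energyJNeg, sphInt, densityJNeg, sqDensity, wt_one, sphereMeasure, neg_sq]

lemma IsPhase.integrable_sphere_sqDensity {σ β C ρ : ℝ} {f : Rn n → ℝ} {P : Rn n → Rn n}
    (h : IsPhase σ β C ρ f P) {r : ℝ} (hr : r ∈ Set.Ioo 0 ρ) :
    Integrable (fun y : sphere (0 : Rn n) 1 => sqDensity σ f (r • (y : Rn n))) (sphereMeasure n) := by
  refine ((h.integrable_sphere_sq hr).const_mul (r ^ (1 - 2 * σ))).congr ?_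
  filter_upwards [ae_mem_halfSphere] with y hy
  rw [sqDensity, wt_smul σ hr.1 hy, mul_assoc]

section Weiss

variable {Ω : Set (Rn n)} {u : Rn n → ℝ} {β K ρ : ℝ}

lemma energyDensity_ae_eq (hΩ : IsHalfDomain Ω) (hu : IsVariationalSolution Ω u) {r : ℝ}
    (hr : halfBall n r ⊆ openPart Ω) :
    energyDensity Ω u =ᵐ[volume.restrict (halfBall n r)] fun x =>
      gradDensity 0 (posGrad u) x + gradDensity 1 (posGrad fun y => -u y) x := by
  filter_upwards [ae_restrict_of_ae_restrict_of_subset hr (hu.weakGrad_pos_ae_eq hΩ),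
    ae_restrict_of_ae_restrict_of_subset hr (hu.weakGrad_neg_ae_eq hΩ)] with x e1 e2
  rw [energyDensity, e1, e2, norm_neg, gradDensity, gradDensity, wt_zero, wt_one]

lemma IsTwoPhase.weissFinite (hΩ : IsHalfDomain Ω) (hu : IsVariationalSolution Ω u)
    (hρ : halfBall n ρ ⊆ openPart Ω) (hβ : 0 < β)
    (h : IsTwoPhase β K ρ (TwoPhase.pos u) (posGrad u) (fun x => -TwoPhase.neg u x)
      (posGrad fun x => -u x)) {r : ℝ} (hr : r ∈ Set.Ioo 0 ρ) : WeissFinite Ω u r := by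
  have hsub := halfBall_mono (n := n) hr.2.le
  refine ⟨?_, ?_, ?_⟩
  · exact (((h.pos.integrableOn_gradDensity hβ).mono_set hsub).add
      ((h.neg.integrableOn_gradDensity hβ).mono_set hsub)).congr
      (energyDensity_ae_eq hΩ hu (hsub.trans hρ)).symm
  · have := h.pos.integrable_sphere_sqDensity hr
    simp only [sqDensity, wt_zero] at this
    exact this
  · have := h.neg.integrable_sphere_sqDensity hr
    simp only [sqDensity, wt_one, neg_sq] at this
    exact this

/-- M is formed with weak gradients, `weissFun` with the pointwise ones. They agree almost
everywhere, and the powers of r are absorbed into the spherical means. -/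
lemma IsTwoPhase.weissM_eq (hΩ : IsHalfDomain Ω) (hu : IsVariationalSolution Ω u)
    (hρ : halfBall n ρ ⊆ openPart Ω) (hβ : 0 < β) (hn : 1 ≤ n)
    (h : IsTwoPhase β K ρ (TwoPhase.pos u) (posGrad u) (fun x => -TwoPhase.neg u x)
      (posGrad fun x => -u x)) {r : ℝ} (hr : r ∈ Set.Ioo 0 ρ) :
    weissM Ω u β r = weissFun β (TwoPhase.pos u) (posGrad u) (fun x => -TwoPhase.neg u x)
      (posGrad fun x => -u x) r := by
  have hsub := halfBall_mono (n := n) hr.2.le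
  have hI : energyI Ω u r = (∫ x in halfBall n r, gradDensity 0 (posGrad u) x) +
      ∫ x in halfBall n r, gradDensity 1 (posGrad fun y => -u y) x := by
    rw [energyI, integral_congr_ae (energyDensity_ae_eq hΩ hu (hsub.trans hρ)),
      integral_add ((h.pos.integrableOn_gradDensity hβ).mono_set hsub)
        ((h.neg.integrableOn_gradDensity hβ).mono_set hsub)]
  have h1 := IsPhase.sphereMean_eq (σ := 0) (β := β) (f := TwoPhase.pos u) hn hr.1
  have h2 := IsPhase.sphereMean_eq (σ := 1) (β := β) (f := fun x => -TwoPhase.neg u x) hn hr.1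
  rw [add_zero] at h1
  rw [weissM, weissFun, hI, energyJPos_eq, energyJNeg_eq, h1, h2]
  ring

end Weiss

end TwoPhase

end

theorem mainTheorem4 {n : ℕ} [NeZero n] (hn : 2 ≤ n)
    (Ω : Set (TwoPhase.Rn n)) (hΩ : TwoPhase.IsHalfDomain Ω)
    (u : TwoPhase.Rn n → ℝ) (hu : TwoPhase.IsVariationalSolution Ω u)
    (h0 : TwoPhase.OnFreeBoundary Ω u 0)
    (β : ℝ) (hβ : β ∈ Set.Ioo (0 : ℝ) (1 / 2))
    (hgrowth : TwoPhase.GrowthBounds Ω u β) :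
    ∃ M₀ : ℝ,
      ((∀ᶠ r in 𝓝[>] (0 : ℝ), TwoPhase.WeissFinite Ω u r) ∧
        Tendsto (TwoPhase.weissM Ω u β) (𝓝[>] (0 : ℝ)) (𝓝 M₀)) ∧
      (∀ (r : ℕ → ℝ) (u₀ : TwoPhase.Rn n → ℝ),
        (∀ m, 0 < r m) → Tendsto r atTop (𝓝 0) → TwoPhase.MemVLoc u₀ →
        TwoPhase.WeakConvV (fun m => TwoPhase.blowUp u β (r m)) u₀ →
        TwoPhase.TwoPhaseHomogeneous u₀ β (β + 1) ∧
        TwoPhase.StrongConvV (fun m => TwoPhase.blowUp u β (r m)) u₀) ∧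
      M₀ = 0 := by
  have hn1 : 1 ≤ n := by omega
  obtain ⟨K, ρ, hρ, hρΩ, h⟩ := hgrowth.exists_isTwoPhase hΩ hu h0 hβ.1 hβ.2.le
  have hev : ∀ᶠ r in 𝓝[>] (0 : ℝ), r ∈ Set.Ioo 0 ρ := Ioo_mem_nhdsGT hρ
  refine ⟨0, ⟨?_, ?_⟩, fun r u₀ hr hr0 hu₀ hw => ?_, rfl⟩
  · filter_upwards [hev] with r hr using h.weissFinite hΩ hu hρΩ hβ.1 hr
  · refine (h.tendsto_weissFun hβ.1 hn1 hρ).congr' ?_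
    filter_upwards [hev] with r hr using (h.weissM_eq hΩ hu hρΩ hβ.1 hn1 hr).symm
  · exact h.blowUp_limit hβ.1 (by linarith [hβ.2]) hn1 hρ hr hr0 hu₀ hw
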